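/- Let $m,k$ be integers with $1\le k<m$, and let $\mathcal Cl_m$ be the real Clifford algebra generated by $\mathbb R^m$ with $x^2=-\|x\|^2$, with standard orthonormal basis $e_1,\dots,e_m$ of $\mathbb R^m$. For $\mathcal Cl_m$-valued functions $f(x,u)$ put $D_x=\sum e_i\partial_{x_i}$, $\langle u,D_x\rangle=\sum u_i\partial_{x_i}$, $\langle D_u,D_x\rangle=\sum\partial_{u_i}\partial_{x_i}$, and $$\mathcal D_{1,2n}=\Delta_x^n-\tfrac{4n}{m+2n-2}\langle u,D_x\rangle\langle D_u,D_x\rangle\Delta_x^{n-1},$$ $$\mathcal D_{1,2n-1}=D_x\Delta_x^{n-1}-\tfrac{2}{m+2n-2}\,u\langle D_u,D_x\rangle\Delta_x^{n-1}-\tfrac{4n-4}{m+2n-2}\langle u,D_x\rangle\langle D_u,D_x\rangle\Delta_x^{n-2}D_x$$ (for $n=1$ the last term is absent). Let $Z_1(u,v)$ be the reproducing kernel of the $\mathcal Cl_m$-valued homogeneous polynomials of degree one that are harmonic ($k$ even) or left monogenic ($k$ odd), with respect to $\int_{S^{m-1}}\overline{f}\,g\,dS$. It exists, is unique, and equals $m\langle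 u,v\rangle/|S^{m-1}|$ for $k$ even and $(m\langle u,v\rangle+uv)/|S^{m-1}|$ for $k$ odd. Let $G_k(x)=\|x\|^{k-m}$ for $k$ even, $G_k(x)=x\|x\|^{k-1-m}$ for $k$ odd, and, for a real constant $c_1\ne0$, $$E_{1,k}(x,u,v)=c_1\,G_k(x)\,Z_1\Big(\frac{xux}{\|x\|^2},v\Big).$$ Let $1\le p\le l$, $\mathbb Z^l=\mathbb Ze_1+\dots+\mathbb Ze_l$, $C_l=\mathbb R^m/\mathbb Z^l$ with projection $\pi_l$; write elements of $\mathbb Z^l$ as $\mathbf m+\mathbf n$ with $\mathbf m=m_1e_1+\dots+m_pe_p$ and $\mathbf n\in\mathbb Ze_{p+1}+\dots+\mathbb Ze_l$. Let $E^p$ be the bundle over $C_l$ obtained from $\mathbb R^m\times\mathcal Cl_m$ by identifying $(x,X)$ with $(x+\mathbf m+\mathbf n,(-1)^{m_1+\dots+m_p}X)$. A section $f'(x',u)$ of $E^p$ over an open $U'\subseteq C_l$ has a lift $f$ with $f'(\pi_l(x),u)=[(x,f(x,u))]$, and $\mathcal D_{1,k}$ induces the operator $\mathcal D'_{1,k}f'(\pi_l(x),u)=[(x,\mathcal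 D_{1,k}f(x,u))]$ on such sections. (1) If $1\le l\le m-k-1$, then for all $u,v\in\mathbb R^m$ the series $$cot_{l,1,k,p}(x,u,v)=\sum_{\mathbf m,\mathbf n}(-1)^{m_1+\dots+m_p}E_{1,k}(x+\mathbf m+\mathbf n,u,v)$$ converges normally on $\mathbb R^m\setminus\mathbb Z^l$ (that is, on every compact subset it is dominated by a convergent series of constants). (2) If $l=m-k$, let $\Lambda_l$ be the set of nonzero elements of $\mathbb Z^l$ whose last nonzero coordinate is positive. Then for all $u,v\in\mathbb R^m$ the symmetrized series $$cot_{m-k,1,k,p}(x,u,v)=E_{1,k}(x,u,v)+\sum_{\mathbf m+\mathbf n\in\Lambda_l}(-1)^{m_1+\dots+m_p}\big[E_{1,k}(x+\mathbf m+\mathbf n,u,v)+E_{1,k}(x-\mathbf m-\mathbf n,u,v)\big],$$ summed as the limit for $N\to\infty$ of the partial sums over the elements of $\Lambda_l$ with coordinates of absolute value at most $N$, converges locally uniformly on $\mathbb R^m\setminus\mathbb Z^l$. If $k$ is odd, the series converges normally there (to the same function). (3) In both cases, for $x\in\mathbb R^m\setminus\mathbb Z^l$ and $u,v\in\mathbb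 R^m$, the function $cot_{l,1,k,p}(x,u,v)$ is smooth in $(x,u)$ and is, as a function of $u$, a homogeneous polynomial of degree one, harmonic if $k$ is even and left monogenic if $k$ is odd. It satisfies $cot_{l,1,k,p}(x+\mathbf m+\mathbf n,u,v)=(-1)^{m_1+\dots+m_p}cot_{l,1,k,p}(x,u,v)$ and $\mathcal D_{1,k}\,cot_{l,1,k,p}=0$. Consequently $cot_{l,1,k,p}(x-y,u,v)$ projects to a unique well defined kernel $cot'_{l,1,k,p}(x',y',u,v):E^p_{y'}\to E^p_{x'}$ on $(C_l\times C_l)\setminus\mathrm{diagonal}$, given by $$cot'_{l,1,k,p}(\pi_l(x),\pi_l(y),u,v)\,[(y,Y)]=[(x,cot_{l,1,k,p}(x-y,u,v)\,Y)]$$ for all representatives $x,y$ and all $Y\in\mathcal Cl_m$; and for all $y'$, $v$ and $\eta\in E^p_{y'}$ the section $(x',u)\mapsto cot'_{l,1,k,p}(x',y',u,v)\eta$ of $E^p$ over $C_l\setminus\{y'\}$ is annihilated by $\mathcal D'_{1,k}$. -/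

import Mathlib

open Set Filter Topology MeasureTheory
open scoped ContDiff RealInnerProductSpace

noncomputable section

namespace SpinCylinder

/-! ### The Clifford algebra `Cl_m` -/

/-- Euclidean space `ℝ^m`. -/
abbrev Vec (m : ℕ) : Type := EuclideanSpace ℝ (Fin m)

/-- The quadratic form `x ↦ -‖x‖²`. -/
def negSq (m : ℕ) : QuadraticForm ℝ (Vec m) := -LinearMap.BilinMap.toQuadraticMap (innerₗ (Vec m))

theorem negSq_apply (m : ℕ) (x : Vec m) : negSq m x = -‖x‖ ^ 2 := by
  simp [negSq]

/-- The real Clifford algebra `Cl_m`, in which `x² = -‖x‖²` for `x ∈ ℝ^m`. -/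
abbrev Cl (m : ℕ) : Type := CliffordAlgebra (negSq m)

/-- The inclusion `ℝ^m ⊆ Cl_m`. -/
abbrev vec {m : ℕ} (x : Vec m) : Cl m := CliffordAlgebra.ι (negSq m) x

/-- The standard orthonormal basis vector `e_i` of `ℝ^m`. -/
abbrev e {m : ℕ} (i : Fin m) : Vec m := EuclideanSpace.single i 1

/-- Indices of the basis `e_A`: subsets `A` of `{1, …, m}`, sorted by their cardinality. -/
abbrev Blade (m : ℕ) : Type := Σ n : ℕ, Set.powersetCard (Fin m) n

instance (m : ℕ) : Finite (Blade m) := by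
  refine Finite.of_injective (fun A : Blade m => (A.2 : Finset (Fin m))) ?_
  rintro ⟨n, A, hA⟩ ⟨n', A', hA'⟩ h
  change A = A' at h
  subst h
  have h1 : A.card = n := hA
  have h2 : A.card = n' := hA'
  subst h1
  subst h2
  rfl

instance (m : ℕ) : Fintype (Blade m) := Fintype.ofFinite _

/-- The standard basis `e_A = e_{j_1} ⋯ e_{j_r}` of `Cl_m` (under the linear isomorphism with the
exterior algebra it is the basis of exterior products of the `e_j`). -/
def bladeBasis (m : ℕ) : Module.Basis (Blade m) ℝ (Cl m) :=
  ((DirectSum.Decomposition.isInternal (fun n : ℕ => ⋀[ℝ]^n (Vec m))).collectedBasis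
    (fun n => (EuclideanSpace.basisFun (Fin m) ℝ).toBasis.exteriorPower n)).map
    (CliffordAlgebra.equivExterior (negSq m)).symm

instance (m : ℕ) : FiniteDimensional ℝ (Cl m) := (bladeBasis m).finiteDimensional_of_finite

/-- The linear isomorphism `a = ∑ a_A e_A ↦ (a_A)_A`. -/
def bladeCoord (m : ℕ) : Cl m ≃ₗ[ℝ] EuclideanSpace ℝ (Blade m) :=
  (bladeBasis m).equivFun.trans (WithLp.linearEquiv 2 ℝ (Blade m → ℝ)).symm

/-- The norm `‖∑ a_A e_A‖ = (∑ a_A²)^{1/2}` on `Cl_m`. -/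
instance instNormedCl (m : ℕ) : NormedAddCommGroup (Cl m) :=
  NormedAddCommGroup.induced (Cl m) (EuclideanSpace ℝ (Blade m)) (bladeCoord m)
    (bladeCoord m).injective

instance instNormedSpaceCl (m : ℕ) : NormedSpace ℝ (Cl m) :=
  NormedSpace.induced ℝ (Cl m) (EuclideanSpace ℝ (Blade m)) (bladeCoord m)

/-! ### The differential operators

They act on functions `f(x, u)` on `ℝ^m × ℝ^m` with values in `Cl_m`. -/

/-- Functions `f(x, u)` with values in `Cl_m`. -/
abbrev Fun₂ (m : ℕ) : Type := Vec m → Vec m → Cl m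

/-- `∂_{x_i}`. -/
def dX {m : ℕ} (i : Fin m) (f : Fun₂ m) : Fun₂ m :=
  fun x u => lineDeriv ℝ (fun y => f y u) x (e i)

/-- `∂_{u_i}`. -/
def dU {m : ℕ} (i : Fin m) (f : Fun₂ m) : Fun₂ m :=
  fun x u => lineDeriv ℝ (fun w => f x w) u (e i)

/-- The Dirac operator `D_x = ∑ e_i ∂_{x_i}`. -/
def diracX {m : ℕ} (f : Fun₂ m) : Fun₂ m :=
  fun x u => ∑ i, vec (e i) * dX i f x u

/-- The Laplace operator `Δ_x`. -/
def lapX {m : ℕ} (f : Fun₂ m) : Fun₂ m :=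
  fun x u => Laplacian.laplacian (fun y => f y u) x

/-- `⟨u, D_x⟩ = ∑ u_i ∂_{x_i}`. -/
def innerUDx {m : ℕ} (f : Fun₂ m) : Fun₂ m :=
  fun x u => ∑ i, u i • dX i f x u

/-- `⟨D_u, D_x⟩ = ∑ ∂_{u_i} ∂_{x_i}`. -/
def innerDuDx {m : ℕ} (f : Fun₂ m) : Fun₂ m :=
  fun x u => ∑ i, dU i (dX i f) x u

/-- The bosonic operator
`D_{1,2n} = Δ_x^n - 4n/(m+2n-2) ⟨u,D_x⟩ ⟨D_u,D_x⟩ Δ_x^{n-1}` for `n ≥ 1`. -/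
def bosonic {m : ℕ} (n : ℕ) (f : Fun₂ m) : Fun₂ m := fun x u =>
  (lapX^[n] f) x u
    - (4 * (n : ℝ) / ((m : ℝ) + 2 * n - 2)) • innerUDx (innerDuDx (lapX^[n - 1] f)) x u

/-- The fermionic operator
`D_{1,2n-1} = D_x Δ_x^{n-1} - 2/(m+2n-2) u ⟨D_u,D_x⟩ Δ_x^{n-1}
  - (4n-4)/(m+2n-2) ⟨u,D_x⟩ ⟨D_u,D_x⟩ Δ_x^{n-2} D_x` for `n ≥ 1`.
For `n = 1` the coefficient of the last term is zero. -/
def fermionic {m : ℕ} (n : ℕ) (f : Fun₂ m) : Fun₂ m := fun x u =>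
  diracX (lapX^[n - 1] f) x u
    - (2 / ((m : ℝ) + 2 * n - 2)) • (vec u * innerDuDx (lapX^[n - 1] f) x u)
    - ((4 * (n : ℝ) - 4) / ((m : ℝ) + 2 * n - 2)) •
        innerUDx (innerDuDx (lapX^[n - 2] (diracX f))) x u

open Classical in
/-- The higher order higher spin operator `D_{1,k}` on `ℝ^m`. -/
def opD {m : ℕ} (k : ℕ) (f : Fun₂ m) : Fun₂ m :=
  if Even k then bosonic (k / 2) f else fermionic ((k + 1) / 2) f

/-! ### The reproducing kernel and the fundamental solution -/

/-- The Dirac operator `D_u` on functions of `u` alone. -/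
def diracU {m : ℕ} (g : Vec m → Cl m) : Vec m → Cl m :=
  fun u => ∑ i, vec (e i) * lineDeriv ℝ g u (e i)

/-- `Cl_m`-valued homogeneous polynomials of degree one on `ℝ^m` (that is, linear maps) which are
harmonic if `k` is even and (left) monogenic if `k` is odd. -/
def degreeOne (m k : ℕ) : Set (Vec m → Cl m) :=
  {g | (∃ L : Vec m →ₗ[ℝ] Cl m, ∀ u, g u = L u) ∧
    (Even k → ∀ u, Laplacian.laplacian g u = 0) ∧ (¬ Even k → ∀ u, diracU g u = 0)}

/-- `Z` is the reproducing kernel of `degreeOne m k` with respect to the inner product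
`∫_{S^{m-1}} \bar f g dS`; here `star` is the Clifford conjugation. -/
def IsReproducingKernel (m k : ℕ) (Z : Vec m → Vec m → Cl m) : Prop :=
  (∀ v, (fun u => Z u v) ∈ degreeOne m k) ∧
  ∀ g ∈ degreeOne m k, ∀ v,
    g v = ∫ u : Metric.sphere (0 : Vec m) 1, star (Z u v) * g u ∂(volume : Measure (Vec m)).toSphere

/-- The surface area of the unit sphere `S^{m-1}`. -/
def sphereArea (m : ℕ) : ℝ := (volume : Measure (Vec m)).toSphere.real univ

open Classical in
/-- The kernel `Z_1(u, v)`: `m⟨u,v⟩ / |S^{m-1}|` for even `k`, `(m⟨u,v⟩ + uv) / |S^{m-1}|` for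
odd `k`. -/
def Z₁ (m k : ℕ) (u v : Vec m) : Cl m :=
  (sphereArea m)⁻¹ • (algebraMap ℝ (Cl m) (m * ⟪u, v⟫) + if Even k then 0 else vec u * vec v)

open Classical in
/-- `G_k(x)`: `1/‖x‖^{m-k}` for even `k` and `x/‖x‖^{m-k+1}` for odd `k`. -/
def G (m k : ℕ) (x : Vec m) : Cl m :=
  if Even k then algebraMap ℝ (Cl m) (1 / ‖x‖ ^ ((m : ℤ) - k))
  else (1 / ‖x‖ ^ ((m : ℤ) - k + 1)) • vec x

/-- The vector `x u x` of `ℝ^m ⊆ Cl_m`; see `vec_sandwich`. -/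
def sandwich {m : ℕ} (x u : Vec m) : Vec m := ‖x‖ ^ 2 • u - (2 * ⟪x, u⟫) • x

theorem vec_sandwich {m : ℕ} (x u : Vec m) : vec (sandwich x u) = vec x * vec u * vec x := by
  have h1 : vec x * vec u = -(vec u * vec x) + algebraMap ℝ (Cl m) (-(2 * ⟪x, u⟫)) := by
    have h := CliffordAlgebra.ι_mul_ι_add_swap (Q := negSq m) x u
    have hp : QuadraticMap.polar (negSq m) x u = -(2 * ⟪x, u⟫) := by
      simp only [QuadraticMap.polar, negSq_apply, norm_add_sq_real]
      ring
    rw [hp] at h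
    rw [← h]
    abel
  have h2 : vec x * vec x = algebraMap ℝ (Cl m) (-‖x‖ ^ 2) := by
    rw [CliffordAlgebra.ι_sq_scalar, negSq_apply]
  rw [h1, add_mul, neg_mul, mul_assoc, h2, ← Algebra.commutes, Algebra.algebraMap_eq_smul_one,
    Algebra.algebraMap_eq_smul_one, smul_mul_assoc, smul_mul_assoc, one_mul, one_mul]
  simp only [sandwich, map_sub, map_smul, neg_smul, neg_neg]
  abel

/-- `E_{1,k}(x,u,v) = c_1 G_k(x) Z_1(xux/‖x‖², v)`. -/
def E (m k : ℕ) (c₁ : ℝ) (x u v : Vec m) : Cl m :=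
  c₁ • (G m k x * Z₁ m k ((‖x‖ ^ 2)⁻¹ • sandwich x u) v)

/-! ### The lattice, the cylinder and the spinor bundle `E^p` -/

/-- Integer vectors `(m_1, …, m_l, 0, …, 0)`. -/
def Lat (m l : ℕ) : AddSubgroup (Fin m → ℤ) where
  carrier := {a | ∀ i : Fin m, l ≤ (i : ℕ) → a i = 0}
  zero_mem' := fun _ _ => rfl
  add_mem' := fun {a b} ha hb i hi => by simp [ha i hi, hb i hi]
  neg_mem' := fun {a} ha i hi => by simp [ha i hi]

/-- `(m_1, m_2, …) ↦ m_1 e_1 + m_2 e_2 + ⋯`. -/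
def emb (m : ℕ) : (Fin m → ℤ) →+ Vec m where
  toFun a := WithLp.toLp 2 (fun i => (a i : ℝ))
  map_zero' := by ext i; simp
  map_add' a b := by ext i; simp

theorem emb_injective (m : ℕ) : Function.Injective (emb m) := by
  intro a b h
  funext i
  have h' := congrArg (fun z : Vec m => z i) h
  simpa [emb] using h'

/-- The lattice `ℤ^l = ℤ e_1 + ⋯ + ℤ e_l` in `ℝ^m`. -/
def lattice (m l : ℕ) : AddSubgroup (Vec m) := (Lat m l).map (emb m)

/-- The sign `(-1)^{m_1 + ⋯ + m_p}`. -/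
def sgn {m : ℕ} (p : ℕ) (a : Fin m → ℤ) : ℝ :=
  (-1 : ℝ) ^ (∑ i : Fin m, if (i : ℕ) < p then a i else 0)

theorem sgn_zero {m : ℕ} (p : ℕ) : sgn p (0 : Fin m → ℤ) = 1 := by simp [sgn]

theorem sgn_add {m : ℕ} (p : ℕ) (a b : Fin m → ℤ) : sgn p (a + b) = sgn p a * sgn p b := by
  unfold sgn
  rw [← zpow_add₀ (by norm_num), ← Finset.sum_add_distrib]
  congr 1
  refine Finset.sum_congr rfl fun i _ => ?_
  split_ifs <;> simp

theorem sgn_cases {m : ℕ} (p : ℕ) (a : Fin m → ℤ) : sgn p a = 1 ∨ sgn p a = -1 := by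
  unfold sgn
  rcases Int.even_or_odd (∑ i : Fin m, if (i : ℕ) < p then a i else 0) with h | h
  · exact Or.inl h.neg_one_zpow
  · exact Or.inr h.neg_one_zpow

theorem sgn_neg_mul {m : ℕ} (p : ℕ) (a : Fin m → ℤ) : sgn p (-a) * sgn p a = 1 := by
  rw [← sgn_add, neg_add_cancel, sgn_zero]

/-- The cylinder `C_l = ℝ^m / ℤ^l`. -/
abbrev Cyl (m l : ℕ) : Type := Vec m ⧸ lattice m l

/-- The projection `π_l : ℝ^m → C_l`. -/
abbrev proj (m l : ℕ) (x : Vec m) : Cyl m l := QuotientAddGroup.mk x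

theorem proj_eq_iff {m l : ℕ} {x y : Vec m} :
    proj m l x = proj m l y ↔ ∃ a ∈ Lat m l, y = x + emb m a := by
  rw [QuotientAddGroup.eq]
  constructor
  · rintro ⟨a, ha, h⟩
    exact ⟨a, ha, by rw [h]; abel⟩
  · rintro ⟨a, ha, h⟩
    exact ⟨a, ha, by rw [h]; abel⟩

/-- The identification of `(x, X)` with `(x + 𝐦 + 𝐧, (-1)^{m_1 + ⋯ + m_p} X)`. -/
def bundleSetoid (m l p : ℕ) : Setoid (Vec m × Cl m) where
  r P Q := ∃ a ∈ Lat m l, Q.1 = P.1 + emb m a ∧ Q.2 = sgn p a • P.2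
  iseqv := by
    refine ⟨fun P => ⟨0, zero_mem _, by simp, by simp [sgn_zero]⟩, ?_, ?_⟩
    · rintro P Q ⟨a, ha, h1, h2⟩
      exact ⟨-a, neg_mem ha, by simp [h1], by rw [h2, smul_smul, sgn_neg_mul, one_smul]⟩
    · rintro P Q R ⟨a, ha, h1, h2⟩ ⟨b, hb, h3, h4⟩
      refine ⟨a + b, add_mem ha hb, by rw [h3, h1, map_add, add_assoc], ?_⟩
      rw [h4, h2, smul_smul, ← sgn_add, add_comm b a]

/-- The total space of the spinor bundle `E^p` over `C_l`. -/
def Bundle (m l p : ℕ) : Type := Quotient (bundleSetoid m l p)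

/-- The class of `(x, X)` in `E^p`. -/
def Bundle.mk {m : ℕ} (l p : ℕ) (x : Vec m) (X : Cl m) : Bundle m l p :=
  Quotient.mk (bundleSetoid m l p) (x, X)

theorem Bundle.mk_eq_iff {m l p : ℕ} {x y : Vec m} {X Y : Cl m} :
    Bundle.mk l p x X = Bundle.mk l p y Y ↔
      ∃ a ∈ Lat m l, y = x + emb m a ∧ Y = sgn p a • X :=
  Quotient.eq (r := bundleSetoid m l p)

/-- The bundle projection `E^p → C_l`. -/
def Bundle.base {m l p : ℕ} : Bundle m l p → Cyl m l :=
  Quotient.lift (fun P => proj m l P.1) (by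
    rintro P Q ⟨a, ha, h, -⟩
    exact proj_eq_iff.2 ⟨a, ha, h⟩)

/-- The fibre of `E^p` over a point of `C_l`. -/
def Fiber {m l : ℕ} (p : ℕ) (x' : Cyl m l) : Type := {ξ : Bundle m l p // ξ.base = x'}

/-- The class of `(x, X)` as a point of the fibre over `π_l(x)`. -/
def Fiber.mk {m : ℕ} (l p : ℕ) (x : Vec m) (X : Cl m) : Fiber p (proj m l x) :=
  ⟨Bundle.mk l p x X, rfl⟩

theorem Fiber.exists_rep {m l p : ℕ} (x : Vec m) (ξ : Fiber p (proj m l x)) :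
    ∃ X, ξ = Fiber.mk l p x X := by
  obtain ⟨ξ, hξ⟩ := ξ
  induction ξ using Quotient.inductionOn with
  | _ P =>
    obtain ⟨y, Y⟩ := P
    obtain ⟨a, ha, h⟩ := proj_eq_iff.1 (show proj m l y = proj m l x from hξ)
    exact ⟨sgn p a • Y, Subtype.ext (Bundle.mk_eq_iff.2 ⟨a, ha, h, rfl⟩)⟩

/-- The element `X` of `Cl_m` with `ξ = [(x, X)]`. -/
def Fiber.coord {m l p : ℕ} (x : Vec m) (ξ : Fiber p (proj m l x)) : Cl m :=
  (Fiber.exists_rep x ξ).choose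

theorem Fiber.mk_coord {m l p : ℕ} (x : Vec m) (ξ : Fiber p (proj m l x)) :
    Fiber.mk l p x (Fiber.coord x ξ) = ξ :=
  (Fiber.exists_rep x ξ).choose_spec.symm

theorem Fiber.mk_injective {m l p : ℕ} (x : Vec m) : Function.Injective (Fiber.mk l p x) := by
  intro X Y h
  obtain ⟨a, -, h1, h2⟩ := Bundle.mk_eq_iff.1 (congrArg Subtype.val h)
  have h3 : emb m a = emb m 0 := by
    rw [map_zero]
    exact (left_eq_add.1 h1)
  rw [emb_injective m h3, sgn_zero, one_smul] at h2
  exact h2.symm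

theorem Fiber.coord_mk {m l p : ℕ} (x : Vec m) (X : Cl m) :
    Fiber.coord x (Fiber.mk l p x X) = X :=
  Fiber.mk_injective x (Fiber.mk_coord x _)

/-- The zero vector of the fibre over `x'`. -/
def Fiber.zero {m l : ℕ} (p : ℕ) (x' : Cyl m l) : Fiber p x' :=
  ⟨Quotient.lift (fun x : Vec m => Bundle.mk l p x 0) (by
      intro x y h
      obtain ⟨a, ha, h⟩ := proj_eq_iff.1 (Quotient.sound h : proj m l x = proj m l y)
      exact Bundle.mk_eq_iff.2 ⟨a, ha, h, by simp⟩) x', by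
    induction x' using Quotient.inductionOn with
    | _ x => rfl⟩

/-! ### The operator on sections of `E^p` -/

/-- Sections `f'(x', u)` of `E^p` over `U' ⊆ C_l`, depending on the variable `u`. -/
abbrev Sec {m l : ℕ} (p : ℕ) (U' : Set (Cyl m l)) : Type :=
  (x' : U') → Vec m → Fiber p x'.1

open Classical in
/-- The lift of a section to `ℝ^m`: `f'(π_l(x), u) = [(x, f(x, u))]` for `π_l(x) ∈ U'`
(extended by zero outside the preimage of `U'`). -/
def Sec.lift {m l p : ℕ} {U' : Set (Cyl m l)} (s : Sec p U') : Fun₂ m := fun x u =>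
  if h : proj m l x ∈ U' then Fiber.coord x (s ⟨proj m l x, h⟩ u) else 0

theorem Sec.lift_add {m l p : ℕ} {U' : Set (Cyl m l)} (s : Sec p U') {a : Fin m → ℤ}
    (ha : a ∈ Lat m l) (x u : Vec m) : s.lift (x + emb m a) u = sgn p a • s.lift x u := by
  have hx : proj m l x = proj m l (x + emb m a) := proj_eq_iff.2 ⟨a, ha, rfl⟩
  by_cases h : proj m l x ∈ U'
  · have h' : proj m l (x + emb m a) ∈ U' := hx ▸ h
    simp only [Sec.lift, dif_pos h, dif_pos h']
    have key : (s ⟨proj m l x, h⟩ u).1 = (s ⟨proj m l (x + emb m a), h'⟩ u).1 := by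
      have : (⟨proj m l x, h⟩ : U') = ⟨proj m l (x + emb m a), h'⟩ := Subtype.ext hx
      rw [this]
    apply Fiber.mk_injective (l := l) (p := p) (x + emb m a)
    rw [Fiber.mk_coord]
    apply Subtype.ext
    rw [← key]
    conv_lhs => rw [← Fiber.mk_coord x (s ⟨proj m l x, h⟩ u)]
    exact Bundle.mk_eq_iff.2 ⟨a, ha, rfl, rfl⟩
  · have h' : proj m l (x + emb m a) ∉ U' := hx ▸ h
    simp only [Sec.lift, dif_neg h, dif_neg h', smul_zero]

/-- `f(x + t, u) = ε f(x, u)`. -/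
def Equivar {m : ℕ} (t : Vec m) (ε : ℝ) (f : Fun₂ m) : Prop :=
  ∀ x u, f (x + t) u = ε • f x u

section Equivariance

variable {m : ℕ} {t : Vec m} {ε : ℝ} {f : Fun₂ m}

theorem Equivar.dX (h : Equivar t ε f) (i : Fin m) : Equivar t ε (dX i f) := by
  intro x u
  have : (fun s : ℝ => f (x + t + s • e i) u) = fun s : ℝ => ε • f (x + s • e i) u := by
    funext s
    rw [← h, add_right_comm]
  simp only [SpinCylinder.dX, lineDeriv, this]
  exact deriv_const_smul_field ε _

theorem Equivar.dU (h : Equivar t ε f) (i : Fin m) : Equivar t ε (dU i f) := by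
  intro x u
  simp only [SpinCylinder.dU, lineDeriv, h x]
  exact deriv_const_smul_field ε _

theorem Equivar.diracX (h : Equivar t ε f) : Equivar t ε (diracX f) := by
  intro x u
  simp only [SpinCylinder.diracX, h.dX _ x u, mul_smul_comm, Finset.smul_sum]

theorem Equivar.innerUDx (h : Equivar t ε f) : Equivar t ε (innerUDx f) := by
  intro x u
  simp only [SpinCylinder.innerUDx, h.dX _ x u, Finset.smul_sum]
  exact Finset.sum_congr rfl fun i _ => smul_comm _ _ _

theorem Equivar.innerDuDx (h : Equivar t ε f) : Equivar t ε (innerDuDx f) := by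
  intro x u
  simp only [SpinCylinder.innerDuDx, (h.dX _).dU _ x u, Finset.smul_sum]

theorem Equivar.lapX (hε : ε = 1 ∨ ε = -1) (h : Equivar t ε f) : Equivar t ε (lapX f) := by
  intro x u
  have h1 : Laplacian.laplacian (fun y => f y u) (x + t)
      = Laplacian.laplacian (fun y => f (y + t) u) x := by
    simp only [InnerProductSpace.laplacian_eq_iteratedFDeriv_stdOrthonormalBasis]
    refine Finset.sum_congr rfl fun i _ => ?_
    rw [iteratedFDeriv_comp_add_right (f := fun y => f y u) 2 t x]
  simp only [SpinCylinder.lapX, h1, h _ u]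
  rcases hε with rfl | rfl
  · simp
  · have h2 : (fun y => (-1 : ℝ) • f y u) = -(fun y => f y u) := by funext y; simp
    rw [h2, InnerProductSpace.laplacian_neg]
    simp

theorem Equivar.lapX_iterate (hε : ε = 1 ∨ ε = -1) (h : Equivar t ε f) (n : ℕ) :
    Equivar t ε (SpinCylinder.lapX^[n] f) := by
  induction n with
  | zero => exact h
  | succ n ih =>
    rw [Function.iterate_succ_apply']
    exact ih.lapX hε

theorem Equivar.opD (hε : ε = 1 ∨ ε = -1) (h : Equivar t ε f) (k : ℕ) :
    Equivar t ε (opD k f) := by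
  intro x u
  unfold SpinCylinder.opD
  split_ifs
  · simp only [bosonic, h.lapX_iterate hε _ x u,
      (h.lapX_iterate hε _).innerDuDx.innerUDx x u, smul_sub]
    rw [smul_comm]
  · simp only [fermionic, (h.lapX_iterate hε _).diracX x u, (h.lapX_iterate hε _).innerDuDx x u,
      (h.diracX.lapX_iterate hε _).innerDuDx.innerUDx x u, smul_sub, mul_smul_comm]
    rw [smul_comm ε, smul_comm ε]

end Equivariance

/-- The operator induced by `D_{1,k}` on sections of `E^p`: if `f'` lifts to `f`, the value at
`π_l(x)` is the class of `(x, (D_{1,k} f)(x, u))`, for any representative `x`. -/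
def Sec.opD {m l p : ℕ} {U' : Set (Cyl m l)} (k : ℕ) (s : Sec p U') : Sec p U' := fun x' u =>
  ⟨Quotient.lift (fun x : Vec m => Bundle.mk l p x (SpinCylinder.opD k s.lift x u)) (by
      intro x y h
      obtain ⟨a, ha, rfl⟩ := proj_eq_iff.1 (Quotient.sound h : proj m l x = proj m l y)
      exact Bundle.mk_eq_iff.2 ⟨a, ha, rfl,
        Equivar.opD (sgn_cases p a) (fun x u => s.lift_add ha x u) k x u⟩) x'.1, by
    obtain ⟨x', hx'⟩ := x'
    induction x' using Quotient.inductionOn with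
    | _ x => rfl⟩

/-! ### The cotangent kernels -/

/-- Normal convergence of the series `∑ f_i` on `S`: on each compact subset of `S` it is dominated
by a convergent series of constants. -/
def ConvergesNormallyOn {ι : Type} {m : ℕ} (f : ι → Vec m → Cl m) (S : Set (Vec m)) : Prop :=
  ∀ K ⊆ S, IsCompact K → ∃ b : ι → ℝ, Summable b ∧ ∀ i, ∀ x ∈ K, ‖f i x‖ ≤ b i

/-- The terms `(-1)^{m_1+⋯+m_p} E_{1,k}(x + 𝐦 + 𝐧, u, v)`. -/
def twistTerm (m l k p : ℕ) (c₁ : ℝ) (u v : Vec m) (a : Lat m l) (x : Vec m) : Cl m :=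
  sgn p a.1 • E m k c₁ (x + emb m a) u v

/-- `cot_{l,1,k,p}(x,u,v)` for `l ≤ m-k-1`. -/
def cot (m l k p : ℕ) (c₁ : ℝ) (x u v : Vec m) : Cl m :=
  ∑' a : Lat m l, twistTerm m l k p c₁ u v a x

/-- The positive part `Λ_l` of the lattice: the vectors `m_1 e_1 + ⋯ + m_j e_j` with `j ≤ l` and
`m_j > 0`. -/
def latPos (m l : ℕ) : Set (Fin m → ℤ) :=
  {a | a ∈ Lat m l ∧ ∃ j, 0 < a j ∧ ∀ i, j < i → a i = 0}

open Classical in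
/-- The elements of `Λ_l` with coordinates of absolute value at most `N`. -/
def posBox (m l N : ℕ) : Finset (Fin m → ℤ) :=
  (Fintype.piFinset fun _ => Finset.Icc (-(N : ℤ)) N).filter (· ∈ latPos m l)

/-- The terms `(-1)^{m_1+⋯+m_p} [E_{1,k}(x + 𝐦 + 𝐧, u, v) + E_{1,k}(x - 𝐦 - 𝐧, u, v)]`. -/
def symTerm (m k p : ℕ) (c₁ : ℝ) (u v : Vec m) (a : Fin m → ℤ) (x : Vec m) : Cl m :=
  sgn p a • (E m k c₁ (x + emb m a) u v + E m k c₁ (x - emb m a) u v)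

/-- The partial sums of the symmetrized series over `posBox m l N`. -/
def symPartial (m l k p : ℕ) (c₁ : ℝ) (u v : Vec m) (N : ℕ) (x : Vec m) : Cl m :=
  E m k c₁ x u v + ∑ a ∈ posBox m l N, symTerm m k p c₁ u v a x

/-- The symmetrized `cot_{l,1,k,p}(x,u,v)` for `l = m-k`, as the limit of its partial sums. -/
def cotSym (m l k p : ℕ) (c₁ : ℝ) (x u v : Vec m) : Cl m :=
  limUnder atTop (fun N => symPartial m l k p c₁ u v N x)

/-- `c(x,u,v)` is a sign-twisted kernel of `D_{1,k}` on `ℝ^m \ ℤ^l`: it is smooth there, a harmonic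
or monogenic polynomial of degree one in `u`, sign-periodic, and annihilated by `D_{1,k}`. -/
structure IsTwistedKernel (m l k p : ℕ) (c : Vec m → Vec m → Vec m → Cl m) : Prop where
  smooth : ∀ v, ContDiffOn ℝ ∞ (fun q : Vec m × Vec m => c q.1 q.2 v)
    ((lattice m l : Set (Vec m))ᶜ ×ˢ univ)
  degree_one : ∀ x ∉ lattice m l, ∀ v, (fun u => c x u v) ∈ degreeOne m k
  periodic : ∀ a ∈ Lat m l, ∀ x ∉ lattice m l, ∀ u v, c (x + emb m a) u v = sgn p a • c x u v
  annihilated : ∀ x ∉ lattice m l, ∀ u v, opD k (fun y w => c y w v) x u = 0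

/-- Kernels on `(C_l × C_l) \ diagonal`, for fixed `u, v`, between the fibres of `E^p`: the value
at `(x', y')` takes the fibre over `y'` to the fibre over `x'`. -/
abbrev BundleKernel (m l p : ℕ) : Type :=
  (x' y' : Cyl m l) → x' ≠ y' → Vec m → Vec m → Fiber p y' → Fiber p x'

/-- `K` is the projection of `c(x - y, u, v)`:
`K(π_l(x), π_l(y), u, v) [(y, Y)] = [(x, c(x - y, u, v) Y)]` for all representatives `x, y`. -/
def IsProjection {m l p : ℕ} (c : Vec m → Vec m → Vec m → Cl m) (K : BundleKernel m l p) : Prop :=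
  ∀ (x y : Vec m) (h : proj m l x ≠ proj m l y) (u v : Vec m) (Y : Cl m),
    K (proj m l x) (proj m l y) h u v (Fiber.mk l p y Y) = Fiber.mk l p x (c (x - y) u v * Y)

/-- The section `(x', u) ↦ K(x', y', u, v) η` of `E^p` over `C_l \ {y'}`. -/
def BundleKernel.sec {m l p : ℕ} (K : BundleKernel m l p) (y' : Cyl m l) (v : Vec m)
    (η : Fiber p y') : Sec p ({y'}ᶜ : Set (Cyl m l)) :=
  fun x' u => K x'.1 y' x'.2 u v η

end SpinCylinder

end

open SpinCylinder

noncomputable section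

namespace SpinCylinder

/-! ### Smooth functions on an open set and their operators -/

open TopologicalSpace (Opens)

/-! Everything rests on one cancellation. Since p ≥ 1, the lattice vector δ = e_1 has sign -1, so
formally ∑ ± f(x + a) = ½ ∑ ± (f(x + a) - f(x + a + δ)). The function f = E_{1,k}(·, u, v) is smooth
off the origin and homogeneous of degree k - m ≤ -l. It is therefore O(‖x‖^{-l}) at infinity, and
its differences are O(‖x‖^{-l-1}), which is summable over a lattice of rank at most l. The
right-hand side, `periodize`, thus converges absolutely and locally uniformly, with all derivatives,
even in the critical case l = m - k, and the properties of the kernel are proved for it once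
(`isTwistedKernel_of_periodize`).

For l ≤ m - k - 1 the original series is absolutely convergent and a reindexing identifies the two
sums (`Decay.periodize_eq_tsum`). For l = m - k a symmetrized partial sum is the sum over a box,
which differs from the corresponding sum of half differences only by two faces: O(N^{l-1}) terms of
size O(N^{-l}) (`tendstoUniformlyOn_sum_latBox`). If k is odd, E_{1,k} is odd in x, so that pairing
a with -a already produces differences and normal convergence (`exists_summable_bound_symTerm`).

The equation D_{1,k} E_{1,k} = 0 is pure operator algebra. All functions involved are linear in u,
so the operators become endomorphisms of `Sm U`, and ∂_u of a linear map is evaluation. What remains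
are commutation rules between Δ, D, multiplication by ⟨x,u⟩ and Clifford multiplication, together
with Δ^n ‖x‖^{2n-m} = 0 (`opLin_evenFam`, `opLin_oddFam`). The equation passes to the periodization,
and to right multiples by constants, through `opLin_mem`: any linear relation respected by
directional derivatives and left multiplications is respected by D_{1,k}.

The reproducing property reduces, for linear functions, to the second moments of the sphere
(`integral_bilinear`). The statements on the bundle follow from sign-periodicity and translation
invariance. -/

/-- `Cl_m`-valued functions which are smooth on the open set `U` and vanish outside `U`. -/
def Sm {m : ℕ} (U : Opens (Vec m)) : Submodule ℝ (Vec m → Cl m) where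
  carrier := {f | ContDiffOn ℝ ∞ f U ∧ ∀ x ∉ U, f x = 0}
  zero_mem' := ⟨contDiffOn_const, fun _ _ => rfl⟩
  add_mem' := fun ha hb => ⟨ha.1.add hb.1, fun x hx => by simp [ha.2 x hx, hb.2 x hx]⟩
  smul_mem' := fun c f hf => ⟨contDiffOn_const.smul hf.1, fun x hx => by simp [hf.2 x hx]⟩

namespace Sm

variable {m : ℕ} {U : Opens (Vec m)}

instance : CoeFun (Sm U) (fun _ => Vec m → Cl m) := ⟨Subtype.val⟩

theorem contDiffOn (f : Sm U) : ContDiffOn ℝ ∞ f U := f.2.1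

theorem contDiffAt (f : Sm U) {x : Vec m} (hx : x ∈ U) : ContDiffAt ℝ ∞ f x :=
  (contDiffOn f).contDiffAt (U.isOpen.mem_nhds hx)

theorem differentiableAt (f : Sm U) {x : Vec m} (hx : x ∈ U) : DifferentiableAt ℝ f x :=
  (contDiffAt f hx).differentiableAt (by simp)

theorem apply_of_notMem (f : Sm U) {x : Vec m} (hx : x ∉ U) : f x = 0 := f.2.2 x hx

theorem ext_on {f g : Sm U} (h : ∀ x ∈ U, f x = g x) : f = g := by
  apply Subtype.ext
  funext x
  by_cases hx : x ∈ U
  · exact h x hx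
  · rw [apply_of_notMem f hx, apply_of_notMem g hx]

@[simp] theorem add_apply (f g : Sm U) (x : Vec m) : (f + g : Sm U) x = f x + g x := rfl
@[simp] theorem sub_apply (f g : Sm U) (x : Vec m) : (f - g : Sm U) x = f x - g x := rfl
@[simp] theorem neg_apply (f : Sm U) (x : Vec m) : (-f : Sm U) x = -f x := rfl
@[simp] theorem smul_apply (c : ℝ) (f : Sm U) (x : Vec m) : (c • f : Sm U) x = c • f x := rfl
@[simp] theorem zero_apply (x : Vec m) : (0 : Sm U) x = 0 := rfl

@[simp] theorem sum_apply {ι : Type*} (s : Finset ι) (f : ι → Sm U) (x : Vec m) :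
    (∑ i ∈ s, f i : Sm U) x = ∑ i ∈ s, f i x := by
  change (Sm U).subtype (∑ i ∈ s, f i) x = _
  rw [map_sum, Finset.sum_apply]
  rfl

open Classical in
/-- The element of `Sm U` given by a function which is smooth on `U`. -/
def of (g : Vec m → Cl m) (hg : ContDiffOn ℝ ∞ g U) : Sm U :=
  ⟨(U : Set (Vec m)).indicator g, hg.congr fun _ hx => indicator_of_mem hx g,
    fun _ hx => indicator_of_notMem (s := (U : Set (Vec m))) hx g⟩

theorem of_apply {g : Vec m → Cl m} {hg : ContDiffOn ℝ ∞ g U} {x : Vec m} (hx : x ∈ U) :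
    of g hg x = g x := indicator_of_mem (s := (U : Set (Vec m))) hx g

theorem fderiv_apply_contDiffOn (f : Sm U) (w : Vec m) :
    ContDiffOn ℝ ∞ (fun x => fderiv ℝ f x w) U :=
  ((contDiffOn f).fderiv_of_isOpen U.isOpen (m := ∞) (by simp)).clm_apply contDiffOn_const

/-- The directional derivative `∂_w`. -/
def pd : Vec m →ₗ[ℝ] Module.End ℝ (Sm U) :=
  LinearMap.mk₂ ℝ (fun w f => of (fun x => fderiv ℝ f x w) (fderiv_apply_contDiffOn f w))
    (fun w z f => ext_on fun x hx => by simp [of_apply hx])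
    (fun c w f => ext_on fun x hx => by simp [of_apply hx])
    (fun w f g => ext_on fun x hx => by
      simp only [of_apply hx, add_apply]
      change fderiv ℝ (f.1 + g.1) x w = _
      rw [fderiv_add (differentiableAt f hx) (differentiableAt g hx)]
      rfl)
    (fun c w f => ext_on fun x hx => by
      simp only [of_apply hx, smul_apply]
      change fderiv ℝ (c • f.1) x w = _
      rw [fderiv_const_smul (differentiableAt f hx)]
      rfl)

theorem pd_apply (w : Vec m) (f : Sm U) {x : Vec m} (hx : x ∈ U) :
    pd w f x = fderiv ℝ f x w :=
  of_apply (hg := fderiv_apply_contDiffOn f w) hx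

theorem lineDeriv_eq_pd (w : Vec m) (f : Sm U) {g : Vec m → Cl m} (h : ∀ x ∈ U, g x = f x)
    {x : Vec m} (hx : x ∈ U) : lineDeriv ℝ g x w = pd w f x := by
  have h1 : g =ᶠ[𝓝 x] f := by
    filter_upwards [U.isOpen.mem_nhds hx] with y hy using h y hy
  rw [h1.lineDeriv_eq, pd_apply w f hx, (differentiableAt f hx).lineDeriv_eq_fderiv]

/-- Multiplication by `⟨x, w⟩`. -/
def X : Vec m →ₗ[ℝ] Module.End ℝ (Sm U) :=
  LinearMap.mk₂ ℝ (fun w f => ⟨fun x => ⟪x, w⟫ • f x,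
      ((contDiff_id.inner ℝ contDiff_const).contDiffOn).smul (contDiffOn f),
      fun x hx => by simp [apply_of_notMem f hx]⟩)
    (fun w z f => ext_on fun x hx => by simp [inner_add_right, add_smul])
    (fun c w f => ext_on fun x hx => by simp [inner_smul_right, mul_smul])
    (fun w f g => ext_on fun x hx => by simp)
    (fun c w f => ext_on fun x hx => by simp only [smul_apply]; exact smul_comm _ _ _)

@[simp] theorem X_apply (w : Vec m) (f : Sm U) (x : Vec m) : X w f x = ⟪x, w⟫ • f x := rfl

/-- Post-composition with a linear map. -/
def post : (Cl m →ₗ[ℝ] Cl m) →ₗ[ℝ] Module.End ℝ (Sm U) :=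
  LinearMap.mk₂ ℝ (fun A f => ⟨fun x => A (f x),
      (LinearMap.toContinuousLinearMap A).contDiff.comp_contDiffOn (contDiffOn f),
      fun x hx => by simp [apply_of_notMem f hx]⟩)
    (fun A B f => ext_on fun x hx => by simp)
    (fun c A f => ext_on fun x hx => by simp)
    (fun A f g => ext_on fun x hx => by simp)
    (fun c A f => ext_on fun x hx => by simp)

@[simp] theorem post_apply (A : Cl m →ₗ[ℝ] Cl m) (f : Sm U) (x : Vec m) :
    post A f x = A (f x) := rfl

/-- Left multiplication by an element of `Cl_m`. -/
def lm : Cl m →ₗ[ℝ] Module.End ℝ (Sm U) := post ∘ₗ LinearMap.mul ℝ (Cl m)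

/-- Right multiplication by an element of `Cl_m`. -/
def rm : Cl m →ₗ[ℝ] Module.End ℝ (Sm U) := post ∘ₗ (LinearMap.mul ℝ (Cl m)).flip

@[simp] theorem lm_apply (a : Cl m) (f : Sm U) (x : Vec m) : lm a f x = a * f x := rfl

@[simp] theorem rm_apply (a : Cl m) (f : Sm U) (x : Vec m) : rm a f x = f x * a := rfl

theorem fderiv_fderiv_apply (f : Sm U) (w z : Vec m) {x : Vec m} (hx : x ∈ U) :
    pd w (pd z f) x = fderiv ℝ (fderiv ℝ f) x w z := by
  have h1 : (pd z f : Vec m → Cl m) =ᶠ[𝓝 x] fun y => fderiv ℝ f y z := by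
    filter_upwards [U.isOpen.mem_nhds hx] with y hy using pd_apply z f hy
  have h2 : DifferentiableAt ℝ (fderiv ℝ f) x :=
    ((contDiffAt f hx).fderiv_right (m := 1) (by norm_cast)).differentiableAt (by simp)
  rw [pd_apply w _ hx, h1.fderiv_eq, fderiv_clm_apply h2 (differentiableAt_const z)]
  simp

theorem pd_comm (w z : Vec m) (f : Sm U) : pd w (pd z f) = pd z (pd w f) := ext_on fun x hx => by
  rw [fderiv_fderiv_apply f w z hx, fderiv_fderiv_apply f z w hx]
  exact ((contDiffAt f hx).isSymmSndFDerivAt (by simp; norm_cast)).eq w z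

theorem pd_X (w z : Vec m) (f : Sm U) : pd w (X z f) = X z (pd w f) + ⟪w, z⟫ • f :=
  ext_on fun x hx => by
    rw [pd_apply w _ hx, add_apply, X_apply, pd_apply w f hx, smul_apply]
    have h1 : HasFDerivAt (fun y : Vec m => ⟪y, z⟫) (innerSL ℝ z) x := by
      have := (innerSL ℝ z).hasFDerivAt (x := x)
      simpa [real_inner_comm] using this
    have h2 := h1.smul (differentiableAt f hx).hasFDerivAt
    change fderiv ℝ ((fun y => ⟪y, z⟫) • f.1) x w = _
    rw [h2.fderiv]
    simp [real_inner_comm]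

theorem pd_post (w : Vec m) (A : Cl m →ₗ[ℝ] Cl m) (f : Sm U) : pd w (post A f) = post A (pd w f) :=
  ext_on fun x hx => by
    rw [pd_apply w _ hx, post_apply, pd_apply w f hx]
    have h := (LinearMap.toContinuousLinearMap A).hasFDerivAt.comp x
      (differentiableAt f hx).hasFDerivAt
    change fderiv ℝ ((LinearMap.toContinuousLinearMap A) ∘ f) x w = _
    rw [h.fderiv]
    rfl

theorem pd_lm (w : Vec m) (a : Cl m) (f : Sm U) : pd w (lm a f) = lm a (pd w f) := pd_post _ _ _

theorem pd_rm (w : Vec m) (a : Cl m) (f : Sm U) : pd w (rm a f) = rm a (pd w f) := pd_post _ _ _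

theorem X_post (w : Vec m) (A : Cl m →ₗ[ℝ] Cl m) (f : Sm U) : X w (post A f) = post A (X w f) :=
  ext_on fun x _ => by simp

theorem X_lm (w : Vec m) (a : Cl m) (f : Sm U) : X w (lm a f) = lm a (X w f) := X_post _ _ _

theorem X_rm (w : Vec m) (a : Cl m) (f : Sm U) : X w (rm a f) = rm a (X w f) := X_post _ _ _

theorem X_comm (w z : Vec m) (f : Sm U) : X w (X z f) = X z (X w f) :=
  ext_on fun x _ => by simp [smul_smul, mul_comm]

theorem lm_lm (a b : Cl m) (f : Sm U) : lm a (lm b f) = lm (a * b) f :=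
  ext_on fun x _ => by simp [mul_assoc]

theorem rm_lm (a b : Cl m) (f : Sm U) : rm a (lm b f) = lm b (rm a f) :=
  ext_on fun x _ => by simp [mul_assoc]

theorem lm_algebraMap (c : ℝ) (f : Sm U) : lm (algebraMap ℝ (Cl m) c) f = c • f :=
  ext_on fun x _ => by simp [Algebra.smul_def]

/-- The Laplace operator. -/
def lap : Module.End ℝ (Sm U) := ∑ i, pd (e i) * pd (e i)

/-- The Dirac operator. -/
def dir : Module.End ℝ (Sm U) := ∑ i, lm (vec (e i)) * pd (e i)

theorem lap_eq (f : Sm U) : lap f = ∑ i, pd (e i) (pd (e i) f) := by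
  simp [lap, LinearMap.sum_apply]

theorem dir_eq (f : Sm U) : dir f = ∑ i, lm (vec (e i)) (pd (e i) f) := by
  simp [dir, LinearMap.sum_apply]

theorem laplacian_eq_lap (f : Sm U) {g : Vec m → Cl m} (h : ∀ x ∈ U, g x = f x)
    {x : Vec m} (hx : x ∈ U) : Laplacian.laplacian g x = lap f x := by
  have h1 : g =ᶠ[𝓝 x] f := by
    filter_upwards [U.isOpen.mem_nhds hx] with y hy using h y hy
  rw [(InnerProductSpace.laplacian_congr_nhds h1).eq_of_nhds,
    InnerProductSpace.laplacian_eq_iteratedFDeriv_orthonormalBasis _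
      (EuclideanSpace.basisFun (Fin m) ℝ), lap_eq, sum_apply]
  refine Finset.sum_congr rfl fun i _ => ?_
  rw [fderiv_fderiv_apply f _ _ hx, iteratedFDeriv_two_apply]
  simp

end Sm

/-! ### The operators on functions which are linear in `u` -/

theorem sum_smul_e {m : ℕ} (u : Vec m) : ∑ i, u i • (e i : Vec m) = u := by
  have := (EuclideanSpace.basisFun (Fin m) ℝ).sum_repr u
  simpa using this

theorem lineDeriv_linear {m : ℕ} (L : Vec m →ₗ[ℝ] Cl m) (u w : Vec m) :
    lineDeriv ℝ (fun z => L z) u w = L w := by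
  have h := (LinearMap.toContinuousLinearMap L).hasFDerivAt (x := u)
  exact (h.hasLineDerivAt w).lineDeriv

section Linear

variable {m : ℕ} {U : Opens (Vec m)}

/-- `F(x, u)` agrees on `U` with the family `f_u` of smooth functions, which is linear in `u`. -/
def Rep (F : Fun₂ m) (f : Vec m →ₗ[ℝ] Sm U) : Prop := ∀ x ∈ U, ∀ u, F x u = f u x

theorem Rep.dX {F : Fun₂ m} {f : Vec m →ₗ[ℝ] Sm U} (h : Rep F f) (i : Fin m) :
    Rep (dX i F) (Sm.pd (e i) ∘ₗ f) := fun _ hx u =>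
  Sm.lineDeriv_eq_pd (e i) (f u) (fun y hy => h y hy u) hx

theorem Rep.lapX {F : Fun₂ m} {f : Vec m →ₗ[ℝ] Sm U} (h : Rep F f) :
    Rep (lapX F) (Sm.lap ∘ₗ f) := fun _ hx u =>
  Sm.laplacian_eq_lap (f u) (fun y hy => h y hy u) hx

theorem Rep.lapX_iterate {F : Fun₂ m} {f : Vec m →ₗ[ℝ] Sm U} (h : Rep F f) (n : ℕ) :
    Rep (SpinCylinder.lapX^[n] F) ((Sm.lap ^ n) ∘ₗ f) := by
  induction n with
  | zero => exact h
  | succ n ih =>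
    rw [Function.iterate_succ_apply', pow_succ']
    exact ih.lapX

theorem Rep.diracX {F : Fun₂ m} {f : Vec m →ₗ[ℝ] Sm U} (h : Rep F f) :
    Rep (diracX F) (Sm.dir ∘ₗ f) := fun x hx u => by
  simp only [SpinCylinder.diracX, LinearMap.comp_apply, Sm.dir_eq, Sm.sum_apply, Sm.lm_apply]
  exact Finset.sum_congr rfl fun i _ => by rw [h.dX i x hx u]; rfl

/-- `⟨D_u, D_x⟩` on families which are linear in `u`. -/
def divU (f : Vec m →ₗ[ℝ] Sm U) : Sm U := ∑ i, Sm.pd (e i) (f (e i))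

/-- On a map linear in u, ∂_{u_i} is evaluation at e_i; the result no longer depends on u, which is
what `innerUDx_eq` then requires. -/
theorem Rep.innerDuDx {F : Fun₂ m} {f : Vec m →ₗ[ℝ] Sm U} (h : Rep F f) :
    ∀ x ∈ U, ∀ u, innerDuDx F x u = divU f x := fun x hx u => by
  simp only [SpinCylinder.innerDuDx, divU, Sm.sum_apply]
  refine Finset.sum_congr rfl fun i _ => ?_
  let L : Vec m →ₗ[ℝ] Cl m := LinearMap.proj x ∘ₗ (Sm U).subtype ∘ₗ Sm.pd (e i) ∘ₗ f
  have h1 : (fun w => SpinCylinder.dX i F x w) = fun w => L w := funext fun w => h.dX i x hx w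
  simp only [dU, h1]
  exact lineDeriv_linear L u (e i)

theorem innerUDx_eq {F : Fun₂ m} {g : Sm U} (h : ∀ x ∈ U, ∀ u, F x u = g x) :
    ∀ x ∈ U, ∀ u, innerUDx F x u = Sm.pd u g x := fun x hx u => by
  conv_rhs => rw [← sum_smul_e u, map_sum, LinearMap.sum_apply, Sm.sum_apply]
  simp only [innerUDx, map_smul, LinearMap.smul_apply, Sm.smul_apply]
  exact Finset.sum_congr rfl fun i _ => by
    rw [dX, Sm.lineDeriv_eq_pd (e i) g (fun y hy => h y hy u) hx]

open Classical in
/-- The operator `D_{1,k}` on families which are linear in `u`. -/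
def opLin (k : ℕ) (f : Vec m →ₗ[ℝ] Sm U) (u : Vec m) : Sm U :=
  if Even k then
    (Sm.lap ^ (k / 2)) (f u) - (4 * ((k / 2 : ℕ) : ℝ) / ((m : ℝ) + 2 * (k / 2 : ℕ) - 2)) •
      Sm.pd u (divU ((Sm.lap ^ (k / 2 - 1)) ∘ₗ f))
  else
    Sm.dir ((Sm.lap ^ ((k + 1) / 2 - 1)) (f u))
      - (2 / ((m : ℝ) + 2 * ((k + 1) / 2 : ℕ) - 2)) •
        Sm.lm (vec u) (divU ((Sm.lap ^ ((k + 1) / 2 - 1)) ∘ₗ f))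
      - ((4 * (((k + 1) / 2 : ℕ) : ℝ) - 4) / ((m : ℝ) + 2 * ((k + 1) / 2 : ℕ) - 2)) •
        Sm.pd u (divU ((Sm.lap ^ ((k + 1) / 2 - 2)) ∘ₗ Sm.dir ∘ₗ f))

theorem Rep.opD {F : Fun₂ m} {f : Vec m →ₗ[ℝ] Sm U} (h : Rep F f) (k : ℕ) {x : Vec m} (hx : x ∈ U)
    (u : Vec m) : opD k F x u = opLin k f u x := by
  unfold SpinCylinder.opD opLin
  split_ifs
  · simp only [bosonic, Sm.sub_apply, Sm.smul_apply]
    rw [h.lapX_iterate _ x hx u, innerUDx_eq (h.lapX_iterate _).innerDuDx x hx u]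
    rfl
  · simp only [fermionic, Sm.sub_apply, Sm.smul_apply, Sm.lm_apply]
    rw [(h.lapX_iterate _).diracX x hx u, (h.lapX_iterate _).innerDuDx x hx u,
      innerUDx_eq (h.diracX.lapX_iterate _).innerDuDx x hx u]
    rfl

/-- A linear relation which is compatible with the directional derivatives and with left
multiplications is compatible with `D_{1,k}`. -/
theorem opLin_mem {V : Opens (Vec m)} (R : Submodule ℝ (Sm U × Sm V))
    (hpd : ∀ w, ∀ q ∈ R, (Sm.pd w q.1, Sm.pd w q.2) ∈ R)
    (hlm : ∀ a, ∀ q ∈ R, (Sm.lm a q.1, Sm.lm a q.2) ∈ R)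
    (k : ℕ) (f : Vec m →ₗ[ℝ] Sm U) (g : Vec m →ₗ[ℝ] Sm V) (h : ∀ u, (f u, g u) ∈ R) (u : Vec m) :
    (opLin k f u, opLin k g u) ∈ R := by
  have hsum : ∀ {ι : Type} (s : Finset ι) (a : ι → Sm U) (b : ι → Sm V),
      (∀ i ∈ s, (a i, b i) ∈ R) → (∑ i ∈ s, a i, ∑ i ∈ s, b i) ∈ R := by
    intro ι s a b hab
    have := R.sum_mem hab
    rwa [show ∑ i ∈ s, (a i, b i) = (∑ i ∈ s, a i, ∑ i ∈ s, b i) from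
      Prod.ext Prod.fst_sum Prod.snd_sum] at this
  have hlap : ∀ n a b, (a, b) ∈ R → ((Sm.lap ^ n) a, (Sm.lap ^ n) b) ∈ R := by
    intro n
    induction n with
    | zero => intro a b hab; exact hab
    | succ n ih =>
      intro a b hab
      rw [pow_succ, pow_succ, Module.End.mul_apply, Module.End.mul_apply]
      apply ih
      rw [Sm.lap_eq, Sm.lap_eq]
      exact hsum _ _ _ fun i _ => hpd _ _ (hpd _ _ hab)
  have hdir : ∀ a b, (a, b) ∈ R → (Sm.dir a, Sm.dir b) ∈ R := fun a b hab => by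
    rw [Sm.dir_eq, Sm.dir_eq]
    exact hsum _ _ _ fun i _ => hlm _ _ (hpd _ _ hab)
  have hdiv : ∀ (a : Vec m →ₗ[ℝ] Sm U) (b : Vec m →ₗ[ℝ] Sm V), (∀ u, (a u, b u) ∈ R) →
      (divU a, divU b) ∈ R := fun a b hab => hsum _ _ _ fun i _ => hpd _ _ (hab _)
  unfold opLin
  split_ifs
  · exact R.sub_mem (hlap _ _ _ (h u))
      (R.smul_mem _ (hpd u _ (hdiv _ _ fun w => hlap _ _ _ (h w))))
  · exact R.sub_mem (R.sub_mem (hdir _ _ (hlap _ _ _ (h u)))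
      (R.smul_mem _ (hlm _ _ (hdiv _ _ fun w => hlap _ _ _ (h w)))))
      (R.smul_mem _ (hpd u _ (hdiv _ _ fun w => hlap _ _ _ (hdir _ _ (h w)))))

end Linear

/-! ### The lattice -/

section Lattice

variable {m l : ℕ}

theorem abs_le_norm_emb (a : Fin m → ℤ) (i : Fin m) : |(a i : ℝ)| ≤ ‖emb m a‖ := by
  have := PiLp.norm_apply_le (emb m a) i
  simpa [emb] using this

theorem one_le_norm_emb {a : Fin m → ℤ} (ha : a ≠ 0) : 1 ≤ ‖emb m a‖ := by
  obtain ⟨i, hi⟩ := Function.ne_iff.1 ha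
  refine le_trans ?_ (abs_le_norm_emb a i)
  exact_mod_cast Int.one_le_abs hi

theorem finite_norm_emb_lt (R : ℝ) : {a : Fin m → ℤ | ‖emb m a‖ < R}.Finite := by
  refine (Set.finite_Icc (fun _ => -⌈R⌉ : Fin m → ℤ) (fun _ => ⌈R⌉)).subset fun a ha => ?_
  have h : ∀ i, |a i| ≤ ⌈R⌉ := fun i => by
    have h1 : |(a i : ℝ)| ≤ ⌈R⌉ := (abs_le_norm_emb a i).trans (ha.le.trans (Int.le_ceil R))
    exact_mod_cast h1
  exact ⟨fun i => (abs_le.1 (h i)).1, fun i => (abs_le.1 (h i)).2⟩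

theorem finite_lat_norm_emb_lt (R : ℝ) : {a : Lat m l | ‖emb m a‖ < R}.Finite :=
  (finite_norm_emb_lt R).preimage Subtype.val_injective.injOn

theorem emb_mem_lattice {a : Fin m → ℤ} (ha : a ∈ Lat m l) : emb m a ∈ lattice m l := ⟨a, ha, rfl⟩

instance discreteTopology_lattice : DiscreteTopology (lattice m l) := by
  refine DiscreteTopology.of_forall_le_dist (r := 1) one_pos ?_
  rintro ⟨_, a, ha, rfl⟩ ⟨_, b, hb, rfl⟩ hne
  have hab : a - b ≠ 0 := fun h => hne (by simp [sub_eq_zero.1 h])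
  change 1 ≤ dist (emb m a) (emb m b)
  rw [dist_eq_norm, ← map_sub]
  exact one_le_norm_emb hab

theorem isClosed_lattice (m l : ℕ) : IsClosed (lattice m l : Set (Vec m)) :=
  AddSubgroup.isClosed_of_discrete

/-- The complement of the lattice. -/
def offLattice (m l : ℕ) : TopologicalSpace.Opens (Vec m) :=
  ⟨(lattice m l : Set (Vec m))ᶜ, (isClosed_lattice m l).isOpen_compl⟩

theorem mem_offLattice {x : Vec m} : x ∈ offLattice m l ↔ x ∉ lattice m l := Iff.rfl

/-- The complement of the origin. -/
def offZero (m : ℕ) : TopologicalSpace.Opens (Vec m) := ⟨{0}ᶜ, isClosed_singleton.isOpen_compl⟩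

theorem mem_offZero {x : Vec m} : x ∈ offZero m ↔ x ≠ 0 := Iff.rfl

theorem add_emb_ne_zero {x : Vec m} (hx : x ∉ lattice m l) {a : Fin m → ℤ} (ha : a ∈ Lat m l) :
    x + emb m a ≠ 0 := fun h => hx (by
  rw [eq_neg_of_add_eq_zero_left h]
  exact neg_mem (emb_mem_lattice ha))

theorem add_emb_notMem {x : Vec m} (hx : x ∉ lattice m l) {a : Fin m → ℤ} (ha : a ∈ Lat m l) :
    x + emb m a ∉ lattice m l := fun h => hx (by
  simpa using sub_mem h (emb_mem_lattice ha))

/-- An upper bound is enough for summability, and it holds for l > m as well: missing coordinates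
are padded with zeros. -/
theorem finrank_lat_le : Module.finrank ℤ (Lat m l) ≤ l := by
  let φ : Lat m l →+ (Fin l → ℤ) :=
    { toFun := fun a i => if h : (i : ℕ) < m then a.1 ⟨i, h⟩ else 0
      map_zero' := by funext i; simp
      map_add' := fun a b => by funext i; by_cases h : (i : ℕ) < m <;> simp [h] }
  have hφ : Function.Injective φ := by
    intro a b hab
    apply Subtype.ext
    funext i
    by_cases hi : (i : ℕ) < l
    · have := congrFun hab ⟨i, hi⟩
      simpa [φ] using this
    · rw [a.2 i (not_lt.1 hi), b.2 i (not_lt.1 hi)]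
  have := LinearMap.finrank_le_finrank_of_injective (f := φ.toIntLinearMap) hφ
  simpa using this

theorem summable_norm_emb_pow_inv {n : ℕ} (hn : l < n) :
    Summable fun a : Lat m l => (‖emb m a‖ ^ n)⁻¹ := by
  let L : Submodule ℤ (Vec m) := AddSubgroup.toIntSubmodule (lattice m l)
  have : DiscreteTopology L := discreteTopology_lattice (m := m) (l := l)
  let ε : Lat m l ≃+ L := (Lat m l).equivMapOfInjective (emb m) (emb_injective m)
  have hr : Module.finrank ℤ L < n := by
    rw [← ε.toIntLinearEquiv.finrank_eq]
    exact finrank_lat_le.trans_lt hn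
  have := (ZLattice.summable_norm_pow_inv L n hr).comp_injective ε.injective
  refine this.congr fun a => ?_
  simp only [Function.comp_apply, inv_pow]
  rfl

/-- Finitely many terms do not affect summability; each of them is bounded on K by compactness. This
isolates the lattice points too close to K for decay estimates. -/
theorem exists_summable_bound {ι W : Type*} [NormedAddCommGroup W] {g : ι → Vec m → W}
    {K : Set (Vec m)} (hK : IsCompact K) (hg : ∀ i, ContinuousOn (g i) K) {c : ι → ℝ}
    (hc : Summable c) {S : Set ι} (hS : S.Finite) (h : ∀ i ∉ S, ∀ x ∈ K, ‖g i x‖ ≤ c i) :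
    ∃ b : ι → ℝ, Summable b ∧ ∀ i, ∀ x ∈ K, ‖g i x‖ ≤ b i := by
  classical
  choose B hB using fun i => hK.exists_bound_of_continuousOn (hg i)
  refine ⟨fun i => if i ∈ S then B i else c i, ?_, fun i x hx => ?_⟩
  · refine (hc.congr_cofinite ?_)
    filter_upwards [hS.compl_mem_cofinite] with i hi
    simp only [if_neg (show i ∉ S from hi)]
  · by_cases hi : i ∈ S
    · simpa [hi] using hB i x hx
    · simpa [hi] using h i hi x hx

end Lattice

/-! ### Functions whose derivatives decay -/

section Decay

variable {m : ℕ} {W : Type} [NormedAddCommGroup W] [NormedSpace ℝ W]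
  {W' : Type} [NormedAddCommGroup W'] [NormedSpace ℝ W']

/-- `f` is smooth off the origin and its derivatives of order `n` are `O(‖x‖^{-(l+n)})`. -/
structure Decay (l : ℕ) (f : Vec m → W) : Prop where
  smooth : ContDiffOn ℝ ∞ f {0}ᶜ
  bound : ∀ n : ℕ, ∃ C, 0 ≤ C ∧ ∀ x, 1 ≤ ‖x‖ → ‖iteratedFDeriv ℝ n f x‖ ≤ C * (‖x‖ ^ (l + n))⁻¹

variable {l : ℕ} {f g : Vec m → W}

theorem ne_zero_of_one_le_norm {x : Vec m} (hx : 1 ≤ ‖x‖) : x ≠ 0 :=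
  norm_pos_iff.1 (one_pos.trans_le hx)

theorem Decay.contDiffAt (hf : Decay l f) {x : Vec m} (hx : x ≠ 0) : ContDiffAt ℝ ∞ f x :=
  hf.smooth.contDiffAt (isOpen_compl_singleton.mem_nhds hx)

theorem Decay.differentiableAt (hf : Decay l f) {x : Vec m} (hx : x ≠ 0) :
    DifferentiableAt ℝ f x := (hf.contDiffAt hx).differentiableAt (by simp)

theorem Decay.norm_le (hf : Decay l f) :
    ∃ C, 0 ≤ C ∧ ∀ x, 1 ≤ ‖x‖ → ‖f x‖ ≤ C * (‖x‖ ^ l)⁻¹ := by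
  obtain ⟨C, hC, h⟩ := hf.bound 0
  exact ⟨C, hC, fun x hx => by simpa using h x hx⟩

theorem Decay.norm_fderiv_le (hf : Decay l f) :
    ∃ C, 0 ≤ C ∧ ∀ x, 1 ≤ ‖x‖ → ‖fderiv ℝ f x‖ ≤ C * (‖x‖ ^ (l + 1))⁻¹ := by
  obtain ⟨C, hC, h⟩ := hf.bound 1
  exact ⟨C, hC, fun x hx => by rw [← norm_iteratedFDeriv_one]; exact h x hx⟩

/-- The exponent could be raised to l + 1, but keeping l makes the class stable under
differentiation, which is what differentiating the periodization repeatedly needs. -/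
theorem Decay.fderiv (hf : Decay l f) : Decay l (fderiv ℝ f) where
  smooth := hf.smooth.fderiv_of_isOpen isOpen_compl_singleton (by simp)
  bound n := by
    obtain ⟨C, hC, h⟩ := hf.bound (n + 1)
    refine ⟨C, hC, fun x hx => ?_⟩
    rw [norm_iteratedFDeriv_fderiv]
    refine (h x hx).trans (mul_le_mul_of_nonneg_left ?_ hC)
    exact inv_anti₀ (by positivity) (pow_le_pow_right₀ hx (by lia))

theorem Decay.add (hf : Decay l f) (hg : Decay l g) : Decay l (f + g) where
  smooth := hf.smooth.add hg.smooth
  bound n := by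
    obtain ⟨C, hC, h⟩ := hf.bound n
    obtain ⟨C', hC', h'⟩ := hg.bound n
    refine ⟨C + C', add_nonneg hC hC', fun x hx => ?_⟩
    have hx0 := ne_zero_of_one_le_norm hx
    rw [iteratedFDeriv_add_apply ((hf.contDiffAt hx0).of_le (by exact_mod_cast le_top))
      ((hg.contDiffAt hx0).of_le (by exact_mod_cast le_top)), add_mul]
    exact (norm_add_le _ _).trans (add_le_add (h x hx) (h' x hx))

theorem Decay.clm_comp (hf : Decay l f) (A : W →L[ℝ] W') : Decay l (fun x => A (f x)) where
  smooth := A.contDiff.comp_contDiffOn hf.smooth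
  bound n := by
    obtain ⟨C, hC, h⟩ := hf.bound n
    refine ⟨‖A‖ * C, by positivity, fun x hx => ?_⟩
    have hx0 := ne_zero_of_one_le_norm hx
    refine (A.norm_iteratedFDeriv_comp_left (hf.contDiffAt hx0)
      (by exact_mod_cast le_top)).trans ?_
    rw [mul_assoc]
    exact mul_le_mul_of_nonneg_left (h x hx) (norm_nonneg _)

theorem decay_zero : Decay l (0 : Vec m → W) where
  smooth := contDiffOn_const
  bound n := ⟨0, le_rfl, fun x _ => by simp⟩

theorem Decay.congr (hf : Decay l f) (h : ∀ x ≠ 0, g x = f x) : Decay l g where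
  smooth := hf.smooth.congr h
  bound n := by
    obtain ⟨C, hC, hb⟩ := hf.bound n
    refine ⟨C, hC, fun x hx => ?_⟩
    have h1 : g =ᶠ[𝓝 x] f := by
      filter_upwards [isOpen_compl_singleton.mem_nhds (ne_zero_of_one_le_norm hx)] with y hy
        using h y hy
    rw [(h1.iteratedFDeriv ℝ n).eq_of_nhds]
    exact hb x hx

/-- Mean value inequality on the ball of radius ‖y‖/2 about y, which stays at distance at least
‖y‖/2 ≥ 1 from the origin. The extra power of ‖y‖ gained here is what makes the differences
summable. -/
theorem Decay.norm_sub_le (hf : Decay l f) : ∃ C, 0 ≤ C ∧ ∀ y z, 2 ≤ ‖y‖ → ‖z - y‖ ≤ ‖y‖ / 2 →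
    ‖f z - f y‖ ≤ C * (‖y‖ ^ (l + 1))⁻¹ * ‖z - y‖ := by
  obtain ⟨C, hC, h⟩ := hf.norm_fderiv_le
  refine ⟨C * 2 ^ (l + 1), by positivity, fun y z hy hz => ?_⟩
  have hball : ∀ w ∈ Metric.closedBall y (‖y‖ / 2), ‖y‖ / 2 ≤ ‖w‖ := by
    intro w hw
    rw [mem_closedBall_iff_norm, norm_sub_rev] at hw
    have := norm_sub_norm_le y w
    linarith
  refine (convex_closedBall y (‖y‖ / 2)).norm_image_sub_le_of_norm_fderiv_le (𝕜 := ℝ)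
    (fun w hw => hf.differentiableAt ?_) (fun w hw => ?_)
    (Metric.mem_closedBall_self (by positivity)) (mem_closedBall_iff_norm.2 hz)
  · exact ne_zero_of_one_le_norm (by linarith [hball w hw])
  · have hw1 := hball w hw
    refine (h w (by linarith)).trans ?_
    rw [mul_assoc]
    refine mul_le_mul_of_nonneg_left ?_ hC
    rw [← div_eq_mul_inv, ← inv_div, ← div_pow]
    exact inv_anti₀ (by positivity) (pow_le_pow_left₀ (by positivity) hw1 _)

/-- A function which is smooth off the origin and positively homogeneous of degree `s ≤ -l`
decays. -/
theorem decay_of_homogeneous {s : ℤ} (hs : s ≤ -(l : ℤ)) (hf : ContDiffOn ℝ ∞ f {0}ᶜ)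
    (hom : ∀ t : ℝ, 0 < t → ∀ x ≠ 0, f (t • x) = t ^ s • f x) : Decay l f := by
  refine ⟨hf, fun n => ?_⟩
  induction n generalizing W l s with
  | zero =>
    obtain ⟨C, hC⟩ := (isCompact_sphere (0 : Vec m) 1).exists_bound_of_continuousOn
      (hf.continuousOn.mono fun x hx => by
        rw [mem_sphere_zero_iff_norm] at hx
        exact ne_zero_of_one_le_norm hx.ge)
    refine ⟨max C 0, le_max_right _ _, fun x hx => ?_⟩
    have hx0 := ne_zero_of_one_le_norm hx
    have hn : ‖x‖ ≠ 0 := norm_ne_zero_iff.2 hx0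
    have h1 := hom ‖x‖ (norm_pos_iff.2 hx0) (‖x‖⁻¹ • x) (smul_ne_zero (inv_ne_zero hn) hx0)
    rw [smul_inv_smul₀ hn] at h1
    have h2 : ‖f (‖x‖⁻¹ • x)‖ ≤ max C 0 :=
      (hC _ (by simp [norm_smul, inv_mul_cancel₀ hn])).trans (le_max_left _ _)
    rw [norm_iteratedFDeriv_zero, h1, norm_smul, norm_zpow, norm_norm, mul_comm]
    refine mul_le_mul h2 ?_ (by positivity) (le_max_right _ _)
    calc ‖x‖ ^ s ≤ ‖x‖ ^ (-(l : ℤ)) := zpow_le_zpow_right₀ hx hs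
      _ = (‖x‖ ^ (l + 0))⁻¹ := by simp
  | succ n ih =>
    have hfd : ContDiffOn ℝ ∞ (fderiv ℝ f) {0}ᶜ :=
      hf.fderiv_of_isOpen isOpen_compl_singleton (by simp)
    -- Differentiating f(tx) = t^s f(x) gives t f'(tx) = t^s f'(x), so f' is homogeneous of degree s
    -- - 1.
    obtain ⟨C, hC, h⟩ := ih (f := fderiv ℝ f) (s := s - 1) (l := l + 1) (by push_cast; lia) hfd (by
      intro t ht x hx
      have hd : ∀ y ≠ 0, DifferentiableAt ℝ f y := fun y hy =>
        (hf.contDiffAt (isOpen_compl_singleton.mem_nhds hy)).differentiableAt (by simp)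
      have h1 : (fun y => f (t • y)) =ᶠ[𝓝 x] fun y => t ^ s • f y := by
        filter_upwards [isOpen_compl_singleton.mem_nhds hx] with y hy using hom t ht y hy
      have h2 := h1.fderiv_eq (𝕜 := ℝ)
      rw [fderiv_fun_const_smul (hd x hx), fderiv_comp_smul] at h2
      rw [zpow_sub_one₀ ht.ne', mul_comm, mul_smul, ← h2, smul_smul, inv_mul_cancel₀ ht.ne',
        one_smul])
    refine ⟨C, hC, fun x hx => ?_⟩
    rw [← norm_iteratedFDeriv_fderiv, show l + (n + 1) = l + 1 + n by ring]
    exact h x hx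

end Decay

/-! ### Sign-twisted periodization -/

section Periodize

variable {m l : ℕ} {W : Type} [NormedAddCommGroup W] [NormedSpace ℝ W]
  {W' : Type} [NormedAddCommGroup W'] [NormedSpace ℝ W']

/-- The terms `± (f(x + a) - f(x + a + δ))`. -/
def diffTerm (p : ℕ) (δ : Lat m l) (f : Vec m → W) (a : Lat m l) (x : Vec m) : W :=
  sgn p a.1 • (f (x + emb m a) - f (x + emb m (a + δ : Lat m l)))

/-- Half the sum of the terms `± (f(x + a) - f(x + a + δ))` over the lattice. -/
def periodize (p : ℕ) (δ : Lat m l) (f : Vec m → W) (x : Vec m) : W :=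
  (1 / 2 : ℝ) • ∑' a : Lat m l, diffTerm p δ f a x

theorem norm_sgn_smul (p : ℕ) (a : Fin m → ℤ) (w : W) : ‖sgn p a • w‖ = ‖w‖ := by
  rcases sgn_cases p a with h | h <;> simp [h]

variable {p : ℕ} {δ : Lat m l} {f g : Vec m → W}

theorem continuousOn_comp_add_emb {W : Type*} [TopologicalSpace W] {f : Vec m → W} (hf : ContinuousOn f {0}ᶜ) {K : Set (Vec m)}
    (hK : K ⊆ (lattice m l : Set (Vec m))ᶜ) (a : Lat m l) :
    ContinuousOn (fun x => f (x + emb m a)) K :=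
  hf.comp (continuousOn_id.add continuousOn_const) fun _ hx => add_emb_ne_zero (hK hx) a.2

theorem exists_summable_bound_diffTerm (hf : Decay l f) {K : Set (Vec m)} (hK : IsCompact K)
    (hKl : K ⊆ (lattice m l : Set (Vec m))ᶜ) :
    ∃ b : Lat m l → ℝ, Summable b ∧ ∀ a, ∀ x ∈ K, ‖diffTerm p δ f a x‖ ≤ b a := by
  obtain ⟨C, hC, h⟩ := hf.norm_sub_le
  obtain ⟨R, hR⟩ := hK.exists_bound_of_continuousOn continuousOn_id
  have hR0 : ∀ x ∈ K, ‖x‖ ≤ |R| := fun x hx => (hR x hx).trans (le_abs_self R)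
  refine exists_summable_bound hK (fun a => ?_)
    ((summable_norm_emb_pow_inv (m := m) (l := l) (Nat.lt_succ_self l)).mul_left
      (C * 2 ^ (l + 1) * ‖emb m δ‖))
    -- Beyond this radius ‖x + a‖ ≥ ‖a‖/2 ≥ 2 and ‖δ‖ ≤ ‖x + a‖/2, as `Decay.norm_sub_le` demands.
    (finite_lat_norm_emb_lt (2 * |R| + 4 * ‖emb m δ‖ + 4)) fun a ha x hx => ?_
  · exact ((continuousOn_comp_add_emb hf.smooth.continuousOn hKl a).sub
      (continuousOn_comp_add_emb hf.smooth.continuousOn hKl (a + δ))).const_smul _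
  · have ha' : 2 * |R| + 4 * ‖emb m δ‖ + 4 ≤ ‖emb m a‖ := not_lt.1 ha
    have hxa : ‖emb m a‖ / 2 ≤ ‖x + emb m a‖ := by
      have := norm_sub_le (x + emb m a) x
      rw [add_sub_cancel_left] at this
      linarith [hR0 x hx, norm_nonneg (emb m δ)]
    have hd : x + emb m (a + δ : Lat m l) - (x + emb m a) = emb m δ := by
      simp [map_add]
    rw [diffTerm, norm_sgn_smul, norm_sub_rev]
    refine (h _ _ (by linarith [norm_nonneg (emb m δ), abs_nonneg R]) ?_).trans ?_
    · rw [hd]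
      linarith [abs_nonneg R]
    · rw [hd, mul_right_comm, mul_right_comm C (2 ^ _), mul_assoc (C * ‖emb m δ‖)]
      refine mul_le_mul_of_nonneg_left ?_ (by positivity)
      have hpos : 0 < ‖emb m a‖ := by linarith [norm_nonneg (emb m δ), abs_nonneg R]
      rw [← div_eq_mul_inv, ← inv_div, ← div_pow]
      exact inv_anti₀ (by positivity) (pow_le_pow_left₀ (by positivity) hxa _)

theorem hasFDerivAt_diffTerm (hf : Decay l f) (a : Lat m l) {x : Vec m} (hx : x ∉ lattice m l) :
    HasFDerivAt (diffTerm p δ f a) (diffTerm p δ (fderiv ℝ f) a x) x := by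
  have h : ∀ b : Lat m l, HasFDerivAt (fun y => f (y + emb m b)) (fderiv ℝ f (x + emb m b)) x :=
    fun b => (hasFDerivAt_comp_add_right _).2
      (hf.differentiableAt (add_emb_ne_zero hx b.2)).hasFDerivAt
  exact ((h a).sub (h (a + δ))).const_smul (sgn p a.1)

/-- Reindexing by b ↦ b - a. No convergence is needed: `tsum` is compatible with bijections and real
scalars unconditionally. -/
theorem periodize_add_emb (a : Lat m l) (x : Vec m) :
    periodize p δ f (x + emb m a) = sgn p a.1 • periodize p δ f x := by
  rw [periodize, periodize, smul_comm (sgn p a.1), ← tsum_const_smul'' (sgn p a.1),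
    ← (Equiv.addRight (-a)).tsum_eq (fun b => diffTerm p δ f b (x + emb m a))]
  congr 1
  refine tsum_congr fun b => ?_
  have hs : sgn p (b - a : Lat m l).1 = sgn p a.1 * sgn p b.1 := by
    have h1 : sgn p b.1 = sgn p (b - a : Lat m l).1 * sgn p a.1 := by
      rw [← sgn_add]; simp
    rw [h1, mul_left_comm, ← sgn_add, mul_comm]
    rcases sgn_cases p a.1 with h | h <;> rw [sgn_add, h] <;> norm_num
  simp only [diffTerm, Equiv.coe_addRight, ← sub_eq_add_neg, smul_smul, hs]
  congr 3 <;>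
  · simp only [AddSubgroup.coe_add, AddSubgroup.coe_sub, map_sub, map_add]
    abel

variable [CompleteSpace W]

theorem summable_diffTerm (hf : Decay l f) {x : Vec m} (hx : x ∉ lattice m l) :
    Summable fun a => diffTerm p δ f a x := by
  obtain ⟨b, hb, h⟩ := exists_summable_bound_diffTerm (p := p) (δ := δ) hf
    (isCompact_singleton (x := x)) (by simpa using hx)
  exact Summable.of_norm_bounded hb fun a => h a x rfl

theorem periodize_add (hf : Decay l f) (hg : Decay l g) {x : Vec m} (hx : x ∉ lattice m l) :
    periodize p δ (f + g) x = periodize p δ f x + periodize p δ g x := by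
  rw [periodize, periodize, periodize, ← smul_add,
    ← (summable_diffTerm hf hx).tsum_add (summable_diffTerm hg hx)]
  congr 2
  funext a
  simp only [diffTerm, Pi.add_apply, ← smul_add]
  congr 1
  abel

theorem periodize_clm (hf : Decay l f) (A : W →L[ℝ] W') {x : Vec m} (hx : x ∉ lattice m l) :
    periodize p δ (fun y => A (f y)) x = A (periodize p δ f x) := by
  rw [periodize, periodize, map_smul, A.map_tsum (summable_diffTerm hf hx)]
  simp only [diffTerm, map_smul, map_sub]

/-- The termwise derivatives are the difference terms of f', which has the same decay, so they are
dominated on a small ball off the lattice. -/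
theorem hasFDerivAt_periodize (hf : Decay l f) {x : Vec m} (hx : x ∉ lattice m l) :
    HasFDerivAt (periodize p δ f) (periodize p δ (fderiv ℝ f) x) x := by
  obtain ⟨r, hr, hball⟩ := Metric.nhds_basis_closedBall.mem_iff.1
    ((isClosed_lattice m l).isOpen_compl.mem_nhds hx)
  obtain ⟨b, hb, h⟩ := exists_summable_bound_diffTerm (p := p) (δ := δ) hf.fderiv
    (isCompact_closedBall x r) hball
  have hsub : Metric.ball x r ⊆ Metric.closedBall x r := Metric.ball_subset_closedBall
  exact (hasFDerivAt_tsum_of_isPreconnected hb Metric.isOpen_ball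
    (convex_ball x r).isPreconnected
    (fun a y hy => hasFDerivAt_diffTerm hf a (hball (hsub hy)))
    (fun a y hy => h a y (hsub hy)) (Metric.mem_ball_self hr) (summable_diffTerm hf hx)
    (Metric.mem_ball_self hr)).const_smul (1 / 2 : ℝ)

/-- Induction on the order, with the target space varying: the derivative of a periodization is the
periodization of the derivative. -/
theorem contDiffOn_periodize (hf : Decay l f) :
    ContDiffOn ℝ ∞ (periodize p δ f) (lattice m l : Set (Vec m))ᶜ := by
  have hU := (isClosed_lattice m l).isOpen_compl
  refine contDiffOn_infty.2 fun n => ?_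
  induction n generalizing W with
  | zero =>
    exact contDiffOn_zero.2 fun x hx =>
      (hasFDerivAt_periodize hf hx).continuousAt.continuousWithinAt
  | succ n ih =>
    have h := (contDiffOn_succ_iff_fderiv_of_isOpen (𝕜 := ℝ) (n := n) (f := periodize p δ f) hU).2
      ⟨fun x hx => (hasFDerivAt_periodize hf hx).differentiableAt.differentiableWithinAt,
        by simp, (ih hf.fderiv).congr fun x hx => (hasFDerivAt_periodize hf hx).fderiv⟩
    exact_mod_cast h

end Periodize

/-! ### Commutation relations -/

section Clifford

variable {m : ℕ}

theorem vec_mul_self (x : Vec m) : vec x * vec x = algebraMap ℝ (Cl m) (-‖x‖ ^ 2) := by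
  rw [CliffordAlgebra.ι_sq_scalar, negSq_apply]

theorem vec_mul_add_swap (x y : Vec m) :
    vec x * vec y + vec y * vec x = algebraMap ℝ (Cl m) (-(2 * ⟪x, y⟫)) := by
  rw [CliffordAlgebra.ι_mul_ι_add_swap]
  congr 1
  simp only [QuadraticMap.polar, negSq_apply, norm_add_sq_real]
  ring

theorem vec_e_mul_self (i : Fin m) : vec (e i) * vec (e i) = (-1 : Cl m) := by
  rw [vec_mul_self]
  simp

theorem inner_e (i : Fin m) (u : Vec m) : ⟪e i, u⟫ = u i := by
  simp [e, EuclideanSpace.inner_single_left]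

theorem sum_inner_smul_e (u : Vec m) : ∑ i, ⟪e i, u⟫ • (e i : Vec m) = u := by
  simp only [inner_e, sum_smul_e]

end Clifford

namespace Sm

section Relations

variable {m : ℕ} {U : TopologicalSpace.Opens (Vec m)}

theorem sum_inner_smul_map {M : Type*} [AddCommGroup M] [Module ℝ M] (A : Vec m →ₗ[ℝ] M)
    (u : Vec m) : ∑ i, ⟪e i, u⟫ • A (e i) = A u := by
  conv_rhs => rw [← sum_inner_smul_e u, map_sum]
  simp only [map_smul]

theorem sum_inner_smul_pd (u : Vec m) (f : Sm U) : ∑ i, ⟪e i, u⟫ • pd (e i) f = pd u f :=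
  sum_inner_smul_map (pd.flip f) u

theorem lap_pd (w : Vec m) (f : Sm U) : lap (pd w f) = pd w (lap f) := by
  simp only [lap_eq, map_sum]
  exact Finset.sum_congr rfl fun i _ => by rw [pd_comm (e i) w f, pd_comm (e i) w]

theorem lap_lm (a : Cl m) (f : Sm U) : lap (lm a f) = lm a (lap f) := by
  simp only [lap_eq, map_sum, pd_lm]

theorem lap_rm (a : Cl m) (f : Sm U) : lap (rm a f) = rm a (lap f) := by
  simp only [lap_eq, map_sum, pd_rm]

theorem dir_pd (w : Vec m) (f : Sm U) : dir (pd w f) = pd w (dir f) := by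
  simp only [dir_eq, map_sum, pd_lm]
  exact Finset.sum_congr rfl fun i _ => by rw [pd_comm (e i) w f]

theorem dir_rm (a : Cl m) (f : Sm U) : dir (rm a f) = rm a (dir f) := by
  simp only [dir_eq, map_sum, pd_rm, rm_lm]

theorem lap_dir (f : Sm U) : lap (dir f) = dir (lap f) := by
  simp only [dir_eq, map_sum, lap_lm, lap_pd]

/-- An operator which commutes with the Laplace operator commutes with its powers. -/
theorem lap_pow_comm {A : Module.End ℝ (Sm U)} (hA : ∀ f, lap (A f) = A (lap f)) (n : ℕ)
    (f : Sm U) : (lap ^ n) (A f) = A ((lap ^ n) f) := by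
  have h : Commute lap A := LinearMap.ext hA
  exact LinearMap.congr_fun (h.pow_left n).eq f

theorem lap_X (u : Vec m) (f : Sm U) : lap (X u f) = X u (lap f) + (2 : ℝ) • pd u f := by
  simp only [lap_eq, pd_X, map_add, map_smul, map_sum, Finset.sum_add_distrib, two_smul]
  rw [sum_inner_smul_pd]
  abel

/-- Iteration of [Δ, ⟨x,u⟩] = 2∂_u. For n = 0 the truncated exponent n - 1 is harmless because its
coefficient vanishes. -/
theorem lap_pow_X (u : Vec m) (n : ℕ) (f : Sm U) :
    (lap ^ n) (X u f) = X u ((lap ^ n) f) + (2 * n : ℝ) • pd u ((lap ^ (n - 1)) f) := by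
  induction n with
  | zero => simp
  | succ n ih =>
    rw [pow_succ', Module.End.mul_apply, ih, map_add, map_smul, lap_X, lap_pd]
    have h : (n : ℝ) • pd u (lap ((lap ^ (n - 1)) f)) = (n : ℝ) • pd u ((lap ^ n) f) := by
      rcases n with _ | n
      · simp
      · rw [pow_succ' _ n]; rfl
    rw [mul_smul, h, Module.End.mul_apply, Nat.add_sub_cancel]
    push_cast
    module

theorem dir_X (u : Vec m) (f : Sm U) : dir (X u f) = X u (dir f) + lm (vec u) f := by
  have h := sum_inner_smul_map ((lm ∘ₗ CliffordAlgebra.ι (negSq m)).flip f) u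
  simp only [LinearMap.flip_apply, LinearMap.comp_apply] at h
  simp only [dir_eq, pd_X, map_add, map_smul, map_sum, Finset.sum_add_distrib, X_lm]
  rw [h]

theorem dir_lm_vec (u : Vec m) (f : Sm U) :
    dir (lm (vec u) f) = -lm (vec u) (dir f) - (2 : ℝ) • pd u f := by
  rw [← sum_inner_smul_pd u f]
  simp only [dir_eq, pd_lm, lm_lm, map_sum, Finset.smul_sum, ← Finset.sum_neg_distrib,
    ← Finset.sum_sub_distrib]
  refine Finset.sum_congr rfl fun i _ => ?_
  rw [eq_sub_of_add_eq (vec_mul_add_swap (e i) u), map_sub, LinearMap.sub_apply, lm_algebraMap]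
  module

/-- Moving D past each e_i in ∑ e_i ∂_i f yields D²f = -D²f - 2Δf. -/
theorem dir_dir (f : Sm U) : dir (dir f) = -lap f := by
  have h : dir (dir f) = -dir (dir f) - (2 : ℝ) • lap f := by
    conv_lhs => rw [dir_eq f, map_sum]
    simp only [dir_lm_vec, Finset.sum_sub_distrib, Finset.sum_neg_distrib, ← Finset.smul_sum,
      ← lap_eq, dir_pd, ← dir_eq]
  have h2 : (2 : ℝ) • (dir (dir f) + lap f) = 0 := by
    rw [smul_add, two_smul ℝ (dir (dir f))]
    nth_rewrite 1 [h]
    abel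
  exact eq_neg_of_add_eq_zero_left ((smul_eq_zero.1 h2).resolve_left two_ne_zero)

/-! ### The Euler operator and multiplication by the vector variable -/

/-- The Euler operator `∑ x_i ∂_{x_i}`. -/
def eu : Module.End ℝ (Sm U) := ∑ i, X (e i) * pd (e i)

theorem eu_eq (f : Sm U) : eu f = ∑ i, X (e i) (pd (e i) f) := by
  simp [eu, LinearMap.sum_apply]

theorem sum_inner_smul_X (u : Vec m) (f : Sm U) : ∑ i, ⟪e i, u⟫ • X (e i) f = X u f :=
  sum_inner_smul_map (X.flip f) u

theorem eu_X (u : Vec m) (f : Sm U) : eu (X u f) = X u (eu f) + X u f := by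
  simp only [eu_eq, pd_X, map_add, map_smul, map_sum, Finset.sum_add_distrib]
  rw [sum_inner_smul_X]
  simp only [X_comm u]

theorem eu_lm (a : Cl m) (f : Sm U) : eu (lm a f) = lm a (eu f) := by
  simp only [eu_eq, pd_lm, X_lm, map_sum]

/-- Left multiplication by the vector variable `x`. -/
def bx : Module.End ℝ (Sm U) := ∑ i, lm (vec (e i)) * X (e i)

theorem bx_eq (f : Sm U) : bx f = ∑ i, lm (vec (e i)) (X (e i) f) := by
  simp [bx, LinearMap.sum_apply]

@[simp] theorem bx_apply (f : Sm U) (x : Vec m) : bx f x = vec x * f x := by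
  rw [bx_eq, sum_apply]
  simp only [lm_apply, X_apply]
  have h : ∑ i, ⟪e i, x⟫ • vec (e i) = vec x := sum_inner_smul_map (CliffordAlgebra.ι (negSq m)) x
  rw [← h, Finset.sum_mul]
  exact Finset.sum_congr rfl fun i _ => by
    rw [mul_smul_comm, smul_mul_assoc, real_inner_comm]

theorem X_bx (u : Vec m) (f : Sm U) : X u (bx f) = bx (X u f) :=
  ext_on fun x _ => by simp

theorem pd_bx (u : Vec m) (f : Sm U) : pd u (bx f) = bx (pd u f) + lm (vec u) f := by
  have h := sum_inner_smul_map ((lm ∘ₗ CliffordAlgebra.ι (negSq m)).flip f) u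
  simp only [LinearMap.flip_apply, LinearMap.comp_apply] at h
  simp only [bx_eq, map_sum, pd_lm, pd_X, map_add, map_smul, Finset.sum_add_distrib]
  rw [← h]
  simp only [real_inner_comm]

theorem eu_bx (f : Sm U) : eu (bx f) = bx (eu f) + bx f := by
  simp only [bx_eq, map_sum, eu_lm, eu_X, map_add, Finset.sum_add_distrib]

theorem bx_smul_vec (u : Vec m) (f : Sm U) :
    lm (vec u) (bx f) = -bx (lm (vec u) f) - (2 : ℝ) • X u f := ext_on fun x _ => by
  have h := eq_sub_of_add_eq (vec_mul_add_swap u x)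
  simp only [lm_apply, bx_apply, sub_apply, neg_apply, smul_apply, X_apply, ← mul_assoc]
  rw [h, sub_mul, ← Algebra.smul_def, real_inner_comm]
  module

/-! ### Radial functions -/

end Relations

variable {m : ℕ}

theorem hasFDerivAt_norm_zpow (s : ℤ) {x : Vec m} (hx : x ≠ 0) :
    HasFDerivAt (fun y : Vec m => ‖y‖ ^ s) ((s * ‖x‖ ^ (s - 2)) • innerSL ℝ x) x := by
  have hn : ‖x‖ ≠ 0 := norm_ne_zero_iff.2 hx
  have h1 : HasFDerivAt (fun y : Vec m => ‖y‖) (fderiv ℝ (fun y : Vec m => ‖y‖) x) x :=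
    ((contDiffAt_norm ℝ hx (n := 1)).differentiableAt (by simp)).hasFDerivAt
  have h2 : fderiv ℝ (fun y : Vec m => ‖y‖) x = ‖x‖⁻¹ • innerSL ℝ x := by
    -- The derivative of the norm is recovered by comparing two derivatives of its square.
    have h3 := (h1.pow 2).unique (hasStrictFDerivAt_norm_sq x).hasFDerivAt
    ext w
    have h4 := congrArg (fun A : Vec m →L[ℝ] ℝ => A w) h3
    simp at h4
    simp only [_root_.smul_apply, innerSL_apply_apply, smul_eq_mul]
    field_simp
    linarith
  have h5 := (hasDerivAt_zpow s ‖x‖ (Or.inl hn)).comp_hasFDerivAt x h1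
  rw [h2, smul_smul, mul_assoc, ← zpow_sub_one₀ hn (s - 1),
    show s - 1 - 1 = s - 2 by ring] at h5
  exact h5

theorem contDiffOn_norm_zpow (s : ℤ) : ContDiffOn ℝ ∞ (fun y : Vec m => ‖y‖ ^ s) {0}ᶜ := by
  intro x hx
  have hx' : x ≠ 0 := hx
  have h := contDiffAt_norm ℝ hx' (n := ∞)
  have hn : ‖x‖ ≠ 0 := norm_ne_zero_iff.2 hx'
  refine ContDiffAt.contDiffWithinAt ?_
  rcases s with n | n
  · simpa using h.pow n
  · simp only [zpow_negSucc]
    exact (h.pow (n + 1)).inv (pow_ne_zero _ hn)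

theorem contDiffOn_algebraMap_norm_zpow (s : ℤ) :
    ContDiffOn ℝ ∞ (fun x : Vec m => algebraMap ℝ (Cl m) (‖x‖ ^ s)) (offZero m) :=
  (LinearMap.toContinuousLinearMap (Algebra.linearMap ℝ (Cl m))).contDiff.comp_contDiffOn
    (contDiffOn_norm_zpow s)

/-- The radial function `‖x‖^s`. -/
def rad (m : ℕ) (s : ℤ) : Sm (offZero m) :=
  of (fun x => algebraMap ℝ (Cl m) (‖x‖ ^ s)) (contDiffOn_algebraMap_norm_zpow s)

theorem rad_apply (s : ℤ) {x : Vec m} (hx : x ≠ 0) :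
    rad m s x = algebraMap ℝ (Cl m) (‖x‖ ^ s) := 
  of_apply (hg := contDiffOn_algebraMap_norm_zpow s) hx

theorem pd_rad (s : ℤ) (w : Vec m) : pd w (rad m s) = (s : ℝ) • X w (rad m (s - 2)) :=
  ext_on fun x hx => by
    have hx' : x ≠ 0 := hx
    have h1 : (rad m s : Vec m → Cl m) =ᶠ[𝓝 x] fun y => algebraMap ℝ (Cl m) (‖y‖ ^ s) := by
      filter_upwards [(offZero m).isOpen.mem_nhds hx] with y hy using rad_apply s hy
    have h2 := (LinearMap.toContinuousLinearMap (Algebra.linearMap ℝ (Cl m))).hasFDerivAt.comp x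
      (hasFDerivAt_norm_zpow s hx')
    rw [pd_apply w _ hx, h1.fderiv_eq]
    change fderiv ℝ (⇑(LinearMap.toContinuousLinearMap (Algebra.linearMap ℝ (Cl m))) ∘
      fun y => ‖y‖ ^ s) x w = _
    rw [h2.fderiv, smul_apply, X_apply, rad_apply _ hx']
    simp [Algebra.algebraMap_eq_smul_one, smul_smul]
    ring_nf

/-- Radial functions are scalar valued, hence central. -/
theorem rm_rad (a : Cl m) (s : ℤ) : rm a (rad m s) = lm a (rad m s) := ext_on fun x hx => by
  rw [rm_apply, lm_apply, rad_apply s hx, Algebra.commutes]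

theorem bx_bx_rad (s : ℤ) : bx (bx (rad m (s - 2))) = -rad m s := ext_on fun x hx => by
  have hn : ‖x‖ ≠ 0 := norm_ne_zero_iff.2 hx
  rw [bx_apply, bx_apply, ← mul_assoc, vec_mul_self, neg_apply, rad_apply _ hx, rad_apply _ hx,
    ← map_mul, ← map_neg]
  congr 1
  rw [zpow_sub₀ hn, zpow_ofNat]
  field_simp

theorem sum_X_X_rad (s : ℤ) : ∑ i, X (e i) (X (e i) (rad m (s - 2))) = rad m s :=
  ext_on fun x hx => by
    have hn : ‖x‖ ≠ 0 := norm_ne_zero_iff.2 hx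
    have h : ∑ i, ⟪x, e i⟫ * ⟪x, e i⟫ = ‖x‖ ^ 2 := by
      rw [EuclideanSpace.real_norm_sq_eq]
      exact Finset.sum_congr rfl fun i _ => by rw [real_inner_comm, inner_e]; ring
    simp only [sum_apply, X_apply, smul_smul]
    rw [← Finset.sum_smul, h, rad_apply _ hx, rad_apply _ hx, Algebra.smul_def, ← map_mul]
    congr 1
    rw [zpow_sub₀ hn, zpow_ofNat]
    field_simp

theorem eu_rad (s : ℤ) : eu (rad m s) = (s : ℝ) • rad m s := by
  simp only [eu_eq, pd_rad, map_smul]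
  rw [← Finset.smul_sum, sum_X_X_rad]

theorem sum_pd_X {U : TopologicalSpace.Opens (Vec m)} (f : Sm U) :
    ∑ i, pd (e i) (X (e i) f) = (m : ℝ) • f + eu f := by
  simp only [pd_X, Finset.sum_add_distrib, ← eu_eq]
  have : ∀ i : Fin m, ⟪(e i : Vec m), e i⟫ = (1 : ℝ) := fun i => by rw [inner_e]; simp
  simp only [this, one_smul, Finset.sum_const, Finset.card_univ, Fintype.card_fin,
    ← Nat.cast_smul_eq_nsmul ℝ]
  abel

theorem lap_rad (s : ℤ) : lap (rad m s) = ((s : ℝ) * (m + s - 2)) • rad m (s - 2) := by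
  simp only [lap_eq, pd_rad, map_smul]
  rw [← Finset.smul_sum, sum_pd_X, eu_rad]
  push_cast
  module

/-- Each Laplacian lowers the exponent by two; after n - 1 of them the function is a multiple of the
harmonic ‖x‖^{2-m}, and the factor m + s - 2 vanishes. -/
theorem lap_pow_rad {n : ℕ} (hn : 1 ≤ n) : (lap ^ n) (rad m (2 * n - m)) = 0 := by
  induction n, hn using Nat.le_induction with
  | base => rw [pow_one, lap_rad]; simp
  | succ n hn ih =>
    rw [pow_succ, Module.End.mul_apply, lap_rad, map_smul,
      show (2 * ((n + 1 : ℕ) : ℤ) - m - 2) = 2 * n - m by push_cast; ring, ih, smul_zero]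

theorem sum_lm_lm {U : TopologicalSpace.Opens (Vec m)} (f : Sm U) :
    ∑ i, lm (vec (e i)) (lm (vec (e i)) f) = -((m : ℝ) • f) := by
  have h : lm (-1 : Cl m) f = -f := ext_on fun x _ => by simp
  simp only [lm_lm, vec_e_mul_self, h, Finset.sum_const, Finset.card_univ, Fintype.card_fin,
    ← Nat.cast_smul_eq_nsmul ℝ, smul_neg]

theorem dir_bx_rad (s : ℤ) : dir (bx (rad m s)) = -((m + s : ℝ) • rad m s) := by
  simp only [dir_eq, pd_bx, pd_rad, map_smul, map_add, Finset.sum_add_distrib]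
  rw [sum_lm_lm, ← Finset.smul_sum]
  have : ∑ i, lm (vec (e i)) (bx (X (e i) (rad m (s - 2)))) = bx (bx (rad m (s - 2))) := by
    rw [bx_eq (bx _)]
    simp only [X_bx]
  rw [this, bx_bx_rad]
  module

end Sm

open Sm

/-! ### The fundamental solutions are annihilated by `D_{1,k}` -/

section Families

variable {m : ℕ}

theorem divU_comp {U : TopologicalSpace.Opens (Vec m)} {A : Module.End ℝ (Sm U)}
    (hA : ∀ w f, A (pd w f) = pd w (A f)) (f : Vec m →ₗ[ℝ] Sm U) : divU (A ∘ₗ f) = A (divU f) := by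
  simp only [divU, map_sum, LinearMap.comp_apply, hA]

theorem divU_lap_pow {U : TopologicalSpace.Opens (Vec m)} (n : ℕ) (f : Vec m →ₗ[ℝ] Sm U) :
    divU ((lap ^ n) ∘ₗ f) = (lap ^ n) (divU f) :=
  divU_comp (fun w => lap_pow_comm (lap_pd w) n) f

/-- `u ↦ ⟨u,v⟩ ‖x‖^s - 2 ⟨x,u⟩ ⟨x,v⟩ ‖x‖^{s-2}`. -/
def evenFam (s : ℤ) (v : Vec m) : Vec m →ₗ[ℝ] Sm (offZero m) :=
  ((innerₗ (Vec m)).flip v).smulRight (rad m s) - (2 : ℝ) • X.flip (X v (rad m (s - 2)))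

theorem evenFam_apply (s : ℤ) (u v : Vec m) :
    evenFam s v u = ⟪u, v⟫ • rad m s - (2 : ℝ) • X u (X v (rad m (s - 2))) := rfl

theorem divU_evenFam (s : ℤ) (v : Vec m) :
    divU (evenFam s v) = -((2 * m + s - 2 : ℝ) • X v (rad m (s - 2))) := by
  simp only [divU, evenFam_apply, map_sub, map_smul, Finset.sum_sub_distrib]
  rw [sum_inner_smul_pd, ← Finset.smul_sum, sum_pd_X, eu_X, eu_rad, pd_rad, map_smul]
  push_cast
  module

/-- With s = 2n - m and g = ⟨x,v⟩‖x‖^{s-2}, both ‖x‖^s and g = s⁻¹ ∂_v ‖x‖^s are killed by Δ^n; s ≠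
0 because k < m. Only the commutator term -4n ∂_u Δ^{n-1} g of Δ^n(-2⟨x,u⟩g) survives. The
divergence in u is -(m + 2n - 2) g, so the coefficient 4n/(m + 2n - 2) cancels it exactly. -/
theorem opLin_evenFam {k n : ℕ} (hn : 1 ≤ n) (hk : k = 2 * n) (hkm : k < m) (u v : Vec m) :
    opLin k (evenFam (k - m) v) u = 0 := by
  have hs : (2 * n - m : ℝ) ≠ 0 := by
    have : (2 * n : ℝ) < m := by exact_mod_cast hk ▸ hkm
    linarith
  have hrad : (lap ^ n) (rad m (2 * n - m)) = 0 := lap_pow_rad hn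
  have hg : (lap ^ n) (X v (rad m (2 * n - m - 2))) = 0 := by
    have h : (2 * n - m : ℝ) • X v (rad m (2 * n - m - 2)) = pd v (rad m (2 * n - m)) := by
      rw [pd_rad]; push_cast; rfl
    have h2 : (2 * n - m : ℝ) • (lap ^ n) (X v (rad m (2 * n - m - 2))) = 0 := by
      rw [← map_smul, h, lap_pow_comm (lap_pd v), hrad, map_zero]
    exact (smul_eq_zero.1 h2).resolve_left hs
  have hmn : (m + 2 * n - 2 : ℝ) ≠ 0 := by
    have h1 : (1 : ℝ) ≤ n := by exact_mod_cast hn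
    have : (2 * n : ℝ) < m := by exact_mod_cast hk ▸ hkm
    linarith
  subst hk
  have hdiv : 2 * n / 2 = n := by lia
  rw [opLin, if_pos (even_two_mul n), hdiv, divU_lap_pow, divU_evenFam, evenFam_apply]
  push_cast
  rw [map_sub, map_smul, map_smul, lap_pow_X, hrad, hg, map_neg, map_smul, map_neg, map_smul,
    map_zero]
  match_scalars
  field_simp
  ring

/-- `u ↦ m ⟨u,v⟩ x‖x‖^t - 2m ⟨x,u⟩ ⟨x,v⟩ x‖x‖^{t-2} - u x v ‖x‖^t`. -/
def oddFam (t : ℤ) (v : Vec m) : Vec m →ₗ[ℝ] Sm (offZero m) :=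
  (m : ℝ) • ((innerₗ (Vec m)).flip v).smulRight (bx (rad m t))
    - (2 * m : ℝ) • X.flip (X v (bx (rad m (t - 2))))
    - (lm ∘ₗ CliffordAlgebra.ι (negSq m)).flip (rm (vec v) (bx (rad m t)))

theorem oddFam_apply (t : ℤ) (u v : Vec m) :
    oddFam t v u = (m : ℝ) • ⟪u, v⟫ • bx (rad m t) - (2 * m : ℝ) • X u (X v (bx (rad m (t - 2))))
      - lm (vec u) (rm (vec v) (bx (rad m t))) := rfl

theorem pd_bx_rad (t : ℤ) (v : Vec m) :
    pd v (bx (rad m t)) = lm (vec v) (rad m t) + (t : ℝ) • X v (bx (rad m (t - 2))) := by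
  rw [pd_bx, pd_rad, map_smul, X_bx]
  abel

theorem divU_oddFam (t : ℤ) (v : Vec m) :
    divU (oddFam t v) = (m : ℝ) • pd v (bx (rad m t))
      - (2 * m * (m + t) : ℝ) • X v (bx (rad m (t - 2)))
      + (m + t : ℝ) • rm (vec v) (rad m t) := by
  simp only [divU, oddFam_apply, map_sub, map_smul, Finset.sum_sub_distrib, pd_lm]
  rw [← dir_eq, ← Finset.smul_sum, sum_inner_smul_pd, ← Finset.smul_sum, sum_pd_X, eu_X, eu_bx,
    eu_rad, map_smul, map_add, map_smul, dir_rm, dir_bx_rad, map_neg, map_smul]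
  push_cast
  module

/-- The order-one case is separate: the last term of the operator has coefficient zero and its
truncated power of Δ carries no information. Here x‖x‖^{-m} is itself monogenic. -/
theorem opLin_one_oddFam (v u : Vec m) (hm : 0 < m) : opLin 1 (oddFam (-m) v) u = 0 := by
  have hm' : (m : ℝ) ≠ 0 := by positivity
  have hdirg : dir (X v (bx (rad m (-m - 2)))) = -rm (vec v) (bx (rad m (-m - 2))) := by
    rw [dir_X, dir_bx_rad, bx_smul_vec, map_neg, map_smul, ← rm_rad]
    have : rm (vec v) (bx (rad m (-m - 2))) = bx (rm (vec v) (rad m (-m - 2))) :=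
      ext_on fun x _ => by simp [mul_assoc]
    rw [this]
    push_cast
    module
  have hdir : dir (bx (rad m (-m))) = 0 := by rw [dir_bx_rad]; simp
  rw [opLin, if_neg (by decide)]
  norm_num only [Nat.cast_one, mul_one, sub_self, zero_div, zero_smul, sub_zero, pow_zero,
    add_sub_cancel_right]
  rw [Module.End.one_apply, show (1 : Module.End ℝ (Sm (offZero m))) ∘ₗ oddFam (-m) v
    = oddFam (-m) v from rfl, divU_oddFam, oddFam_apply]
  simp only [map_sub, map_smul, map_add]
  rw [dir_X, hdirg, dir_lm_vec, dir_rm, hdir, pd_rm, pd_bx_rad, pd_bx_rad, rm_rad]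
  simp only [map_neg, map_smul, map_add, map_zero, X_rm, rm_lm, rm_rad]
  push_cast
  match_scalars <;> field_simp <;> ring

/-- Let ρ = ‖x‖^t with Δ^{n+1}ρ = 0 (n already lowered by one) and σ = Δ^n ρ, so that D²σ = -Δσ = 0.
Every term of the operator reduces to left multiples and derivatives of σ and Dσ, and comparing
coefficients finishes the proof. -/
theorem opLin_oddFam {k n : ℕ} (hk : k = 2 * n + 1) (hkm : k < m) (u v : Vec m) :
    opLin k (oddFam (k - 1 - m) v) u = 0 := by
  rcases Nat.eq_zero_or_pos n with rfl | hn
  · subst hk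
    have := opLin_one_oddFam v u (by lia : 0 < m)
    simpa using this
  obtain ⟨n, rfl⟩ : ∃ j, n = j + 1 := ⟨n - 1, by lia⟩
  subst hk
  set t : ℤ := 2 * ((n + 1 : ℕ) : ℤ) - m with ht
  have htk : ((2 * (n + 1) + 1 : ℕ) : ℤ) - 1 - m = t := by rw [ht]; push_cast; ring
  have htr : (t : ℝ) = 2 * (n + 1) - m := by rw [ht]; push_cast; ring
  have hlt : (2 * (n + 1) + 1 : ℝ) < m := by exact_mod_cast hkm
  have ht0 : (2 * (n + 1) - m : ℝ) ≠ 0 := by linarith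
  have hmn : (m + 2 * (n + 1) : ℝ) ≠ 0 := by positivity
  set ρ := rad m t with hρ
  set ψ := bx ρ with hψ
  set g := X v (bx (rad m (t - 2))) with hg
  set σ := (lap ^ n) ρ with hσ
  have hlapρ : (lap ^ (n + 1)) ρ = 0 := lap_pow_rad (by lia)
  have hdirψ : dir ψ = -((2 * (n + 1) : ℝ) • ρ) := by
    rw [hψ, hρ, dir_bx_rad, htr]; congr 2; ring
  have hdirdirσ : dir (dir σ) = 0 := by
    rw [dir_dir, hσ, ← Module.End.mul_apply, ← pow_succ', hlapρ, neg_zero]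
  have hlapψ : (lap ^ (n + 1)) ψ = (2 * (n + 1) : ℝ) • dir σ := by
    have : lap ψ = (2 * (n + 1) : ℝ) • dir ρ := by
      rw [← neg_neg (lap ψ), ← dir_dir, hdirψ, map_neg, map_smul, neg_neg]
    rw [pow_succ, Module.End.mul_apply, this, map_smul, lap_pow_comm lap_dir]
  -- The product rule for ∂_v(x‖x‖^t), solved for g; t ≠ 0 since k < m. Thus g needs no Laplacian
  -- computation of its own.
  have hgeq : g = (2 * (n + 1) - m : ℝ)⁻¹ • (pd v ψ - lm (vec v) ρ) := by
    rw [hψ, hρ, pd_bx_rad, htr, add_sub_cancel_left, inv_smul_smul₀ ht0]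
  have hlapg : (lap ^ (n + 1)) g = (2 * (n + 1) - m : ℝ)⁻¹ • (2 * (n + 1) : ℝ) • pd v (dir σ) := by
    rw [hgeq, map_smul, map_sub, lap_pow_comm (lap_pd v), lap_pow_comm (lap_lm _), hlapρ, hlapψ,
      map_zero, sub_zero, map_smul]
  have hdirγ : dir ((lap ^ n) g) = (2 * (n + 1) - m : ℝ)⁻¹ •
      (lm (vec v) (dir σ) - (2 * n : ℝ) • pd v σ) := by
    rw [hgeq, map_smul, map_sub, lap_pow_comm (lap_pd v), lap_pow_comm (lap_lm _), map_smul,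
      map_sub, dir_pd, ← lap_pow_comm lap_dir, hdirψ, map_neg, map_smul, ← hσ, dir_lm_vec, map_neg,
      map_smul]
    module
  -- Since ρ is scalar, σv = vσ; applying D to both sides turns right multiplication by v into left
  -- multiplication.
  have hrm : rm (vec v) (dir σ) = -lm (vec v) (dir σ) - (2 : ℝ) • pd v σ := by
    rw [← dir_rm, hσ, ← lap_pow_comm (lap_rm _), hρ, rm_rad, lap_pow_comm (lap_lm _), dir_lm_vec]
  have hodd : ¬ Even (2 * (n + 1) + 1) := by simp [parity_simps]
  have hdiv : (2 * (n + 1) + 1 + 1) / 2 = n + 2 := by lia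
  have h3 : divU ((lap ^ n) ∘ₗ dir ∘ₗ oddFam t v) = dir ((lap ^ n) (divU (oddFam t v))) := by
    rw [divU_lap_pow, divU_comp fun w f => dir_pd w f, lap_pow_comm lap_dir]
  have hq : divU (oddFam t v) = (m : ℝ) • pd v ψ - (4 * m * (n + 1) : ℝ) • g
      + (2 * (n + 1) : ℝ) • rm (vec v) ρ := by
    rw [divU_oddFam, htr]
    congr 2
    · congr 1; ring
    · ring
  rw [htk, opLin, if_neg hodd, hdiv, show n + 2 - 1 = n + 1 from rfl, show n + 2 - 2 = n from rfl,
    divU_lap_pow, h3, hq, oddFam_apply, ← hg]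
  simp only [map_sub, map_add, map_smul]
  rw [lap_pow_X, lap_pow_comm (lap_lm _), lap_pow_comm (lap_rm _), lap_pow_comm (lap_rm _),
    lap_pow_comm (lap_rm _), lap_pow_comm (lap_pd _), lap_pow_comm (lap_pd _), hlapψ, hlapρ, hlapg,
    Nat.add_sub_cancel, dir_rm, hrm]
  have hψn : dir ((lap ^ n) ψ) = -((2 * (n + 1) : ℝ) • σ) := by
    rw [← lap_pow_comm lap_dir, hdirψ, map_neg, map_smul]
  simp only [map_add, map_smul, dir_X, dir_pd, hdirγ, dir_lm_vec, hdirdirσ, hrm,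
    map_zero, map_neg, map_sub, hψn, pd_lm]
  push_cast
  have hmn2 : (m + 2 * (n + 2) - 2 : ℝ) ≠ 0 := by
    convert hmn using 1; ring
  match_scalars <;> field_simp <;> ring

end Families

/-! ### The fundamental solution as a family of smooth functions -/

section Fundamental

variable {m k : ℕ}

open Classical in
/-- The functions `E_{1,k}(·, u, v)`, as a family which is linear in `u`. -/
def famE (k : ℕ) (c₁ : ℝ) (v : Vec m) : Vec m →ₗ[ℝ] Sm (offZero m) :=
  if Even k then (c₁ * (sphereArea m)⁻¹ * m) • evenFam (k - m) v
  else (c₁ * (sphereArea m)⁻¹) • oddFam (k - 1 - m) v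

theorem vec_smul (c : ℝ) (x : Vec m) : vec (c • x) = c • vec x := map_smul _ _ _

theorem inner_sandwich (x u v : Vec m) :
    ⟪sandwich x u, v⟫ = ‖x‖ ^ 2 * ⟪u, v⟫ - 2 * ⟪x, u⟫ * ⟪x, v⟫ := by
  rw [sandwich, inner_sub_left, real_inner_smul_left, real_inner_smul_left]

/-- The conventions for powers of zero make E vanish at the origin, matching the zero extension in
`Sm`; hence `famE_apply` holds at every x. -/
theorem E_zero (hkm : k < m) (c₁ : ℝ) (u v : Vec m) : E m k c₁ 0 u v = 0 := by
  have h : (m : ℤ) - k ≠ 0 := by lia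
  have hG : G m k 0 = 0 := by
    unfold G
    split_ifs
    · simp [zero_zpow _ h]
    · simp
  simp [E, hG]

theorem famE_apply (hkm : k < m) (c₁ : ℝ) (x u v : Vec m) :
    famE k c₁ v u x = E m k c₁ x u v := by
  by_cases hx : x = 0
  · subst hx
    rw [E_zero hkm, apply_of_notMem _ (by simp [mem_offZero])]
  have hn : ‖x‖ ≠ 0 := norm_ne_zero_iff.2 hx
  unfold famE E G Z₁
  split_ifs with hk
  · rw [LinearMap.smul_apply, evenFam_apply, Sm.smul_apply, Sm.sub_apply, Sm.smul_apply, Sm.smul_apply, X_apply,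
      X_apply, rad_apply _ hx, rad_apply _ hx, real_inner_smul_left, inner_sandwich]
    simp only [Algebra.algebraMap_eq_smul_one, add_zero, smul_mul_assoc, one_mul, smul_smul,
      ← sub_smul]
    congr 1
    rw [zpow_sub₀ hn (k - m : ℤ) 2, zpow_sub₀ hn (k : ℤ) m, zpow_sub₀ hn (m : ℤ) k]
    simp only [zpow_natCast, zpow_ofNat]
    field_simp
  -- From x² = -‖x‖², x (xux/‖x‖²) v = -u x v: this is the last term of `oddFam`.
  · have hw : vec x * (vec ((‖x‖ ^ 2)⁻¹ • sandwich x u) * vec v) = -(vec u * (vec x * vec v)) := by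
      rw [vec_smul, vec_sandwich, smul_mul_assoc, mul_smul_comm, ← mul_assoc, ← mul_assoc,
        ← mul_assoc, vec_mul_self, ← Algebra.smul_def, smul_mul_assoc, smul_mul_assoc, smul_smul,
        mul_assoc]
      rw [show (‖x‖ ^ 2)⁻¹ * -‖x‖ ^ 2 = -1 by field_simp, neg_one_smul]
    rw [LinearMap.smul_apply, oddFam_apply, Sm.smul_apply, Sm.sub_apply, Sm.sub_apply, Sm.smul_apply, Sm.smul_apply,
      Sm.smul_apply, X_apply, X_apply, lm_apply, rm_apply, bx_apply, bx_apply, rad_apply _ hx,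
      rad_apply _ hx, real_inner_smul_left, inner_sandwich, smul_mul_assoc, mul_smul_comm, mul_add,
      hw]
    have hz : ‖x‖ ^ ((k : ℤ) - 1 - m) = 1 / ‖x‖ ^ ((m : ℤ) - k + 1) := by
      rw [one_div, ← zpow_neg]; congr 1; ring
    have hz2 : ‖x‖ ^ ((k : ℤ) - 1 - m - 2) = 1 / ‖x‖ ^ ((m : ℤ) - k + 1) * (‖x‖ ^ 2)⁻¹ := by
      rw [zpow_sub₀ hn _ 2, hz, zpow_ofNat, div_eq_mul_inv]
    rw [hz, hz2]
    simp only [Algebra.algebraMap_eq_smul_one, mul_smul_comm, smul_mul_assoc, mul_one]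
    match_scalars
    · field_simp
    · field_simp

theorem E_smul (c₁ : ℝ) (u v : Vec m) {t : ℝ} (ht : 0 < t) {x : Vec m} (hx : x ≠ 0) :
    E m k c₁ (t • x) u v = t ^ ((k : ℤ) - m) • E m k c₁ x u v := by
  have hn : ‖x‖ ≠ 0 := norm_ne_zero_iff.2 hx
  have hs : (‖t • x‖ ^ 2)⁻¹ • sandwich (t • x) u = (‖x‖ ^ 2)⁻¹ • sandwich x u := by
    simp only [sandwich, norm_smul, Real.norm_of_nonneg ht.le, real_inner_smul_left, smul_sub,
      smul_smul]
    congr 2 <;> field_simp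
  have hG : G m k (t • x) = t ^ ((k : ℤ) - m) • G m k x := by
    unfold G
    rw [norm_smul, Real.norm_of_nonneg ht.le]
    split_ifs
    · rw [Algebra.algebraMap_eq_smul_one, Algebra.algebraMap_eq_smul_one, smul_smul, mul_zpow,
        one_div, mul_inv, ← zpow_neg, one_div, neg_sub]
    · rw [vec_smul, smul_smul, smul_smul, mul_zpow, one_div, mul_inv, ← zpow_neg, one_div,
        mul_right_comm, ← zpow_add_one₀ ht.ne']
      congr 3
      ring
  rw [E, E, hs, hG, smul_mul_assoc, smul_comm]

theorem E_neg (hk : Odd k) (c₁ : ℝ) (x u v : Vec m) : E m k c₁ (-x) u v = -E m k c₁ x u v := by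
  have hk' : ¬ Even k := Nat.not_even_iff_odd.2 hk
  simp [E, G, if_neg hk', sandwich, vec]

theorem decay_famE {l : ℕ} (hl : l + k ≤ m) (hkm : k < m) (c₁ : ℝ) (u v : Vec m) :
    Decay l (famE k c₁ v u : Vec m → Cl m) := by
  refine decay_of_homogeneous (s := (k : ℤ) - m) (by lia) (contDiffOn (famE k c₁ v u))
    fun t ht x hx => ?_
  rw [famE_apply hkm, famE_apply hkm, E_smul c₁ u v ht hx]

theorem opLin_famE (hk : 1 ≤ k) (hkm : k < m) (c₁ : ℝ) (u v : Vec m) :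
    opLin k (famE k c₁ v) u = 0 := by
  have hsmul : ∀ (c : ℝ) (f : Vec m →ₗ[ℝ] Sm (offZero m)), opLin k f u = 0 →
      opLin k (c • f) u = 0 := by
    intro c f hf
    let R : Submodule ℝ (Sm (offZero m) × Sm (offZero m)) :=
      LinearMap.graph (c • LinearMap.id)
    have h := opLin_mem R (fun w q hq => by
        simp only [R, LinearMap.mem_graph_iff] at hq ⊢
        rw [hq]; simp) (fun a q hq => by
        simp only [R, LinearMap.mem_graph_iff] at hq ⊢
        rw [hq]; simp) k f (c • f) (fun u => by simp [R]) u
    rw [LinearMap.mem_graph_iff, hf] at h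
    simpa using h
  unfold famE
  split_ifs with he
  · obtain ⟨n, hn⟩ := he
    exact hsmul _ _ (opLin_evenFam (n := n) (by lia) (by lia) hkm u v)
  · obtain ⟨n, hn⟩ := Nat.not_even_iff_odd.1 he
    exact hsmul _ _ (opLin_oddFam hn hkm u v)

/-- This is monogenicity in u, since D_u of a linear map L is ∑ e_i L(e_i). The terms combine to
m(vx + xv)‖x‖^t - 2m⟨x,v⟩ x²‖x‖^{t-2} = 0. -/
theorem sum_lm_famE (hk : ¬ Even k) (c₁ : ℝ) (v : Vec m) :
    ∑ i, lm (vec (e i)) (famE k c₁ v (e i)) = 0 := by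
  have h := sum_inner_smul_map ((lm ∘ₗ CliffordAlgebra.ι (negSq m)).flip
    (bx (rad m ((k : ℤ) - 1 - m)))) v
  simp only [LinearMap.flip_apply, LinearMap.comp_apply] at h
  simp only [famE, if_neg hk, LinearMap.smul_apply, oddFam_apply, map_smul, map_sub]
  rw [← Finset.smul_sum, Finset.sum_sub_distrib, Finset.sum_sub_distrib, sum_lm_lm,
    ← Finset.smul_sum, ← Finset.smul_sum, ← bx_eq, ← X_bx, bx_bx_rad]
  change _ • (_ • (∑ i, ⟪e i, v⟫ • lm (CliffordAlgebra.ι (negSq m) (e i)) _) - _ - _) = _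
  rw [h, bx_smul_vec, ← rm_rad]
  have : rm (vec v) (bx (rad m ((k : ℤ) - 1 - m))) = bx (rm (vec v) (rad m ((k : ℤ) - 1 - m))) :=
    ext_on fun x _ => by simp [mul_assoc]
  rw [this, map_neg]
  module

end Fundamental

/-! ### Periodized families -/

section PeriodizeFam

variable {m l p : ℕ} {δ : Lat m l}

/-- The relation between a function and its sign-twisted periodization. -/
def perRel (p : ℕ) (δ : Lat m l) : Submodule ℝ (Sm (offZero m) × Sm (offLattice m l)) where
  carrier := {q | Decay l (q.1 : Vec m → Cl m) ∧
    ∀ x ∉ lattice m l, q.2 x = periodize p δ (q.1 : Vec m → Cl m) x}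
  zero_mem' := ⟨decay_zero, fun x _ => by
    change (0 : Cl m) = periodize p δ (fun _ => 0) x
    simp [periodize, diffTerm]⟩
  add_mem' := fun {q r} hq hr => ⟨hq.1.add hr.1, fun x hx => by
    change q.2 x + r.2 x = periodize p δ (q.1.1 + r.1.1) x
    rw [hq.2 x hx, hr.2 x hx, periodize_add hq.1 hr.1 hx]⟩
  smul_mem' := fun c q hq => ⟨hq.1.clm_comp (c • ContinuousLinearMap.id ℝ (Cl m)), fun x hx => by
    change c • q.2 x = periodize p δ (fun y => (c • ContinuousLinearMap.id ℝ (Cl m)) (q.1.1 y)) x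
    rw [hq.2 x hx, periodize_clm hq.1 _ hx]
    rfl⟩

theorem lm_mem_perRel (a : Cl m) (q : Sm (offZero m) × Sm (offLattice m l))
    (hq : q ∈ perRel p δ) : (lm a q.1, lm a q.2) ∈ perRel p δ := by
  let A : Cl m →L[ℝ] Cl m := LinearMap.toContinuousLinearMap (LinearMap.mul ℝ (Cl m) a)
  refine ⟨hq.1.clm_comp A, fun x hx => ?_⟩
  change a * q.2 x = periodize p δ (fun y => A (q.1.1 y)) x
  rw [hq.2 x hx, periodize_clm hq.1 _ hx]
  rfl

theorem pd_mem_perRel (w : Vec m) (q : Sm (offZero m) × Sm (offLattice m l))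
    (hq : q ∈ perRel p δ) : (pd w q.1, pd w q.2) ∈ perRel p δ := by
  let A : (Vec m →L[ℝ] Cl m) →L[ℝ] Cl m := ContinuousLinearMap.apply ℝ (Cl m) w
  have h1 : ∀ x ≠ 0, pd w q.1 x = A (fderiv ℝ q.1 x) := fun x hx => pd_apply w q.1 hx
  refine ⟨(hq.1.fderiv.clm_comp A).congr h1, fun x hx => ?_⟩
  have h2 : periodize p δ (pd w q.1 : Vec m → Cl m) x
      = periodize p δ (fun y => A (fderiv ℝ q.1 y)) x := by
    simp only [periodize, diffTerm]
    congr 2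
    funext a
    rw [h1 _ (add_emb_ne_zero hx a.2), h1 _ (add_emb_ne_zero hx (a + δ).2)]
  have h3 : (q.2 : Vec m → Cl m) =ᶠ[𝓝 x] periodize p δ (q.1 : Vec m → Cl m) := by
    filter_upwards [(offLattice m l).isOpen.mem_nhds hx] with y hy using hq.2 y hy
  change pd w q.2 x = periodize p δ (pd w q.1 : Vec m → Cl m) x
  rw [h2, periodize_clm hq.1.fderiv _ hx, pd_apply w q.2 hx, h3.fderiv_eq,
    (hasFDerivAt_periodize hq.1 hx).fderiv]
  rfl

/-- Single-valuedness of the relation: it gives linearity of `perFam` in u, and turns a vanishing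
first component into a vanishing second one. -/
theorem eq_of_mem_perRel {f : Sm (offZero m)} {g g' : Sm (offLattice m l)}
    (h : (f, g) ∈ perRel p δ) (h' : (f, g') ∈ perRel p δ) : g = g' :=
  ext_on fun x hx => by rw [h.2 x hx, h'.2 x hx]

/-- The sign-twisted periodization of a family which is linear in `u`. -/
def perFam (p : ℕ) (δ : Lat m l) (f : Vec m →ₗ[ℝ] Sm (offZero m))
    (hf : ∀ u, Decay l (f u : Vec m → Cl m)) : Vec m →ₗ[ℝ] Sm (offLattice m l) :=
  have hmem : ∀ u, (f u, Sm.of (periodize p δ (f u : Vec m → Cl m))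
      (contDiffOn_periodize (hf u))) ∈ perRel p δ := fun u =>
    ⟨hf u, fun _ hx => of_apply (hg := contDiffOn_periodize (hf u)) hx⟩
  { toFun := fun u => Sm.of (periodize p δ (f u : Vec m → Cl m)) (contDiffOn_periodize (hf u))
    map_add' := fun u w => eq_of_mem_perRel (hmem (u + w)) (by
      rw [map_add]; exact add_mem (hmem u) (hmem w))
    map_smul' := fun c u => eq_of_mem_perRel (hmem (c • u)) (by
      rw [map_smul]; exact Submodule.smul_mem _ c (hmem u)) }

theorem perFam_mem (f : Vec m →ₗ[ℝ] Sm (offZero m)) (hf : ∀ u, Decay l (f u : Vec m → Cl m))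
    (u : Vec m) : (f u, perFam p δ f hf u) ∈ perRel p δ :=
  ⟨hf u, fun _ hx => of_apply (hg := contDiffOn_periodize (hf u)) hx⟩

theorem laplacian_linear (L : Vec m →ₗ[ℝ] Cl m) (u : Vec m) :
    Laplacian.laplacian (fun w => L w) u = 0 := by
  have h : (fderiv ℝ fun w => L w) = fun _ => LinearMap.toContinuousLinearMap L :=
    funext fun x => (LinearMap.toContinuousLinearMap L).hasFDerivAt.fderiv
  rw [InnerProductSpace.laplacian_eq_iteratedFDeriv_stdOrthonormalBasis]
  refine Finset.sum_eq_zero fun i _ => ?_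
  rw [iteratedFDeriv_two_apply, h]
  simp

theorem mem_degreeOne_of_linear {k : ℕ} (L : Vec m →ₗ[ℝ] Cl m)
    (hL : ¬ Even k → ∑ i, vec (e i) * L (e i) = 0) : (fun u => L u) ∈ degreeOne m k :=
  ⟨⟨L, fun _ => rfl⟩, fun _ u => laplacian_linear L u, fun hk u => by
    simp only [diracU, lineDeriv_linear]
    exact hL hk⟩

/-- The sign-twisted periodization of `E_{1,k}` is a sign-twisted kernel. -/
theorem isTwistedKernel_of_periodize {k : ℕ} (hk : 1 ≤ k) (hkm : k < m) (hl : l + k ≤ m) {c₁ : ℝ}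
    {c : Vec m → Vec m → Vec m → Cl m}
    (hc : ∀ x ∉ lattice m l, ∀ u v, c x u v = periodize p δ (fun y => E m k c₁ y u v) x) :
    IsTwistedKernel m l k p c := by
  have hE : ∀ u v, (famE k c₁ v u : Vec m → Cl m) = fun y => E m k c₁ y u v := fun u v =>
    funext fun x => famE_apply hkm c₁ x u v
  let F : Vec m → Vec m →ₗ[ℝ] Sm (offLattice m l) := fun v =>
    perFam p δ (famE k c₁ v) fun u => decay_famE hl hkm c₁ u v
  have hmem : ∀ u v, (famE k c₁ v u, F v u) ∈ perRel p δ := fun u v => perFam_mem _ _ u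
  have hF : ∀ x ∉ lattice m l, ∀ u v, c x u v = F v u x := fun x hx u v => by
    rw [(hmem u v).2 x hx, hc x hx, hE]
  refine ⟨fun v => ?_, fun x hx v => ?_, fun a ha x hx u v => ?_, fun x hx u v => ?_⟩
  -- Joint smoothness follows from smoothness in x by expanding u in coordinates.
  · have h : ContDiffOn ℝ ∞ (fun q : Vec m × Vec m => ∑ i, q.2 i • F v (e i) q.1)
        ((lattice m l : Set (Vec m))ᶜ ×ˢ univ) := by
      refine ContDiffOn.sum fun i _ => ContDiffOn.fun_smul ?_ ?_
      · exact ((EuclideanSpace.proj (𝕜 := ℝ) i).contDiff.comp contDiff_snd).contDiffOn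
      · exact (contDiffOn (F v (e i))).comp contDiff_fst.contDiffOn fun q hq => hq.1
    refine h.congr fun q hq => ?_
    rw [hF q.1 hq.1]
    conv_lhs => rw [← sum_smul_e q.2, map_sum, Sm.sum_apply]
    simp only [map_smul, Sm.smul_apply]
  · let L : Vec m →ₗ[ℝ] Cl m :=
      LinearMap.proj x ∘ₗ (Sm (offLattice m l)).subtype ∘ₗ F v
    have hL : (fun u => c x u v) = fun u => L u := funext fun u => hF x hx u v
    rw [hL]
    refine mem_degreeOne_of_linear L fun hk' => ?_
    have h1 : (∑ i, lm (vec (e i)) (famE k c₁ v (e i)), ∑ i, lm (vec (e i)) (F v (e i)))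
        ∈ perRel p δ := by
      have := (perRel p δ).sum_mem (t := Finset.univ)
        fun i _ => lm_mem_perRel (vec (e i)) _ (hmem (e i) v)
      rwa [show ∑ i, (lm (vec (e i)) (famE k c₁ v (e i)), lm (vec (e i)) (F v (e i)))
        = (∑ i, lm (vec (e i)) (famE k c₁ v (e i)), ∑ i, lm (vec (e i)) (F v (e i))) from
        Prod.ext Prod.fst_sum Prod.snd_sum] at this
    rw [sum_lm_famE hk'] at h1
    have h2 := congrArg (fun f : Sm (offLattice m l) => f x)
      (eq_of_mem_perRel h1 (zero_mem (perRel p δ)))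
    simp only [Sm.sum_apply, lm_apply] at h2
    exact h2
  · rw [hc _ (add_emb_notMem hx ha), hc x hx]
    exact periodize_add_emb ⟨a, ha⟩ x
  · have hrep : Rep (fun y w => c y w v) (F v) := fun y hy w => hF y hy w v
    rw [hrep.opD k hx u]
    -- D_{1,k} maps a function and its periodization to a related pair, whose first entry is zero.
    have h := opLin_mem (perRel p δ) pd_mem_perRel lm_mem_perRel k _ (F v)
      (fun u => hmem u v) u
    rw [opLin_famE hk hkm] at h
    rw [eq_of_mem_perRel h (zero_mem (perRel p δ))]
    rfl

end PeriodizeFam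

/-! ### Absolutely convergent periodizations -/

section Absolute

variable {m l p : ℕ} {W : Type} [NormedAddCommGroup W] [NormedSpace ℝ W] {f : Vec m → W}

theorem half_norm_emb_le {x : Vec m} {a : Fin m → ℤ} {R : ℝ} (hx : ‖x‖ ≤ R)
    (ha : 2 * R ≤ ‖emb m a‖) : ‖emb m a‖ / 2 ≤ ‖x + emb m a‖ := by
  have := norm_sub_le (x + emb m a) x
  rw [add_sub_cancel_left] at this
  linarith

theorem inv_pow_le_of_half_le {A B : ℝ} (hA : 0 < A) (h : A / 2 ≤ B) (n : ℕ) :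
    (B ^ n)⁻¹ ≤ 2 ^ n * (A ^ n)⁻¹ := by
  rw [← div_eq_mul_inv, ← inv_div, ← div_pow]
  exact inv_anti₀ (by positivity) (pow_le_pow_left₀ (by positivity) h _)

theorem exists_norm_le_of_isCompact {K : Set (Vec m)} (hK : IsCompact K) :
    ∃ R, 0 ≤ R ∧ ∀ x ∈ K, ‖x‖ ≤ R := by
  obtain ⟨R, hR⟩ := hK.exists_bound_of_continuousOn continuousOn_id
  exact ⟨|R|, abs_nonneg R, fun x hx => (hR x hx).trans (le_abs_self R)⟩

theorem Decay.exists_summable_bound_twist (hf : Decay (l + 1) f) {K : Set (Vec m)}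
    (hK : IsCompact K) (hKl : K ⊆ (lattice m l : Set (Vec m))ᶜ) :
    ∃ b : Lat m l → ℝ, Summable b ∧ ∀ a : Lat m l, ∀ x ∈ K,
      ‖sgn p a.1 • f (x + emb m a)‖ ≤ b a := by
  obtain ⟨C, hC, h⟩ := hf.norm_le
  obtain ⟨R, hR, hRK⟩ := exists_norm_le_of_isCompact hK
  refine exists_summable_bound hK
    (fun a => (continuousOn_comp_add_emb hf.smooth.continuousOn hKl a).const_smul _)
    ((summable_norm_emb_pow_inv (m := m) (l := l) (Nat.lt_succ_self l)).mul_left (C * 2 ^ (l + 1)))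
    (finite_lat_norm_emb_lt (2 * R + 2)) fun a ha x hx => ?_
  have ha' : 2 * R + 2 ≤ ‖emb m a‖ := not_lt.1 ha
  have hxa := half_norm_emb_le (hRK x hx) (by linarith : 2 * R ≤ ‖emb m a‖)
  rw [norm_sgn_smul, mul_assoc]
  exact (h _ (by linarith)).trans (mul_le_mul_of_nonneg_left
    (inv_pow_le_of_half_le (by linarith) hxa _) hC)

theorem tsum_twist_add (δ : Lat m l) (x : Vec m) :
    ∑' a : Lat m l, sgn p a.1 • f (x + emb m (a + δ : Lat m l))
      = sgn p δ.1 • ∑' a : Lat m l, sgn p a.1 • f (x + emb m a) := by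
  rw [← tsum_const_smul'', ← (Equiv.addRight δ).tsum_eq
    (fun a : Lat m l => sgn p δ.1 • sgn p a.1 • f (x + emb m a))]
  refine tsum_congr fun a => ?_
  have h : sgn p δ.1 * sgn p δ.1 = 1 := by rcases sgn_cases p δ.1 with h | h <;> simp [h]
  rw [Equiv.coe_addRight, AddSubgroup.coe_add, sgn_add, smul_smul, mul_left_comm, h, mul_one]

/-- With one more order of decay the two halves of the difference series converge separately.
Shifting the index by δ reverses the sign, so they add up to twice the series. -/
theorem Decay.periodize_eq_tsum [CompleteSpace W] (hf : Decay (l + 1) f) {δ : Lat m l}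
    (hδ : sgn p δ.1 = -1) {x : Vec m} (hx : x ∉ lattice m l) :
    periodize p δ f x = ∑' a : Lat m l, sgn p a.1 • f (x + emb m a) := by
  have hs : Summable fun a : Lat m l => sgn p a.1 • f (x + emb m a) := by
    obtain ⟨b, hb, h⟩ := hf.exists_summable_bound_twist (p := p)
      (isCompact_singleton (x := x)) (by simpa using hx)
    exact Summable.of_norm_bounded hb fun a => h a x rfl
  have hs' : Summable fun a : Lat m l => sgn p a.1 • f (x + emb m (a + δ : Lat m l)) := by
    have h := ((Equiv.addRight δ).summable_iff.2 hs).const_smul (sgn p δ.1)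
    refine h.congr fun a => ?_
    have h : sgn p δ.1 * sgn p δ.1 = 1 := by rcases sgn_cases p δ.1 with h | h <;> simp [h]
    rw [Function.comp_apply, Equiv.coe_addRight, AddSubgroup.coe_add, sgn_add, smul_smul,
      mul_left_comm, h, mul_one]
  simp only [periodize, diffTerm, smul_sub]
  rw [hs.tsum_sub hs', tsum_twist_add, hδ]
  module

end Absolute

/-! ### Summation over boxes -/

section Box

variable {m l p : ℕ}

/-- The lattice points with coordinates of absolute value at most `N`. -/
def latBox (m l N : ℕ) : Finset (Lat m l) := by
  classical
  exact (Fintype.piFinset fun _ : Fin m => Finset.Icc (-(N : ℤ)) N).subtype (· ∈ Lat m l)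

theorem mem_latBox {N : ℕ} {a : Lat m l} : a ∈ latBox m l N ↔ ∀ i, |a.1 i| ≤ N := by
  simp [latBox, abs_le]

theorem tendsto_latBox : Tendsto (latBox m l) atTop atTop := by
  refine tendsto_atTop_finset_of_monotone (fun N M hNM a ha => ?_) fun a => ?_
  · rw [mem_latBox] at ha ⊢
    exact fun i => (ha i).trans (by exact_mod_cast hNM)
  · refine ⟨∑ i, (a.1 i).natAbs, mem_latBox.2 fun i => ?_⟩
    rw [Int.abs_eq_natAbs]
    exact_mod_cast Finset.single_le_sum (f := fun i => (a.1 i).natAbs) (fun _ _ => Nat.zero_le _)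
      (Finset.mem_univ i)

/-- One coordinate is pinned and those of index at least l vanish, leaving at most l - 1 free ones.
-/
theorem card_face_le {s : Finset (Lat m l)} {o : Fin m} (ho : (o : ℕ) = 0) {N : ℕ} {c : ℤ}
    (h : ∀ a ∈ s, a.1 o = c ∧ ∀ i ≠ o, |a.1 i| ≤ N) : s.card ≤ (2 * N + 1) ^ (l - 1) := by
  classical
  let t : Finset (Fin m → ℤ) := Fintype.piFinset fun i : Fin m =>
    if i = o then {c} else if (i : ℕ) < l then Finset.Icc (-(N : ℤ)) N else {0}
  have h1 : s.card ≤ t.card := by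
    refine Finset.card_le_card_of_injOn (fun a => a.1) (fun a ha => ?_)
      Subtype.val_injective.injOn
    rw [Finset.mem_coe, Fintype.mem_piFinset]
    intro i
    by_cases hi : i = o
    · subst hi; simp [(h a ha).1]
    · by_cases hil : (i : ℕ) < l
      · simpa [hi, hil, abs_le] using (h a ha).2 i hi
      · simpa [hi, hil] using a.2 i (not_lt.1 hil)
  refine h1.trans ?_
  rw [Fintype.card_piFinset]
  have h2 : ∀ i : Fin m, (if i = o then ({c} : Finset ℤ) else if (i : ℕ) < l then
      Finset.Icc (-(N : ℤ)) N else {0}).card = if i ≠ o ∧ (i : ℕ) < l then 2 * N + 1 else 1 := by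
    intro i
    by_cases hi : i = o
    · simp [hi]
    · by_cases hil : (i : ℕ) < l
      · simp only [hi, hil, if_false, if_true, ne_eq, not_false_eq_true, and_self, Int.card_Icc]
        lia
      · simp [hi, hil]
  rw [Finset.prod_congr rfl fun i _ => h2 i, Finset.prod_ite, Finset.prod_const, Finset.prod_const,
    one_pow, mul_one]
  refine Nat.pow_le_pow_right (by lia) ?_
  calc (Finset.univ.filter fun x : Fin m => x ≠ o ∧ (x : ℕ) < l).card
      ≤ (Finset.Ioo 0 l).card := by
        refine Finset.card_le_card_of_injOn (fun i => (i : ℕ)) (fun i hi => ?_)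
          Fin.val_injective.injOn
        simp only [Finset.coe_filter, Finset.mem_univ, true_and, mem_ofPred_eq] at hi
        rw [Finset.mem_coe, Finset.mem_Ioo]
        refine ⟨Nat.pos_of_ne_zero fun h0 => hi.1 (Fin.ext (h0.trans ho.symm)), hi.2⟩
    _ = l - 1 := by simp

variable {W : Type} [NormedAddCommGroup W] [NormedSpace ℝ W] {f : Vec m → W}

/-- At most (3N)^{l-1} points carry terms of size at most C(N/2)^{-l}, which leaves O(1/N); 6^l
absorbs 3^{l-1} and 2^l. -/
theorem norm_sum_face_le {C R : ℝ} (hC : 0 ≤ C)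
    (hf : ∀ y, 1 ≤ ‖y‖ → ‖f y‖ ≤ C * (‖y‖ ^ l)⁻¹) (hl : 1 ≤ l) {s : Finset (Lat m l)} {o : Fin m}
    (ho : (o : ℕ) = 0) {N : ℕ} (hN : 2 * R + 2 ≤ N) {c : ℤ} (hc : (N : ℤ) ≤ |c|)
    (h : ∀ a ∈ s, a.1 o = c ∧ ∀ i ≠ o, |a.1 i| ≤ N) {x : Vec m} (hx : ‖x‖ ≤ R) :
    ‖∑ a ∈ s, sgn p a.1 • f (x + emb m a)‖ ≤ C * 6 ^ l * (N : ℝ)⁻¹ := by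
  have hR : 0 ≤ R := (norm_nonneg x).trans hx
  have hN0 : (0 : ℝ) < N := by linarith
  have hN1 : (1 : ℝ) ≤ N := by linarith
  have hterm : ∀ a ∈ s, ‖sgn p a.1 • f (x + emb m a)‖ ≤ C * (2 ^ l * ((N : ℝ) ^ l)⁻¹) := by
    intro a ha
    have h1 : (N : ℝ) ≤ ‖emb m a‖ := by
      refine le_trans ?_ (abs_le_norm_emb a.1 o)
      rw [(h a ha).1]
      exact_mod_cast hc
    have h2 := half_norm_emb_le hx (by linarith : 2 * R ≤ ‖emb m a‖)
    rw [norm_sgn_smul]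
    exact (hf _ (by linarith)).trans (mul_le_mul_of_nonneg_left
      (inv_pow_le_of_half_le hN0 (by linarith) _) hC)
  refine (norm_sum_le_of_le s hterm).trans ?_
  rw [Finset.sum_const, nsmul_eq_mul]
  have hcard : (s.card : ℝ) ≤ (3 * N) ^ (l - 1) := by
    calc (s.card : ℝ) ≤ ((2 * N + 1) ^ (l - 1) : ℕ) := by exact_mod_cast card_face_le ho h
      _ ≤ (3 * N) ^ (l - 1) := by
        push_cast
        exact pow_le_pow_left₀ (by positivity) (by linarith) _
  obtain ⟨j, rfl⟩ : ∃ j, l = j + 1 := ⟨l - 1, by lia⟩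
  calc (s.card : ℝ) * (C * (2 ^ (j + 1) * ((N : ℝ) ^ (j + 1))⁻¹))
      ≤ (3 * N) ^ j * (C * (2 ^ (j + 1) * ((N : ℝ) ^ (j + 1))⁻¹)) :=
        mul_le_mul_of_nonneg_right hcard (by positivity)
    _ = C * (3 ^ j * 2 ^ (j + 1)) * (N : ℝ)⁻¹ := by
        rw [mul_pow, pow_succ (N : ℝ) j]
        field_simp
    _ ≤ C * 6 ^ (j + 1) * (N : ℝ)⁻¹ := by
        refine mul_le_mul_of_nonneg_right (mul_le_mul_of_nonneg_left ?_ hC) (by positivity)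
        rw [show (6 : ℝ) = 3 * 2 by norm_num, mul_pow]
        exact mul_le_mul_of_nonneg_right (pow_le_pow_right₀ (by norm_num) (by lia)) (by positivity)

/-- The sums over boxes of a function of critical decay converge, if they are sign-twisted in the
first coordinate. -/
theorem tendstoUniformlyOn_sum_latBox [CompleteSpace W] (hf : Decay l f) (hl : 1 ≤ l) {o : Fin m}
    (ho : (o : ℕ) = 0) {δ : Lat m l} (hδo : δ.1 = Pi.single o 1) (hδ : sgn p δ.1 = -1)
    {K : Set (Vec m)} (hK : IsCompact K) (hKl : K ⊆ (lattice m l : Set (Vec m))ᶜ) :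
    TendstoUniformlyOn (fun N x => ∑ a ∈ latBox m l N, sgn p a.1 • f (x + emb m a))
      (periodize p δ f) atTop K := by
  classical
  obtain ⟨b, hb, hbound⟩ := exists_summable_bound_diffTerm (p := p) (δ := δ) hf hK hKl
  have hP : TendstoUniformlyOn
      (fun N x => (1 / 2 : ℝ) • ∑ a ∈ latBox m l N, diffTerm p δ f a x)
      (periodize p δ f) atTop K := by
    have h1 := tendstoUniformlyOn_tsum hb hbound
    have h2 : TendstoUniformlyOn (fun N x => ∑ a ∈ latBox m l N, diffTerm p δ f a x)
        (fun x => ∑' a, diffTerm p δ f a x) atTop K :=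
      fun u hu => tendsto_latBox.eventually (h1 u hu)
    exact (uniformContinuous_const_smul (1 / 2 : ℝ)).comp_tendstoUniformlyOn h2
  obtain ⟨C, hC, hCf⟩ := hf.norm_le
  obtain ⟨R, hR, hRK⟩ := exists_norm_le_of_isCompact hK
  have hQ : TendstoUniformlyOn (fun (N : ℕ) x =>
      ∑ a ∈ latBox m l N, sgn p a.1 • f (x + emb m a)
        - (1 / 2 : ℝ) • ∑ a ∈ latBox m l N, diffTerm p δ f a x) (fun _ => 0) atTop K := by
    rw [Metric.tendstoUniformlyOn_iff]
    intro ε hε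
    have hlim : Tendsto (fun N : ℕ => C * 6 ^ l * (N : ℝ)⁻¹) atTop (𝓝 0) := by
      simpa using tendsto_natCast_atTop_atTop.inv_tendsto_atTop.const_mul (C * 6 ^ l)
    filter_upwards [hlim.eventually (gt_mem_nhds hε), eventually_ge_atTop ⌈2 * R + 2⌉₊]
      with N hNε hNR x hx
    have hN : 2 * R + 2 ≤ N := (Nat.le_ceil _).trans (by exact_mod_cast hNR)
    set D := latBox m l N with hD
    set D' := D.map (Equiv.addRight δ).toEmbedding with hD'
    -- As δ has sign -1, the subtracted half of the difference sum over D is the sum of h over the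
    -- translate D' = D + δ, with a plus sign. The error is therefore half of D \ D' minus D' \ D,
    -- two opposite faces of the box.
    set h : Lat m l → W := fun a => sgn p a.1 • f (x + emb m a) with hh
    have hdiff : ∑ a ∈ D, diffTerm p δ f a x = ∑ a ∈ D, h a + ∑ a ∈ D', h a := by
      rw [hD', Finset.sum_map, ← Finset.sum_add_distrib]
      refine Finset.sum_congr rfl fun a _ => ?_
      simp only [diffTerm, hh, Equiv.coe_toEmbedding, Equiv.coe_addRight, AddSubgroup.coe_add,
        sgn_add, hδ]
      module
    have heq : ∑ a ∈ D, h a - (1 / 2 : ℝ) • ∑ a ∈ D, diffTerm p δ f a x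
        = (1 / 2 : ℝ) • (∑ a ∈ D \ D', h a - ∑ a ∈ D' \ D, h a) := by
      rw [hdiff, Finset.sum_sdiff_sub_sum_sdiff]
      module
    have hmem' : ∀ a, a ∈ D' ↔ a - δ ∈ D := by
      intro a
      rw [hD', Finset.mem_map]
      constructor
      · rintro ⟨c, hc, rfl⟩
        simpa using hc
      · exact fun ha => ⟨a - δ, ha, by simp⟩
    have hsub : ∀ (a : Lat m l) (i : Fin m), i ≠ o → (a - δ).1 i = a.1 i := by
      intro a i hi
      simp [hδo, hi]
    have hsubo : ∀ a : Lat m l, (a - δ).1 o = a.1 o - 1 := by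
      intro a
      simp [hδo]
    -- Translation by e_1 loses the face with first coordinate -N and gains the one with first
    -- coordinate N + 1.
    have hf1 : ∀ a ∈ D \ D', a.1 o = -(N : ℤ) ∧ ∀ i ≠ o, |a.1 i| ≤ N := by
      intro a ha
      rw [Finset.mem_sdiff, hmem', hD, mem_latBox, mem_latBox] at ha
      refine ⟨?_, fun i _ => ha.1 i⟩
      by_contra hne
      refine ha.2 fun i => ?_
      by_cases hi : i = o
      · subst hi
        have := abs_le.1 (ha.1 i)
        rw [hsubo, abs_le]
        lia
      · rw [hsub a i hi]
        exact ha.1 i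
    have hf2 : ∀ a ∈ D' \ D, a.1 o = (N : ℤ) + 1 ∧ ∀ i ≠ o, |a.1 i| ≤ N := by
      intro a ha
      rw [Finset.mem_sdiff, hmem', hD, mem_latBox, mem_latBox] at ha
      have hi' : ∀ i ≠ o, |a.1 i| ≤ N := fun i hi => by
        rw [← hsub a i hi]
        exact ha.1 i
      refine ⟨?_, hi'⟩
      by_contra hne
      refine ha.2 fun i => ?_
      by_cases hi : i = o
      · subst hi
        have := abs_le.1 (ha.1 i)
        rw [hsubo] at this
        rw [abs_le]
        lia
      · exact hi' i hi
    rw [dist_zero_left, heq, norm_smul]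
    have h1 := norm_sum_face_le (p := p) hC hCf hl ho hN (by simp) hf1 (hRK x hx)
    have h2 := norm_sum_face_le (p := p) hC hCf hl ho hN
      (by rw [abs_of_nonneg] <;> lia) hf2 (hRK x hx)
    have h3 := norm_sub_le (∑ a ∈ D \ D', h a) (∑ a ∈ D' \ D, h a)
    have h4 : ‖(1 / 2 : ℝ)‖ = 1 / 2 := by norm_num
    rw [h4]
    linarith
  have := hP.add hQ
  simp only [Pi.add_def, add_sub_cancel, add_zero] at this
  exact this

/-! ### The symmetrized series -/

theorem neg_notMem_latPos {a : Fin m → ℤ} (ha : a ∈ latPos m l) : -a ∉ latPos m l := by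
  rintro ⟨-, i, hi, hi'⟩
  obtain ⟨-, j, hj, hj'⟩ := ha
  rw [Pi.neg_apply] at hi
  rcases lt_trichotomy i j with h | h | h
  · have := hi' j h
    rw [Pi.neg_apply] at this
    lia
  · subst h
    lia
  · have := hj' i h
    lia

theorem zero_notMem_latPos : (0 : Fin m → ℤ) ∉ latPos m l := by
  rintro ⟨-, i, hi, -⟩
  simp at hi

theorem mem_latPos_or_neg_mem {a : Fin m → ℤ} (ha : a ∈ Lat m l) (h0 : a ≠ 0) :
    a ∈ latPos m l ∨ -a ∈ latPos m l := by
  have hne : (Finset.univ.filter fun i => a i ≠ 0).Nonempty := by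
    obtain ⟨i, hi⟩ := Function.ne_iff.1 h0
    exact ⟨i, by simpa using hi⟩
  obtain ⟨j, hj, hmax⟩ := Finset.exists_max_image _ id hne
  have hj0 : a j ≠ 0 := (Finset.mem_filter.1 hj).2
  have hz : ∀ i, j < i → a i = 0 := fun i hi => by
    by_contra h
    exact absurd (hmax i (by simpa using h)) (not_le.2 hi)
  rcases lt_or_gt_of_ne hj0 with h | h
  · exact Or.inr ⟨neg_mem ha, j, by simpa using h, fun i hi => by simp [hz i hi]⟩
  · exact Or.inl ⟨ha, j, h, hz⟩

theorem mem_posBox {N : ℕ} {a : Fin m → ℤ} :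
    a ∈ posBox m l N ↔ (∀ i, |a i| ≤ N) ∧ a ∈ latPos m l := by
  simp [posBox, abs_le]

/-- The lattice is the disjoint union of 0, Λ_l and -Λ_l, and boxes are symmetric. -/
theorem sum_latBox_eq {M : Type*} [AddCommGroup M] (N : ℕ) (h : (Fin m → ℤ) → M) :
    ∑ a ∈ latBox m l N, h a = h 0 + ∑ a ∈ posBox m l N, (h a + h (-a)) := by
  classical
  let B : Finset (Fin m → ℤ) :=
    (Fintype.piFinset fun _ : Fin m => Finset.Icc (-(N : ℤ)) N).filter (· ∈ Lat m l)
  have hB : ∀ a, a ∈ B ↔ (∀ i, |a i| ≤ N) ∧ a ∈ Lat m l := fun a => by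
    simp [B, abs_le]
  have h1 : ∑ a ∈ latBox m l N, h a = ∑ a ∈ B, h a := by
    refine Finset.sum_bij (fun a _ => a.1) (fun a ha => (hB _).2 ⟨mem_latBox.1 ha, a.2⟩)
      (fun _ _ _ _ hab => Subtype.ext hab)
      (fun a ha => ⟨⟨a, ((hB a).1 ha).2⟩, mem_latBox.2 ((hB a).1 ha).1, rfl⟩) fun _ _ => rfl
  have hB0 : B = insert 0 (posBox m l N ∪ (posBox m l N).image fun a => -a) := by
    ext a
    rw [hB, Finset.mem_insert, Finset.mem_union, Finset.mem_image, mem_posBox]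
    constructor
    · rintro ⟨h1, h2⟩
      by_cases h0 : a = 0
      · exact Or.inl h0
      · rcases mem_latPos_or_neg_mem h2 h0 with h | h
        · exact Or.inr (Or.inl ⟨h1, h⟩)
        · exact Or.inr (Or.inr ⟨-a, mem_posBox.2 ⟨fun i => by simpa using h1 i, h⟩, neg_neg a⟩)
    · rintro (rfl | h | ⟨b, hb, rfl⟩)
      · exact ⟨fun i => by simp, zero_mem _⟩
      · exact ⟨h.1, h.2.1⟩
      · rw [mem_posBox] at hb
        exact ⟨fun i => by simpa using hb.1 i, neg_mem hb.2.1⟩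
  rw [h1, hB0, Finset.sum_insert, Finset.sum_union, Finset.sum_image, Finset.sum_add_distrib]
  · exact fun a _ b _ hab => neg_injective hab
  · rw [Finset.disjoint_left]
    intro a ha ha'
    obtain ⟨b, hb, rfl⟩ := Finset.mem_image.1 ha'
    exact neg_notMem_latPos (mem_posBox.1 hb).2 (mem_posBox.1 ha).2
  · intro h0
    rcases Finset.mem_union.1 h0 with h | h
    · exact zero_notMem_latPos (mem_posBox.1 h).2
    · obtain ⟨b, hb, hb0⟩ := Finset.mem_image.1 h
      rw [neg_eq_zero] at hb0
      subst hb0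
      exact zero_notMem_latPos (mem_posBox.1 hb).2

theorem sgn_neg (a : Fin m → ℤ) : sgn p (-a) = sgn p a := by
  have h := sgn_neg_mul p a
  rcases sgn_cases p a with h' | h' <;> rw [h'] at h ⊢ <;> linarith

theorem symPartial_eq_sum_latBox (k N : ℕ) (c₁ : ℝ) (u v x : Vec m) :
    symPartial m l k p c₁ u v N x
      = ∑ a ∈ latBox m l N, sgn p a.1 • E m k c₁ (x + emb m a) u v := by
  rw [sum_latBox_eq N fun a => sgn p a • E m k c₁ (x + emb m a) u v, symPartial, sgn_zero, one_smul,
    map_zero, add_zero]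
  congr 1
  refine Finset.sum_congr rfl fun a _ => ?_
  rw [symTerm, sgn_neg, smul_add, map_neg, ← sub_eq_add_neg]

theorem tendsto_sum_posBox {M : Type*} [AddCommGroup M] [TopologicalSpace M]
    {h : (Fin m → ℤ) → M} {s : M} (hs : HasSum (fun a : latPos m l => h a) s) :
    Tendsto (fun N => ∑ a ∈ posBox m l N, h a) atTop (𝓝 s) := by
  classical
  let P : ℕ → Finset (latPos m l) := fun N => (posBox m l N).subtype (· ∈ latPos m l)
  have hP : Tendsto P atTop atTop := by
    refine tendsto_atTop_finset_of_monotone (fun N M hNM a ha => ?_) fun a => ?_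
    · rw [Finset.mem_subtype, mem_posBox] at ha ⊢
      exact ⟨fun i => (ha.1 i).trans (by exact_mod_cast hNM), ha.2⟩
    · refine ⟨∑ i, (a.1 i).natAbs, Finset.mem_subtype.2 (mem_posBox.2 ⟨fun i => ?_, a.2⟩)⟩
      rw [Int.abs_eq_natAbs]
      exact_mod_cast Finset.single_le_sum (f := fun i => (a.1 i).natAbs)
        (fun _ _ => Nat.zero_le _) (Finset.mem_univ i)
  refine (hs.comp hP).congr fun N => ?_
  simp only [Function.comp_apply, P]
  rw [Finset.sum_subtype_of_mem h fun a ha => (mem_posBox.1 ha).2]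

/-- For odd k the pair equals E(x + a) - E(-x + a), a difference over the fixed displacement 2x. It
gains one order of decay whatever the signs. -/
theorem exists_summable_bound_symTerm {k : ℕ} (hk : Odd k) (hl : l + k ≤ m) (hkm : k < m) (c₁ : ℝ)
    (u v : Vec m) {K : Set (Vec m)} (hK : IsCompact K)
    (hKl : K ⊆ (lattice m l : Set (Vec m))ᶜ) :
    ∃ b : latPos m l → ℝ, Summable b ∧ ∀ a : latPos m l, ∀ x ∈ K,
      ‖symTerm m k p c₁ u v a x‖ ≤ b a := by
  have hE : ∀ x, famE k c₁ v u x = E m k c₁ x u v := fun x => famE_apply hkm c₁ x u v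
  have hf := decay_famE hl hkm c₁ u v
  set f : Vec m → Cl m := (famE k c₁ v u).1
  obtain ⟨C, hC, h⟩ := hf.norm_sub_le
  obtain ⟨R, hR, hRK⟩ := exists_norm_le_of_isCompact hK
  let ι : latPos m l → Lat m l := fun a => ⟨a.1, a.2.1⟩
  have hι : Function.Injective ι := fun a b hab => Subtype.ext (congrArg (fun c => c.1) hab)
  have hterm : ∀ (a : latPos m l) x, symTerm m k p c₁ u v a x
      = sgn p a.1 • (f (x + emb m (ι a)) + f (x + emb m (-ι a : Lat m l))) := by
    intro a x
    rw [symTerm, hE, hE, AddSubgroup.coe_neg, map_neg, ← sub_eq_add_neg]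
  refine exists_summable_bound hK (fun a => ?_)
    (((summable_norm_emb_pow_inv (m := m) (l := l) (Nat.lt_succ_self l)).comp_injective hι).mul_left
      (C * 2 ^ (l + 1) * (2 * R)))
    -- This gives ‖-x + a‖ ≥ ‖a‖/2 ≥ 4R + 2, hence at least 2 and at least twice the displacement
    -- 2‖x‖.
    ((finite_lat_norm_emb_lt (8 * R + 4)).preimage hι.injOn) fun a ha x hx => ?_
  · have := ((continuousOn_comp_add_emb hf.smooth.continuousOn hKl (ι a)).add
      (continuousOn_comp_add_emb hf.smooth.continuousOn hKl (-ι a))).const_smul (sgn p a.1)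
    exact this.congr fun x _ => hterm a x
  · have ha' : 8 * R + 4 ≤ ‖emb m a‖ := not_lt.1 ha
    have hx1 := hRK x hx
    have hxn : ‖-x‖ ≤ R := by rwa [norm_neg]
    have hxa := half_norm_emb_le hxn (by linarith : 2 * R ≤ ‖emb m a‖)
    have hd : x + emb m a - (-x + emb m a) = (2 : ℝ) • x := by module
    have hdn : ‖(2 : ℝ) • x‖ = 2 * ‖x‖ := by rw [norm_smul]; norm_num
    have hneg : x - emb m a = -(-x + emb m a) := by abel
    have h1 := h (-x + emb m a) (x + emb m a) (by linarith) (by rw [hd, hdn]; linarith)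
    rw [hd, hdn, hE, hE] at h1
    rw [symTerm, norm_sgn_smul, hneg, E_neg hk, ← sub_eq_add_neg]
    refine h1.trans ?_
    have h2 := inv_pow_le_of_half_le (by linarith) hxa (l + 1)
    calc C * (‖-x + emb m a‖ ^ (l + 1))⁻¹ * (2 * ‖x‖)
        ≤ C * (2 ^ (l + 1) * (‖emb m a‖ ^ (l + 1))⁻¹) * (2 * R) := by gcongr
      _ = C * 2 ^ (l + 1) * (2 * R) * (‖emb m a‖ ^ (l + 1))⁻¹ := by ring

end Box

open scoped Pointwise

/-! ### Second moments of the sphere -/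

section Sphere

variable {m : ℕ}

/-- The action of a linear isometry on the unit sphere. -/
def sphereMap (A : Vec m ≃ₗᵢ[ℝ] Vec m) (u : Metric.sphere (0 : Vec m) 1) :
    Metric.sphere (0 : Vec m) 1 := ⟨A u, by simp⟩

theorem continuous_sphereMap (A : Vec m ≃ₗᵢ[ℝ] Vec m) : Continuous (sphereMap A) :=
  (A.continuous.comp continuous_subtype_val).subtype_mk _

/-- Up to a constant factor the surface measure of s is the volume of the cone over s, and
isometries preserve volume. -/
theorem map_sphereMap_toSphere (A : Vec m ≃ₗᵢ[ℝ] Vec m) :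
    (volume : Measure (Vec m)).toSphere.map (sphereMap A) = (volume : Measure (Vec m)).toSphere := by
  ext s hs
  have hm := (continuous_sphereMap A).measurable
  rw [Measure.map_apply hm hs, Measure.toSphere_apply' _ (hm hs), Measure.toSphere_apply' _ hs]
  congr 1
  have h : Ioo (0 : ℝ) 1 • ((↑) '' (sphereMap A ⁻¹' s) : Set (Vec m))
      = A ⁻¹' (Ioo (0 : ℝ) 1 • ((↑) '' s : Set (Vec m))) := by
    ext x
    simp only [Set.mem_smul, mem_image, mem_preimage]
    constructor
    · rintro ⟨t, ht, _, ⟨u, hu, rfl⟩, rfl⟩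
      exact ⟨t, ht, _, ⟨sphereMap A u, hu, rfl⟩, by simp [sphereMap]⟩
    · rintro ⟨t, ht, _, ⟨u, hu, rfl⟩, hx⟩
      refine ⟨t, ht, _, ⟨sphereMap A.symm u, ?_, rfl⟩, ?_⟩
      · have : sphereMap A (sphereMap A.symm u) = u := Subtype.ext (by simp [sphereMap])
        rwa [this]
      · apply A.injective
        simp [sphereMap, ← hx]
  rw [h]
  exact A.measurePreserving.measure_preimage_emb A.toHomeomorph.measurableEmbedding _

theorem integral_comp_sphereMap (A : Vec m ≃ₗᵢ[ℝ] Vec m) {g : Metric.sphere (0 : Vec m) 1 → ℝ}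
    (hg : Continuous g) : ∫ u, g (sphereMap A u) ∂(volume : Measure (Vec m)).toSphere
      = ∫ u, g u ∂(volume : Measure (Vec m)).toSphere := by
  conv_rhs => rw [← map_sphereMap_toSphere A]
  rw [integral_map (continuous_sphereMap A).measurable.aemeasurable hg.aestronglyMeasurable]

theorem continuous_coord (i : Fin m) :
    Continuous fun u : Metric.sphere (0 : Vec m) 1 => (u : Vec m) i :=
  (EuclideanSpace.proj (𝕜 := ℝ) i).continuous.comp continuous_subtype_val

theorem continuous_coord_mul_coord (i j : Fin m) :
    Continuous fun u : Metric.sphere (0 : Vec m) 1 => (u : Vec m) i * (u : Vec m) j :=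
  (continuous_coord i).mul (continuous_coord j)

theorem integrable_sphere {W : Type*} [NormedAddCommGroup W]
    {g : Metric.sphere (0 : Vec m) 1 → W} (hg : Continuous g) :
    Integrable g (volume : Measure (Vec m)).toSphere :=
  hg.integrable_of_hasCompactSupport (HasCompactSupport.of_compactSpace g)

/-- The reflection in the hyperplane orthogonal to e_i changes the sign of the integrand. -/
theorem integral_coord_mul_coord_of_ne {i j : Fin m} (hij : i ≠ j) :
    ∫ u, (u : Vec m) i * (u : Vec m) j ∂(volume : Measure (Vec m)).toSphere = 0 := by
  have h := integral_comp_sphereMap (Submodule.reflection (ℝ ∙ (e i : Vec m))ᗮ)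
    (continuous_coord_mul_coord i j)
  have hr : ∀ (u : Vec m) (a : Fin m), Submodule.reflection (ℝ ∙ (e i : Vec m))ᗮ u a
      = u a - 2 * u i * (e i : Vec m) a := by
    intro u a
    rw [Submodule.reflection_orthogonal_apply, Submodule.reflection_singleton_apply]
    simp [inner_e]
  simp only [sphereMap, hr] at h
  have h1 : ∀ u : Metric.sphere (0 : Vec m) 1,
      ((u : Vec m) i - 2 * (u : Vec m) i * (e i : Vec m) i)
        * ((u : Vec m) j - 2 * (u : Vec m) i * (e i : Vec m) j)
      = -((u : Vec m) i * (u : Vec m) j) := by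
    intro u
    simp [hij.symm]
    ring
  simp only [h1, integral_neg] at h
  linarith

theorem integral_coord_sq_eq (i j : Fin m) :
    ∫ u, (u : Vec m) i * (u : Vec m) i ∂(volume : Measure (Vec m)).toSphere
      = ∫ u, (u : Vec m) j * (u : Vec m) j ∂(volume : Measure (Vec m)).toSphere := by
  have h := integral_comp_sphereMap
    (LinearIsometryEquiv.piLpCongrLeft 2 ℝ ℝ (Equiv.swap i j))
    (continuous_coord_mul_coord j j)
  rw [← h]
  simp [sphereMap, Equiv.piCongrLeft'_apply]

theorem mul_integral_coord_sq (i : Fin m) :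
    m * ∫ u, (u : Vec m) i * (u : Vec m) i ∂(volume : Measure (Vec m)).toSphere
      = sphereArea m := by
  have h1 : ∑ j : Fin m, ∫ u, (u : Vec m) j * (u : Vec m) j ∂(volume : Measure (Vec m)).toSphere
      = sphereArea m := by
    rw [← integral_finsetSum _ fun j _ =>
      integrable_sphere (continuous_coord_mul_coord j j)]
    have h2 : ∀ u : Metric.sphere (0 : Vec m) 1, ∑ j, (u : Vec m) j * (u : Vec m) j = 1 := by
      intro u
      have h3 : ‖(u : Vec m)‖ = 1 := mem_sphere_zero_iff_norm.1 u.2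
      have h4 := EuclideanSpace.real_norm_sq_eq (u : Vec m)
      rw [h3] at h4
      simp only [← pow_two]
      linarith
    simp [h2, sphereArea]
  rw [← h1, Finset.sum_congr rfl fun j _ => integral_coord_sq_eq j i]
  simp

/-- The second moments of the sphere are (|S|/m) δ_{ij}, so integrating a quadratic expression takes
a trace. As all elements of `degreeOne` are linear, no other integral is needed. -/
theorem integral_bilinear (hm : 0 < m) (B : Vec m →ₗ[ℝ] Vec m →ₗ[ℝ] Cl m) :
    ∫ u : Metric.sphere (0 : Vec m) 1, B u u ∂(volume : Measure (Vec m)).toSphere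
      = (sphereArea m / m) • ∑ i, B (e i) (e i) := by
  have h1 : ∀ u : Vec m, B u u = ∑ i, ∑ j, (u i * u j) • B (e i) (e j) := by
    intro u
    conv_lhs => rw [← sum_smul_e u]
    simp only [map_sum, LinearMap.sum_apply, map_smul, LinearMap.smul_apply, Finset.smul_sum,
      smul_smul]
    rw [Finset.sum_comm]
    exact Finset.sum_congr rfl fun i _ => Finset.sum_congr rfl fun j _ => by rw [mul_comm]
  have hc : ∀ i j : Fin m, Integrable (fun u : Metric.sphere (0 : Vec m) 1 =>
      ((u : Vec m) i * (u : Vec m) j) • B (e i) (e j)) (volume : Measure (Vec m)).toSphere :=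
    fun i j => integrable_sphere ((continuous_coord_mul_coord i j).smul continuous_const)
  rw [integral_congr_ae (ae_of_all _ fun u : Metric.sphere (0 : Vec m) 1 => h1 u), integral_finsetSum _ fun i _ => integrable_finsetSum _ fun j _ => hc i j, Finset.smul_sum]
  refine Finset.sum_congr rfl fun i _ => ?_
  rw [integral_finsetSum _ fun j _ => hc i j, Finset.sum_eq_single i]
  · rw [integral_smul_const]
    congr 1
    rw [eq_div_iff (by positivity), mul_comm, mul_integral_coord_sq]
  · intro j _ hj
    rw [integral_smul_const, integral_coord_mul_coord_of_ne hj.symm, zero_smul]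
  · simp

theorem sphereArea_ne_zero (hm : 0 < m) : sphereArea m ≠ 0 := by
  have : Nonempty (Fin m) := ⟨⟨0, hm⟩⟩
  have : NeZero (volume : Measure (Vec m)).toSphere := ⟨Measure.toSphere_ne_zero _⟩
  exact (measureReal_univ_pos).ne'

end Sphere

/-! ### The reproducing kernel -/

section Kernel

variable {m k : ℕ}

/-- The kernel `Z₁(·, v)` as a linear map. -/
def Z₁Lin (m k : ℕ) (v : Vec m) : Vec m →ₗ[ℝ] Cl m where
  toFun u := Z₁ m k u v
  map_add' u w := by
    unfold Z₁
    split_ifs <;> simp [inner_add_left, mul_add, add_mul]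
    abel
  map_smul' c u := by
    unfold Z₁
    split_ifs <;>
      simp [real_inner_smul_left, Algebra.algebraMap_eq_smul_one, smul_smul, mul_comm, mul_left_comm]

/-- The Clifford conjugation as a continuous linear equivalence. -/
def conj (m : ℕ) : Cl m ≃L[ℝ] Cl m :=
  (LinearEquiv.ofInvolutive
    { toFun := star
      map_add' := star_add
      map_smul' := CliffordAlgebra.star_smul } star_involutive).toContinuousLinearEquiv

theorem sum_inner_smul_vec (v : Vec m) : ∑ i, ⟪e i, v⟫ • vec (e i) = vec v :=
  sum_inner_smul_map (CliffordAlgebra.ι (negSq m)) v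

theorem Z₁_mem_degreeOne (v : Vec m) : (fun u => Z₁ m k u v) ∈ degreeOne m k := by
  refine mem_degreeOne_of_linear (Z₁Lin m k v) fun hk => ?_
  have h : ∀ i : Fin m, vec (e i) * Z₁Lin m k v (e i)
      = (sphereArea m)⁻¹ • ((m : ℝ) • (⟪e i, v⟫ • vec (e i)) - vec v) := by
    intro i
    change vec (e i) * Z₁ m k (e i) v = _
    rw [Z₁, if_neg hk, mul_smul_comm, mul_add, ← mul_assoc, vec_e_mul_self, ← Algebra.commutes,
      ← Algebra.smul_def, mul_smul, neg_one_mul, sub_eq_add_neg]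
  rw [Finset.sum_congr rfl fun i _ => h i, ← Finset.smul_sum, Finset.sum_sub_distrib,
    ← Finset.smul_sum, sum_inner_smul_vec]
  simp [← Nat.cast_smul_eq_nsmul ℝ]

theorem isReproducingKernel_Z₁ (hm : 0 < m) : IsReproducingKernel m k (Z₁ m k) := by
  refine ⟨Z₁_mem_degreeOne, fun g hg v => ?_⟩
  obtain ⟨⟨L, hL⟩, -, hmono⟩ := hg
  obtain rfl : g = fun u => L u := funext hL
  let B : Vec m →ₗ[ℝ] Vec m →ₗ[ℝ] Cl m :=
    (LinearMap.mul ℝ (Cl m)).compl₁₂ ((conj m).toLinearEquiv.toLinearMap ∘ₗ Z₁Lin m k v) L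
  have hB : ∀ u w, B u w = star (Z₁ m k u v) * L w := fun u w => rfl
  have hA := sphereArea_ne_zero hm
  have hm' : (m : ℝ) ≠ 0 := by positivity
  have hLv : ∑ i, ⟪e i, v⟫ • L (e i) = L v := sum_inner_smul_map L v
  change L v = ∫ u : Metric.sphere (0 : Vec m) 1, B u u ∂(volume : Measure (Vec m)).toSphere
  rw [integral_bilinear hm]
  simp only [hB]
  have h : ∀ i : Fin m, star (Z₁ m k (e i) v) * L (e i) = (sphereArea m)⁻¹ •
      ((m : ℝ) • (⟪e i, v⟫ • L (e i)) + vec v * if Even k then 0 else vec (e i) * L (e i)) := by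
    intro i
    rw [Z₁, CliffordAlgebra.star_smul, star_add, CliffordAlgebra.star_algebraMap, smul_mul_assoc,
      add_mul, ← Algebra.smul_def, mul_smul]
    congr 2
    split_ifs
    · simp
    · rw [star_mul, vec, vec, CliffordAlgebra.star_ι, CliffordAlgebra.star_ι, neg_mul_neg, mul_assoc]
  rw [Finset.sum_congr rfl fun i _ => h i, ← Finset.smul_sum, Finset.sum_add_distrib,
    ← Finset.smul_sum, hLv, ← Finset.mul_sum]
  -- The trace produces L(v) plus a multiple of v ∑ e_i L(e_i); for odd k this sum is D_u L = 0.
  have h0 : (∑ i, if Even k then 0 else vec (e i) * L (e i)) = 0 := by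
    by_cases hk : Even k
    · simp [hk]
    · have h1 := hmono hk 0
      simp only [diracU, lineDeriv_linear] at h1
      simpa only [if_neg hk] using h1
  rw [h0, mul_zero, add_zero, smul_smul, smul_smul]
  rw [show sphereArea m / m * (sphereArea m)⁻¹ * m = 1 by field_simp, one_smul]

/-- Each kernel reproduces the other one; the two integrals are conjugate. Taking Z = Z' gives
Hermitian symmetry, and both facts together give uniqueness. -/
theorem IsReproducingKernel.star_eq {Z Z' : Vec m → Vec m → Cl m} (hZ : IsReproducingKernel m k Z)
    (hZ' : IsReproducingKernel m k Z') (v w : Vec m) : star (Z' v w) = Z w v := by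
  rw [hZ'.2 _ (hZ.1 v) w, hZ.2 _ (hZ'.1 w) v]
  change conj m (∫ u : Metric.sphere (0 : Vec m) 1, star (Z u v) * Z' u w
    ∂(volume : Measure (Vec m)).toSphere) = _
  rw [← (conj m).integral_comp_comm]
  congr 1
  funext u
  change star (star (Z u v) * Z' u w) = _
  rw [star_mul, star_star]

theorem IsReproducingKernel.unique {Z Z' : Vec m → Vec m → Cl m} (hZ : IsReproducingKernel m k Z)
    (hZ' : IsReproducingKernel m k Z') : Z = Z' :=
  funext fun w => funext fun v => by rw [← hZ.star_eq hZ' v w, hZ'.star_eq hZ' v w]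

end Kernel

/-! ### Translations -/

section Translation

variable {m : ℕ}

/-- `f(x + t, u)`. -/
def shift (t : Vec m) (f : Fun₂ m) : Fun₂ m := fun x u => f (x + t) u

theorem dX_shift (t : Vec m) (f : Fun₂ m) (i : Fin m) : dX i (shift t f) = shift t (dX i f) := by
  funext x u
  simp only [dX, shift, lineDeriv, add_right_comm x]

theorem lapX_shift (t : Vec m) (f : Fun₂ m) : lapX (shift t f) = shift t (lapX f) := by
  funext x u
  simp only [lapX, shift, InnerProductSpace.laplacian_eq_iteratedFDeriv_stdOrthonormalBasis]
  refine Finset.sum_congr rfl fun i _ => ?_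
  rw [iteratedFDeriv_comp_add_right (f := fun y => f y u) 2 t x]

theorem lapX_iterate_shift (t : Vec m) (f : Fun₂ m) (n : ℕ) :
    lapX^[n] (shift t f) = shift t (lapX^[n] f) := by
  have h : Function.Semiconj (shift t) lapX lapX := fun f => (lapX_shift t f).symm
  exact (h.iterate_right n f).symm

theorem diracX_shift (t : Vec m) (f : Fun₂ m) : diracX (shift t f) = shift t (diracX f) := by
  funext x u
  simp only [diracX, dX_shift, shift]

theorem innerUDx_shift (t : Vec m) (f : Fun₂ m) : innerUDx (shift t f) = shift t (innerUDx f) := by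
  funext x u
  simp only [innerUDx, dX_shift, shift]

theorem innerDuDx_shift (t : Vec m) (f : Fun₂ m) :
    innerDuDx (shift t f) = shift t (innerDuDx f) := by
  funext x u
  simp only [innerDuDx, dX_shift]
  rfl

theorem opD_shift (k : ℕ) (t : Vec m) (f : Fun₂ m) : opD k (shift t f) = shift t (opD k f) := by
  funext x u
  simp only [opD, shift]
  split_ifs
  · simp only [bosonic]
    simp only [lapX_iterate_shift, innerDuDx_shift, innerUDx_shift]
    rfl
  · simp only [fermionic]
    simp only [lapX_iterate_shift, innerDuDx_shift, innerUDx_shift, diracX_shift]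
    rfl

end Translation

/-! ### The kernel on the bundle -/

section BundleKernel

variable {m l k p : ℕ} {c : Vec m → Vec m → Vec m → Cl m}

theorem proj_ne_iff {x y : Vec m} : proj m l x ≠ proj m l y ↔ x - y ∉ lattice m l := by
  rw [ne_eq, eq_comm, QuotientAddGroup.eq, neg_add_eq_sub]

open Classical in
/-- `c(z, u, v) Y`, extended by zero to the lattice. -/
def mulRight (l : ℕ) (c : Vec m → Vec m → Vec m → Cl m) (v : Vec m) (Y : Cl m) : Fun₂ m :=
  fun z u => if z ∈ lattice m l then 0 else c z u v * Y

/-- Right multiplication by Y commutes with derivatives and with left multiplications, so its graph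
is a relation to which `opLin_mem` applies. -/
theorem IsTwistedKernel.opD_mulRight (hc : IsTwistedKernel m l k p c) (v : Vec m) (Y : Cl m)
    {z : Vec m} (hz : z ∉ lattice m l) (u : Vec m) : opD k (mulRight l c v Y) z u = 0 := by
  have hsm : ∀ u, ContDiffOn ℝ ∞ (fun x => c x u v) (offLattice m l) := fun u =>
    (hc.smooth v).comp (contDiff_id.prodMk contDiff_const).contDiffOn fun x hx => ⟨hx, mem_univ u⟩
  have hlin : ∀ x ∉ lattice m l, ∃ L : Vec m →ₗ[ℝ] Cl m, ∀ u, c x u v = L u := fun x hx =>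
    (hc.degree_one x hx v).1
  choose L hL using hlin
  let F : Vec m →ₗ[ℝ] Sm (offLattice m l) :=
    { toFun := fun u => Sm.of (fun x => c x u v) (hsm u)
      map_add' := fun u w => ext_on fun x hx => by
        rw [Sm.add_apply, of_apply hx, of_apply hx, of_apply hx, hL x hx, hL x hx, hL x hx, map_add]
      map_smul' := fun a u => ext_on fun x hx => by
        rw [RingHom.id_apply, Sm.smul_apply, of_apply hx, of_apply hx, hL x hx, hL x hx, map_smul] }
  have hF : Rep (fun y w => c y w v) F := fun x hx u => (of_apply (hg := hsm u) hx).symm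
  have hF0 : opLin k F u = 0 := ext_on fun x hx => by
    rw [← hF.opD k hx u, hc.annihilated x hx u v]
    rfl
  have hR : Rep (mulRight l c v Y) (rm Y ∘ₗ F) := fun x hx u => by
    rw [mulRight, if_neg (mem_offLattice.1 hx), LinearMap.comp_apply, rm_apply, ← hF x hx u]
  rw [hR.opD k hz u]
  let R : Submodule ℝ (Sm (offLattice m l) × Sm (offLattice m l)) := LinearMap.graph (rm Y)
  have h := opLin_mem R (fun w q hq => by
      simp only [R, LinearMap.mem_graph_iff] at hq ⊢
      rw [hq, pd_rm]) (fun a q hq => by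
      simp only [R, LinearMap.mem_graph_iff] at hq ⊢
      rw [hq, rm_lm]) k F (rm Y ∘ₗ F) (fun u => by simp [R]) u
  rw [LinearMap.mem_graph_iff, hF0] at h
  simp only [map_zero] at h
  rw [h]
  rfl

/-- Moving x by a and y by b multiplies c(x - y) by the sign of a - b and Y by the sign of b; the
product is the sign of a, as the bundle identification requires. -/
theorem IsTwistedKernel.mk_eq_mk (hc : IsTwistedKernel m l k p c) {x₀ y₀ x y : Vec m}
    (h : proj m l x₀ ≠ proj m l y₀) (hx : proj m l x₀ = proj m l x) {Y₀ Y : Cl m}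
    (hy : Bundle.mk l p y₀ Y₀ = Bundle.mk l p y Y) (u v : Vec m) :
    Bundle.mk l p x₀ (c (x₀ - y₀) u v * Y₀) = Bundle.mk l p x (c (x - y) u v * Y) := by
  obtain ⟨a, ha, rfl⟩ := proj_eq_iff.1 hx
  obtain ⟨b, hb, rfl, rfl⟩ := Bundle.mk_eq_iff.1 hy
  refine Bundle.mk_eq_iff.2 ⟨a, ha, rfl, ?_⟩
  have h1 : x₀ + emb m a - (y₀ + emb m b) = x₀ - y₀ + emb m (a - b) := by
    rw [map_sub]; abel
  have h2 : sgn p (a - b) * sgn p b = sgn p a := by rw [← sgn_add, sub_add_cancel]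
  rw [h1, hc.periodic _ (sub_mem ha hb) _ (proj_ne_iff.1 h), smul_mul_assoc, mul_smul_comm,
    smul_smul, h2]

theorem IsTwistedKernel.exists_isProjection (hc : IsTwistedKernel m l k p c) :
    ∃ K : BundleKernel m l p, IsProjection c K := by
  -- The value is characterized through all representatives at once, so that it can be chosen
  -- without descending a dependent function through two quotients.
  have hex : ∀ (x' y' : Cyl m l) (_ : x' ≠ y') (u v : Vec m) (η : Fiber p y'),
      ∃ ξ : Fiber p x', ∀ x y Y, proj m l x = x' → η.1 = Bundle.mk l p y Y →
        ξ.1 = Bundle.mk l p x (c (x - y) u v * Y) := by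
    intro x' y' h u v η
    induction x' using Quotient.inductionOn with
    | _ x₀ =>
      induction y' using Quotient.inductionOn with
      | _ y₀ =>
        obtain ⟨Y₀, rfl⟩ := Fiber.exists_rep (l := l) (p := p) y₀ η
        exact ⟨Fiber.mk l p x₀ (c (x₀ - y₀) u v * Y₀), fun x y Y hx hy =>
          hc.mk_eq_mk h hx.symm hy u v⟩
  choose K hK using hex
  exact ⟨K, fun x y h u v Y => Subtype.ext (hK _ _ h u v _ x y Y rfl rfl)⟩

theorem IsProjection.eq {K K' : BundleKernel m l p} (hK : IsProjection c K)
    (hK' : IsProjection c K') : K = K' := by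
  funext x' y' h u v η
  induction x' using Quotient.inductionOn with
  | _ x =>
    induction y' using Quotient.inductionOn with
    | _ y =>
      obtain ⟨Y, rfl⟩ := Fiber.exists_rep (l := l) (p := p) y η
      exact (hK x y h u v Y).trans (hK' x y h u v Y).symm

/-- The equality holds at every x: both sides are set to zero exactly where x - y lies in the
lattice. -/
theorem IsProjection.lift_sec {K : BundleKernel m l p} (hK : IsProjection c K) (y v : Vec m)
    (Y : Cl m) : (K.sec (proj m l y) v (Fiber.mk l p y Y)).lift = shift (-y) (mulRight l c v Y) := by
  funext x u
  rw [Sec.lift, shift, mulRight, ← sub_eq_add_neg]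
  by_cases h : proj m l x ≠ proj m l y
  · have h' : proj m l x ∈ ({proj m l y}ᶜ : Set (Cyl m l)) := h
    rw [dif_pos h', if_neg (proj_ne_iff.1 h)]
    change Fiber.coord x (K (proj m l x) (proj m l y) h u v (Fiber.mk l p y Y)) = _
    rw [hK x y h u v Y, Fiber.coord_mk]
  · have h' : proj m l x ∉ ({proj m l y}ᶜ : Set (Cyl m l)) := h
    rw [dif_neg h', if_pos (not_not.1 (mt proj_ne_iff.2 h))]

theorem IsTwistedKernel.opD_sec (hc : IsTwistedKernel m l k p c) {K : BundleKernel m l p}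
    (hK : IsProjection c K) (y' : Cyl m l) (v : Vec m) (η : Fiber p y')
    (x' : ({y'}ᶜ : Set (Cyl m l))) (u : Vec m) :
    (K.sec y' v η).opD k x' u = Fiber.zero p x'.1 := by
  obtain ⟨x', hx'⟩ := x'
  induction x' using Quotient.inductionOn with
  | _ x =>
    induction y' using Quotient.inductionOn with
    | _ y =>
      obtain ⟨Y, rfl⟩ := Fiber.exists_rep (l := l) (p := p) y η
      have h : proj m l x ≠ proj m l y := hx'
      apply Subtype.ext
      change Bundle.mk l p x (opD k (K.sec (proj m l y) v (Fiber.mk l p y Y)).lift x u)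
        = Bundle.mk l p x 0
      rw [hK.lift_sec, opD_shift, shift, ← sub_eq_add_neg,
        hc.opD_mulRight v Y (proj_ne_iff.1 h)]

theorem IsTwistedKernel.existsUnique_bundleKernel (hc : IsTwistedKernel m l k p c) :
    ∃! K : BundleKernel m l p, IsProjection c K ∧
      ∀ y' v η x' u, (K.sec y' v η).opD k x' u = Fiber.zero p x'.1 := by
  obtain ⟨K, hK⟩ := hc.exists_isProjection
  exact ⟨K, ⟨hK, hc.opD_sec hK⟩, fun K' hK' => hK'.1.eq hK⟩

end BundleKernel

/-! ### The cotangent kernels -/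

section Cotangent

variable {m l k p : ℕ}

/-- The only place where p ≥ 1 enters: it makes the sign of e_1 equal to -1. -/
theorem exists_unit_lat (hp : 1 ≤ p) (hpl : p ≤ l) (hlm : l ≤ m) :
    ∃ (o : Fin m) (δ : Lat m l), (o : ℕ) = 0 ∧ δ.1 = Pi.single o 1 ∧ sgn p δ.1 = -1 := by
  refine ⟨⟨0, by lia⟩, ⟨Pi.single ⟨0, by lia⟩ 1, fun i hi => ?_⟩, rfl, rfl, ?_⟩
  · refine Pi.single_eq_of_ne ?_ _
    rintro rfl
    simp only at hi
    lia
  · have h : (∑ i : Fin m, if (i : ℕ) < p then (Pi.single (⟨0, by lia⟩ : Fin m) 1 : Fin m → ℤ) i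
        else 0) = 1 := by
      rw [Finset.sum_eq_single (⟨0, by lia⟩ : Fin m)]
      · rw [if_pos (show 0 < p by lia), Pi.single_eq_same]
      · intro i _ hi
        rw [Pi.single_eq_of_ne hi, ite_self]
      · simp
    rw [sgn, h, zpow_one]

theorem convergesNormallyOn_twistTerm (hkm : k < m) (hl : l + k + 1 ≤ m) (c₁ : ℝ) (u v : Vec m) :
    ConvergesNormallyOn (twistTerm m l k p c₁ u v) (lattice m l : Set (Vec m))ᶜ := by
  intro K hK hKc
  have h := (decay_famE (l := l + 1) (by lia) hkm c₁ u v).exists_summable_bound_twist (p := p)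
    hKc hK
  simp only [famE_apply hkm] at h
  exact h

theorem cot_eq_periodize (hkm : k < m) (hl : l + k + 1 ≤ m) (c₁ : ℝ) {δ : Lat m l}
    (hδ : sgn p δ.1 = -1) {x : Vec m} (hx : x ∉ lattice m l) (u v : Vec m) :
    cot m l k p c₁ x u v = periodize p δ (fun y => E m k c₁ y u v) x := by
  have h := (decay_famE (l := l + 1) (by lia) hkm c₁ u v).periodize_eq_tsum hδ hx
  simp only [famE_apply hkm] at h
  rw [show (famE k c₁ v u : Vec m → Cl m) = fun y => E m k c₁ y u v from
    funext fun y => famE_apply hkm c₁ y u v] at h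
  exact h.symm

theorem tendstoUniformlyOn_symPartial (hkm : k < m) (hl : l + k = m) (c₁ : ℝ) {o : Fin m}
    (ho : (o : ℕ) = 0) {δ : Lat m l} (hδo : δ.1 = Pi.single o 1) (hδ : sgn p δ.1 = -1)
    (u v : Vec m) {K : Set (Vec m)} (hK : IsCompact K)
    (hKl : K ⊆ (lattice m l : Set (Vec m))ᶜ) :
    TendstoUniformlyOn (symPartial m l k p c₁ u v) (periodize p δ fun y => E m k c₁ y u v)
      atTop K := by
  have h := tendstoUniformlyOn_sum_latBox (p := p) (decay_famE hl.le hkm c₁ u v) (by lia) ho hδo hδ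
    hK hKl
  rw [show (famE k c₁ v u : Vec m → Cl m) = fun y => E m k c₁ y u v from
    funext fun y => famE_apply hkm c₁ y u v] at h
  exact h.congr (Eventually.of_forall fun N x _ => (symPartial_eq_sum_latBox k N c₁ u v x).symm)

theorem tendsto_symPartial (hkm : k < m) (hl : l + k = m) (c₁ : ℝ) {o : Fin m}
    (ho : (o : ℕ) = 0) {δ : Lat m l} (hδo : δ.1 = Pi.single o 1) (hδ : sgn p δ.1 = -1)
    (u v : Vec m) {x : Vec m} (hx : x ∉ lattice m l) :
    Tendsto (fun N => symPartial m l k p c₁ u v N x) atTop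
      (𝓝 (periodize p δ (fun y => E m k c₁ y u v) x)) :=
  (tendstoUniformlyOn_symPartial hkm hl c₁ ho hδo hδ u v (isCompact_singleton (x := x))
    (by simpa using hx)).tendsto_at rfl

theorem cotSym_eq_periodize (hkm : k < m) (hl : l + k = m) (c₁ : ℝ) {o : Fin m}
    (ho : (o : ℕ) = 0) {δ : Lat m l} (hδo : δ.1 = Pi.single o 1) (hδ : sgn p δ.1 = -1)
    {x : Vec m} (hx : x ∉ lattice m l) (u v : Vec m) :
    cotSym m l k p c₁ x u v = periodize p δ (fun y => E m k c₁ y u v) x :=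
  (tendsto_symPartial hkm hl c₁ ho hδo hδ u v hx).limUnder_eq

/-- The boxes exhaust Λ_l, so under absolute convergence the limit over boxes is the unordered sum.
-/
theorem cotSym_eq_tsum (hk : Odd k) (hkm : k < m) (hl : l + k = m) (c₁ : ℝ) {x : Vec m}
    (hx : x ∉ lattice m l) (u v : Vec m) :
    cotSym m l k p c₁ x u v
      = E m k c₁ x u v + ∑' a : latPos m l, symTerm m k p c₁ u v a x := by
  obtain ⟨b, hb, h⟩ := exists_summable_bound_symTerm (p := p) hk hl.le hkm c₁ u v
    (isCompact_singleton (x := x)) (by simpa using hx)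
  have hs : Summable fun a : latPos m l => symTerm m k p c₁ u v a x :=
    Summable.of_norm_bounded hb fun a => h a x rfl
  exact ((tendsto_sum_posBox (h := fun a => symTerm m k p c₁ u v a x) hs.hasSum).const_add
    (E m k c₁ x u v)).limUnder_eq

end Cotangent

end SpinCylinder

end

theorem mainTheorem3 (m k : ℕ) (hk : 1 ≤ k) (hkm : k < m) (c₁ : ℝ) (hc₁ : c₁ ≠ 0) :
    -- `Z₁` is the reproducing kernel
    (IsReproducingKernel m k (Z₁ m k) ∧ ∀ Z, IsReproducingKernel m k Z → Z = Z₁ m k) ∧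
    -- the case `1 ≤ l ≤ m - k - 1`
    (∀ l p : ℕ, 1 ≤ p → p ≤ l → l + k + 1 ≤ m →
      (∀ u v, ConvergesNormallyOn (twistTerm m l k p c₁ u v) (lattice m l : Set (Vec m))ᶜ) ∧
      IsTwistedKernel m l k p (cot m l k p c₁) ∧
      ∃! K : BundleKernel m l p, IsProjection (cot m l k p c₁) K ∧
        ∀ y' v η x' u, (K.sec y' v η).opD k x' u = Fiber.zero p x'.1) ∧
    -- the case `l = m - k`
    (∀ l p : ℕ, 1 ≤ p → p ≤ l → l + k = m →
      (∀ u v, TendstoLocallyUniformlyOn (symPartial m l k p c₁ u v)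
        (fun x => cotSym m l k p c₁ x u v) Filter.atTop (lattice m l : Set (Vec m))ᶜ) ∧
      (Odd k → ∀ u v,
        ConvergesNormallyOn (fun a : latPos m l => symTerm m k p c₁ u v a)
          (lattice m l : Set (Vec m))ᶜ ∧
        ∀ x ∉ lattice m l, cotSym m l k p c₁ x u v =
          E m k c₁ x u v + ∑' a : latPos m l, symTerm m k p c₁ u v a x) ∧
      IsTwistedKernel m l k p (cotSym m l k p c₁) ∧
      ∃! K : BundleKernel m l p, IsProjection (cotSym m l k p c₁) K ∧
        ∀ y' v η x' u, (K.sec y' v η).opD k x' u = Fiber.zero p x'.1) := by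
  have hm : 0 < m := by lia
  refine ⟨⟨isReproducingKernel_Z₁ hm, fun Z hZ => hZ.unique (isReproducingKernel_Z₁ hm)⟩,
    fun l p hp hpl hl => ?_, fun l p hp hpl hl => ?_⟩
  · obtain ⟨o, δ, ho, hδo, hδ⟩ := exists_unit_lat hp hpl (by lia : l ≤ m)
    have hker : IsTwistedKernel m l k p (cot m l k p c₁) :=
      isTwistedKernel_of_periodize hk hkm (by lia) fun x hx u v =>
        cot_eq_periodize hkm hl c₁ hδ hx u v
    exact ⟨convergesNormallyOn_twistTerm hkm hl c₁, hker, hker.existsUnique_bundleKernel⟩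
  · obtain ⟨o, δ, ho, hδo, hδ⟩ := exists_unit_lat hp hpl (by lia : l ≤ m)
    have hcot : ∀ x ∉ lattice m l, ∀ u v,
        cotSym m l k p c₁ x u v = periodize p δ (fun y => E m k c₁ y u v) x := fun x hx u v =>
      cotSym_eq_periodize hkm hl c₁ ho hδo hδ hx u v
    have hker : IsTwistedKernel m l k p (cotSym m l k p c₁) :=
      isTwistedKernel_of_periodize hk hkm hl.le hcot
    refine ⟨fun u v => ?_, fun hodd u v => ⟨fun K hK hKc =>
      exists_summable_bound_symTerm hodd hl.le hkm c₁ u v hKc hK, fun x hx =>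
      cotSym_eq_tsum hodd hkm hl c₁ hx u v⟩, hker, hker.existsUnique_bundleKernel⟩
    rw [tendstoLocallyUniformlyOn_iff_forall_isCompact (isClosed_lattice m l).isOpen_compl]
    exact fun K hK hKc => (tendstoUniformlyOn_symPartial hkm hl c₁ ho hδo hδ u v hKc hK).congr_right
      fun x hx => (hcot x (hK hx) u v).symm
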